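/- Let $N\ge 1$ be an integer and $\hbar>0$. Consider triangular arrays $(\gamma_{nj})_{1\le j\le n\le N}$ of complex numbers, write $\boldsymbol\gamma_n=(\gamma_{n1},\dots,\gamma_{nn})$, and set $\gamma_{nj}=0$ for $j>n$. The level $\boldsymbol\gamma_N$ is a parameter. In the Gelfand–Zetlin representation of $\mathfrak{gl}(N)$ the generators act on functions of $\boldsymbol\gamma_1,\dots,\boldsymbol\gamma_{N-1}$ by $$E_{nn}=\frac1{i\hbar}\Big(\sum_{j=1}^n\gamma_{nj}-\sum_{j=1}^{n-1}\gamma_{n-1,j}\Big)\quad(1\le n\le N),$$ $$E_{n,n+1}=-\frac1{i\hbar}\sum_{j=1}^n\frac{\prod_{r=1}^{n+1}(\gamma_{nj}-\gamma_{n+1,r}-\frac{i\hbar}2)}{\prod_{s\ne j}(\gamma_{nj}-\gamma_{ns})}e^{-i\hbar\partial_{\gamma_{nj}}},\qquad E_{n+1,n}=\frac1{i\hbar}\sum_{j=1}^n\frac{\prod_{r=1}^{n-1}(\gamma_{nj}-\gamma_{n-1,r}+\frac{i\hbar}2)}{\prod_{s\ne j}(\gamma_{nj}-\gamma_{ns})}e^{i\hbar\partial_{\gamma_{nj}}}\quad(1\le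 n\le N-1),$$ where $e^{\pm i\hbar\partial_{\gamma_{nj}}}$ replaces $\gamma_{nj}$ by $\gamma_{nj}\pm i\hbar$. Put $w'_N=1$ and $$w_N=e^{-\frac{\pi}{\hbar}\sum_{n=1}^{N-1}(n-1)\sum_{j=1}^n\gamma_{nj}}\prod_{n=1}^{N-1}\prod_{k=1}^n\prod_{m=1}^{n+1}\hbar^{\frac{\gamma_{nk}-\gamma_{n+1,m}}{i\hbar}+\frac12}\,\Gamma\Big(\frac{\gamma_{nk}-\gamma_{n+1,m}}{i\hbar}+\frac12\Big),$$ and for $\boldsymbol\gamma_N\in\mathbb R^N$ let $\langle\phi,\psi\rangle=\int_{\mathbb R^{N(N-1)/2}}\mu_0\,\overline{\phi}\,\psi\,\prod_{j\le n\le N-1}d\gamma_{nj}$ with $\mu_0=\prod_{n=2}^{N-1}\prod_{s<p}(\gamma_{ns}-\gamma_{np})\big(e^{2\pi\gamma_{np}/\hbar}-e^{2\pi\gamma_{ns}/\hbar}\big)$. Let $\rho^{(N)}_k=\frac12(N-2k+1)$ and $\boldsymbol x\cdot\boldsymbol\rho^{(N)}=\sum_k x_k\rho^{(N)}_k$. **Theorem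 5.1.** (i) $w_N$ and $w_N'$ are Whittaker vectors: for $n=1,\dots,N-1$, $E_{n,n+1}w_N=-\frac i\hbar w_N$ and $E_{n+1,n}w'_N=-\frac i\hbar w'_N$, as identities of meromorphic functions (they hold at every array with $\gamma_{ns}\ne\gamma_{np}$ for $s\neq p$ and $\frac{\gamma_{nk}-\gamma_{n+1,m}}{i\hbar}+\frac12\notin\mathbb Z$ for all $n\le N-1$, $k\le n$, $m\le n+1$). (ii) For $\boldsymbol\gamma_N,\boldsymbol x\in\mathbb R^N$ the integral defining the Whittaker matrix element $\langle w'_N,e^{-\sum_k x_kE_{kk}}w_N\rangle$ converges absolutely, and $$e^{-\boldsymbol x\cdot\boldsymbol\rho^{(N)}}\langle w'_N,e^{-\sum_k x_kE_{kk}}w_N\rangle=(-2\pi\hbar)^{\binom N3}\,\psi_{\boldsymbol\gamma_N}(\boldsymbol x),$$ where $\psi_{\boldsymbol\gamma_N}(\boldsymbol x)$ is given by the absolutely convergent integral $$\psi_{\boldsymbol\gamma_N}(\boldsymbol x)=e^{-\boldsymbol x\cdot\boldsymbol\rho^{(N)}}\int_{\mathbb R^{N(N-1)/2}}\prod_{n=1}^{N-1}\frac{\prod_{k=1}^n\prod_{m=1}^{n+1}\hbar^{\frac{\gamma_{nk}-\gamma_{n+1,m}}{i\hbar}+\frac12}\Gamma\big(\frac{\gamma_{nk}-\gamma_{n+1,m}}{i\hbar}+\frac12\big)}{\prod_{s<p}\big|\Gamma\big(\frac{\gamma_{ns}-\gamma_{np}}{i\hbar}\big)\big|^2}\;e^{\frac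 i\hbar\sum_{n,j=1}^N(\gamma_{nj}-\gamma_{n-1,j})x_n}\prod_{j\le n\le N-1}d\gamma_{nj}.\tag{wf1}$$ (iii) For every $\boldsymbol x\in\mathbb R^N$ the function $\boldsymbol\gamma_N\mapsto\psi_{\boldsymbol\gamma_N}(\boldsymbol x)$ on $\mathbb R^N$ extends to a holomorphic function on $\mathbb C^N$, denoted by the same symbol. For every $\boldsymbol\gamma_N\in\mathbb C^N$, $$\psi_{\boldsymbol\gamma_N}(\boldsymbol x)=\int_{\mathcal S}\prod_{n=1}^{N-1}\frac{\prod_{k=1}^n\prod_{m=1}^{n+1}\hbar^{\frac{\gamma_{nk}-\gamma_{n+1,m}}{i\hbar}}\Gamma\big(\frac{\gamma_{nk}-\gamma_{n+1,m}}{i\hbar}\big)}{\prod_{s\ne p}\Gamma\big(\frac{\gamma_{ns}-\gamma_{np}}{i\hbar}\big)}\;e^{\frac i\hbar\sum_{n,j=1}^N(\gamma_{nj}-\gamma_{n-1,j})x_n}\prod_{j\le n\le N-1}d\gamma_{nj},\tag{wf6}$$ where $\mathcal S$ is any product of horizontal lines $\operatorname{Im}\gamma_{nj}=c_{nj}$ ($1\le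 j\le n\le N-1$) on which $\min_j\operatorname{Im}\gamma_{kj}>\max_m\operatorname{Im}\gamma_{k+1,m}$ for all $k=1,\dots,N-1$. The integral (wf6) converges absolutely. (iv) $\psi$ is a wave function of the open $GL(N,\mathbb R)$ Toda chain: for every $\boldsymbol\gamma_N\in\mathbb C^N$ the function $\boldsymbol x\mapsto\psi_{\boldsymbol\gamma_N}(\boldsymbol x)$ is smooth on $\mathbb R^N$ and $$A_N(\lambda)\,\psi_{\boldsymbol\gamma_N}=\prod_{j=1}^N(\lambda-\gamma_{Nj})\,\psi_{\boldsymbol\gamma_N}\qquad(\lambda\in\mathbb C),$$ where $A_{-1}=0$, $A_0=1$, $A_n(\lambda)=(\lambda-p_n)A_{n-1}(\lambda)-e^{x_{n-1}-x_n}A_{n-2}(\lambda)$ and $p_n=-i\hbar\,\partial/\partial x_n$; the coefficients of $A_N(\lambda)=\sum_k(-1)^k\lambda^{N-k}h_k$ are the Toda Hamiltonians, $h_1=\sum_jp_j$, $h_2=\sum_{j<k}p_jp_k-\sum_{j=1}^{N-1}e^{x_j-x_{j+1}}$, etc. -/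

import Mathlib

noncomputable section

namespace TodaGZ

/-! ### Triangular arrays

An array `a : ℕ → ℕ → ℂ` stands for the triangular array `γ_{n,j}`: the level `n` is counted from
`1`, and the entries of level `n` are `a n 0, …, a n (n-1)`. -/

/-- Arrays of complex numbers `a n j = γ_{n,j+1}`. -/
abbrev GZArray : Type := ℕ → ℕ → ℂ

/-- A family of entries (in `R`) for the levels `1, …, N-1` of a triangular array: level `n` has
`n` entries (level `0` is empty), so there are `N(N-1)/2` entries altogether. -/
abbrev Low (R : Type) (N : ℕ) : Type := (n : Fin N) → Fin (n : ℕ) → R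

/-- The triangular array with levels `1, …, N-1` given by `low` and level `N` given by `top`;
all other entries are zero. -/
def fullArray (N : ℕ) (top : Fin N → ℂ) (low : Low ℂ N) : GZArray := fun n j =>
  if hn : n < N then (if hj : j < n then low ⟨n, hn⟩ ⟨j, hj⟩ else 0)
  else if n = N then (if hj : j < N then top ⟨j, hj⟩ else 0)
  else 0

/-- `∑_{j=1}^n γ_{n,j}`. -/
def rowSum (a : GZArray) (n : ℕ) : ℂ := ∑ j ∈ Finset.range n, a n j

/-- `(γ_{n,k} - γ_{l,m}) / (iℏ)`. -/
def scaledDiff (ℏ : ℝ) (a : GZArray) (n k l m : ℕ) : ℂ :=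
  (a n k - a l m) / (Complex.I * ℏ)

/-- The array `a` with the entry `γ_{n,j}` replaced by `γ_{n,j} + s`. -/
def shiftEntry (a : GZArray) (n j : ℕ) (s : ℂ) : GZArray :=
  Function.update a n (Function.update (a n) j (a n j + s))

/-! ### The Gelfand–Zetlin representation of `gl(N)` by difference operators

The operators act on functions of the array; the top level is never shifted, it is the label. -/

/-- The function by which the Cartan generator `E_{nn}` multiplies (`n ≥ 1`). -/
def cartanSymbol (ℏ : ℝ) (n : ℕ) (a : GZArray) : ℂ :=
  1 / (Complex.I * ℏ) * (rowSum a n - rowSum a (n - 1))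

/-- `E_{nn}`. -/
def opE (ℏ : ℝ) (n : ℕ) (F : GZArray → ℂ) : GZArray → ℂ := fun a => cartanSymbol ℏ n a * F a

/-- `E_{n,n+1}`, with `e^{-iℏ∂}` the shift of the variable by `-iℏ`. -/
def opRaise (ℏ : ℝ) (n : ℕ) (F : GZArray → ℂ) : GZArray → ℂ := fun a =>
  -(1 / (Complex.I * ℏ)) * ∑ j ∈ Finset.range n,
    (∏ r ∈ Finset.range (n + 1), (a n j - a (n + 1) r - Complex.I * ℏ / 2)) /
      (∏ s ∈ (Finset.range n).erase j, (a n j - a n s)) *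
      F (shiftEntry a n j (-(Complex.I * ℏ)))

/-- `E_{n+1,n}`. -/
def opLower (ℏ : ℝ) (n : ℕ) (F : GZArray → ℂ) : GZArray → ℂ := fun a =>
  1 / (Complex.I * ℏ) * ∑ j ∈ Finset.range n,
    (∏ r ∈ Finset.range (n - 1), (a n j - a (n - 1) r + Complex.I * ℏ / 2)) /
      (∏ s ∈ (Finset.range n).erase j, (a n j - a n s)) *
      F (shiftEntry a n j (Complex.I * ℏ))

/-- The operator `e^{-∑ x_k E_{kk}}`. Since `E_{kk}` is the operator of multiplication by
`cartanSymbol ℏ k`, it is the multiplication by the exponential of the symbol. -/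
def cartanTorus (ℏ : ℝ) (N : ℕ) (x : Fin N → ℝ) (F : GZArray → ℂ) : GZArray → ℂ := fun a =>
  Complex.exp (-∑ k : Fin N, (x k : ℂ) * cartanSymbol ℏ (k + 1) a) * F a

/-! ### Whittaker vectors and the pairing -/

/-- `s_n(γ_n, γ_{n+1})`. -/
def sFactor (ℏ : ℝ) (n : ℕ) (a : GZArray) : ℂ :=
  ∏ k ∈ Finset.range n, ∏ m ∈ Finset.range (n + 1),
    (ℏ : ℂ) ^ (scaledDiff ℏ a n k (n + 1) m + 1 / 2) *
      Complex.Gamma (scaledDiff ℏ a n k (n + 1) m + 1 / 2)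

/-- The Whittaker vector `w_N`. -/
def whittakerVec (ℏ : ℝ) (N : ℕ) : GZArray → ℂ := fun a =>
  Complex.exp (-((Real.pi : ℂ) / ℏ) * ∑ n ∈ Finset.Ico 1 N, ((n : ℂ) - 1) * rowSum a n) *
    ∏ n ∈ Finset.Ico 1 N, sFactor ℏ n a

/-- The dual Whittaker vector `w'_N`. -/
def dualWhittakerVec : GZArray → ℂ := fun _ => 1

/-- The arrays off the hyperplanes where the coefficients of the generators or the Gamma factors
of `w_N` and of its shifts have poles. -/
def Regular (ℏ : ℝ) (N : ℕ) (a : GZArray) : Prop :=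
  (∀ n ∈ Finset.Ico 1 N, ∀ s ∈ Finset.range n, ∀ p ∈ Finset.range n, s ≠ p → a n s ≠ a n p) ∧
  (∀ n ∈ Finset.Ico 1 N, ∀ k ∈ Finset.range n, ∀ m ∈ Finset.range (n + 1), ∀ z : ℤ,
    scaledDiff ℏ a n k (n + 1) m + 1 / 2 ≠ (z : ℂ))

/-- The density `μ_0` of the pairing. -/
def muZero (ℏ : ℝ) (N : ℕ) (a : GZArray) : ℂ :=
  ∏ n ∈ Finset.Ico 2 N, ∏ p ∈ Finset.range n, ∏ s ∈ Finset.range p,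
    (a n s - a n p) *
      (Complex.exp (2 * Real.pi * a n p / ℏ) - Complex.exp (2 * Real.pi * a n s / ℏ))

/-- The integrand of the pairing of `φ` and `ψ`, for the label `top`. -/
def pairingIntegrand (ℏ : ℝ) (N : ℕ) (top : Fin N → ℝ) (φ ψ : GZArray → ℂ) (t : Low ℝ N) : ℂ :=
  let a := fullArray N (fun j => (top j : ℂ)) (fun n j => (t n j : ℂ))
  muZero ℏ N a * (starRingEnd ℂ) (φ a) * ψ a

/-- The pairing `⟨φ, ψ⟩ = ∫_{ℝ^{N(N-1)/2}} μ_0 φ̄ ψ dγ`. -/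
def pairing (ℏ : ℝ) (N : ℕ) (top : Fin N → ℝ) (φ ψ : GZArray → ℂ) : ℂ :=
  ∫ t : Low ℝ N, pairingIntegrand ℏ N top φ ψ t

/-- `ρ^{(N)}_k = (N - 2k + 1) / 2`, `k = 1, …, N`. -/
def rho (N k : ℕ) : ℝ := ((N : ℝ) - 2 * k + 1) / 2

/-- `e^{-x·ρ^{(N)}}`. -/
def rhoFactor (N : ℕ) (x : Fin N → ℝ) : ℂ :=
  Complex.exp (-∑ k : Fin N, ((x k * rho N (k + 1) : ℝ) : ℂ))

/-! ### The two integral formulas -/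

/-- `e^{(i/ℏ) ∑_{n,j} (γ_{n,j} - γ_{n-1,j}) x_n}`. -/
def planeWave (ℏ : ℝ) (N : ℕ) (x : Fin N → ℝ) (a : GZArray) : ℂ :=
  Complex.exp (Complex.I / ℏ * ∑ n : Fin N, (rowSum a (n + 1) - rowSum a n) * (x n : ℂ))

/-- The integrand of the integral over real arrays. -/
def realIntegrand (ℏ : ℝ) (N : ℕ) (x : Fin N → ℝ) (a : GZArray) : ℂ :=
  (∏ n ∈ Finset.Ico 1 N,
    (∏ k ∈ Finset.range n, ∏ m ∈ Finset.range (n + 1),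
      (ℏ : ℂ) ^ (scaledDiff ℏ a n k (n + 1) m + 1 / 2) *
        Complex.Gamma (scaledDiff ℏ a n k (n + 1) m + 1 / 2)) /
    (∏ p ∈ Finset.range n, ∏ s ∈ Finset.range p,
      ((‖Complex.Gamma (scaledDiff ℏ a n s n p)‖ ^ 2 : ℝ) : ℂ))) *
  planeWave ℏ N x a

/-- The real array with label `γ_N = top` and remaining entries `t`. -/
def realArray (N : ℕ) (top : Fin N → ℝ) (t : Low ℝ N) : GZArray :=
  fullArray N (fun j => (top j : ℂ)) (fun n j => (t n j : ℂ))

/-- The integrand of the Mellin–Barnes integral. (`Complex.Gamma` takes the value `0` at its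
poles, so that `1 / Complex.Gamma` is the entire function `1 / Γ`.) -/
def mbIntegrand (ℏ : ℝ) (N : ℕ) (x : Fin N → ℝ) (a : GZArray) : ℂ :=
  (∏ n ∈ Finset.Ico 1 N,
    (∏ k ∈ Finset.range n, ∏ m ∈ Finset.range (n + 1),
      (ℏ : ℂ) ^ (scaledDiff ℏ a n k (n + 1) m) *
        Complex.Gamma (scaledDiff ℏ a n k (n + 1) m)) /
    (∏ s ∈ Finset.range n, ∏ p ∈ (Finset.range n).erase s,
      Complex.Gamma (scaledDiff ℏ a n s n p))) *
  planeWave ℏ N x a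

/-- `min_j Im γ_{k,j} > max_m Im γ_{k+1,m}` for `k = 1, …, N-1`. -/
def InShiftedDomain (N : ℕ) (a : GZArray) : Prop :=
  ∀ n ∈ Finset.Ico 1 N, ∀ j ∈ Finset.range n, ∀ m ∈ Finset.range (n + 1),
    (a (n + 1) m).im < (a n j).im

/-- The array with label `top` whose entry `γ_{n,j}` below the top level is the point with real
part `t n j` of the horizontal line `Im = c n j`. -/
def lineArray (N : ℕ) (top : Fin N → ℂ) (c t : Low ℝ N) : GZArray :=
  fullArray N top (fun n j => (t n j : ℂ) + (c n j : ℂ) * Complex.I)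

/-- The product of the horizontal lines `Im γ_{n,j} = c n j` lies in the shifted domain. -/
def AdmissibleHeights (N : ℕ) (top : Fin N → ℂ) (c : Low ℝ N) : Prop :=
  ∀ t : Low ℝ N, InShiftedDomain N (lineArray N top c t)

/-! ### The open Toda chain -/

/-- The momentum `p_k = -iℏ ∂/∂x_k`. -/
def momentum (ℏ : ℝ) {N : ℕ} (k : Fin N) (f : (Fin N → ℝ) → ℂ) : (Fin N → ℝ) → ℂ := fun x =>
  -(Complex.I * ℏ) * fderiv ℝ f x (Pi.single k 1)

/-- The generating polynomials of the Toda Hamiltonians: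
`A_n(λ) = (λ - p_n) A_{n-1}(λ) - e^{x_{n-1} - x_n} A_{n-2}(λ)`, `A_0 = 1`, `A_{-1} = 0`,
applied to a function `f` of `x_1, …, x_N`. The coefficient of `λ^{N-k}` in `A_N(λ)` is
`(-1)^k` times the `k`-th Hamiltonian of the chain with `N` particles. -/
def todaA (ℏ : ℝ) (N : ℕ) (lam : ℂ) (f : (Fin N → ℝ) → ℂ) :
    (n : ℕ) → n ≤ N → (Fin N → ℝ) → ℂ
  | 0, _ => f
  | 1, h => fun x => lam * f x - momentum ℏ ⟨0, h⟩ f x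
  | n + 2, h => fun x =>
      lam * todaA ℏ N lam f (n + 1) (by omega) x
        - momentum ℏ ⟨n + 1, h⟩ (todaA ℏ N lam f (n + 1) (by omega)) x
        - Complex.exp ((x ⟨n, by omega⟩ - x ⟨n + 1, h⟩ : ℝ) : ℂ) *
            todaA ℏ N lam f n (by omega) x

end TodaGZ

end

/-!
The Mellin–Barnes integrand is treated as one function on the whole space of triangular arrays.
By the reflection formula `1 / (Γ(w) Γ(-w)) = -w sin(πw) / π` it is a polynomial in the entries
(`diffProduct`) times a product of `ℏ ^ z Γ(z)`, of sines and of the plane wave (`gammaSin`,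
`planeWaveC`).

*Decay.* On a product of horizontal lines, `|Γ(z)|` is at most a constant times
`exp (-(π/2 - η) |Im z|)` for every `η > 0` (rotation of the ray in Euler's integral,
`norm_Gamma_le_exp`), and `|sin(πw)| ≤ exp (π |Im w|)`. The sum of the exponents is controlled by
the energy inequality `∑ |x_k - x_l| + ∑ |y_k - y_l| ≤ 2 ∑ |x_k - y_m|` for `n` points `x` and
`n + 1` points `y` (`sum_abs_sub_add_sum_abs_sub_le`), which telescopes over the levels and leaves
a strictly negative multiple of the norm of the array (`exists_pos_mul_sum_le_sum_cross_sub`). The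
small losses `η`, the polynomial factors, and a small imaginary part of the positions `x` are then
absorbed. The bounds are locally uniform in all parameters, so that the integral is holomorphic in
the heights of the lines, the label and the positions together
(`integrable_and_hasFDerivAt_integral_integrand`).

*Contours.* No form of Cauchy's theorem is needed: the integral `G(w) = ∫ F(w + t) dt` over real
translations `t` is invariant under real translations of `w`, hence its complex derivative
vanishes in the real directions, hence by linearity in the imaginary ones too
(`integral_translate_eq_of_segment`). This gives the independence of the heights and therefore the
entire continuation in the label (`waveFunction`).

*Toda chain.* The momentum `p_k` multiplies the integrand by `∑ γ_{k,j} - ∑ γ_{k-1,j}`. By induction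
`A_n(λ)` multiplies it by `∏_j (λ - γ_{n,j})`. The induction step is Lagrange interpolation at the
nodes `γ_{n,1}, …, γ_{n,n}` of the polynomials attached to the levels `n - 1` and `n + 1`
(`sum_prod_sub_mul_prod_div_prod`, `sum_prod_sub_mul_prod_div_prod_pred`), combined with the shift
of the line of `γ_{n,j}` by `iℏ`, which exchanges `∏_k (γ_{n,j} - γ_{n-1,k})` for
`-e^{x_{n+1} - x_n} ∏_m (γ_{n,j} - γ_{n+1,m})` (`lineIntegral_mul_prod_sub`). The shift meets no
pole: the factor `∏_k (γ_{n,j} - γ_{n-1,k})` turns `Γ(z)` into `Γ(z + 1)`, and the denominators of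
the interpolation formula divide the difference product.

*Real arrays.* For a real label, the lines at the heights `ℏ (N - n) / 2` turn the Mellin–Barnes
integrand into the integrand over real arrays times `e^{-x·ρ}`, point by point; and the density of
the pairing times the exponential factor of the Whittaker vector is a power of `-2πℏ` over
`∏ |Γ|²`, again point by point. The Whittaker property itself is `Γ(z + 1) = z Γ(z)` together with
the Lagrange identity `sum_prod_sub_div_prod`.
-/

open Filter Topology MeasureTheory

noncomputable section

namespace TodaGZ

/-! ### Integrals depending holomorphically on parameters -/

theorem aestronglyMeasurable_clm_of_apply {E Ω : Type*} [NormedAddCommGroup E] [NormedSpace ℂ E]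
    [FiniteDimensional ℂ E] [MeasurableSpace Ω] {μ : Measure Ω} {g : Ω → E →L[ℂ] ℂ}
    (hg : ∀ v, AEStronglyMeasurable (fun t => g t v) μ) : AEStronglyMeasurable g μ := by
  let b := Module.finBasis ℂ E
  have key : g = fun t => ∑ i, g t (b i) • LinearMap.toContinuousLinearMap (b.coord i) := by
    funext t
    ext v
    conv_lhs => rw [← b.sum_repr v, map_sum]
    simp [mul_comm]
  rw [key]
  exact Finset.aestronglyMeasurable_fun_sum _ fun i _ => (hg (b i)).smul_const _

/-- Differentiation under the integral sign for holomorphic integrands: a bound on the values of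
the integrand suffices, since the Schwarz lemma turns it into a bound on the derivative. -/
theorem hasFDerivAt_integral_of_holomorphic {E Ω : Type*} [NormedAddCommGroup E] [NormedSpace ℂ E]
    [FiniteDimensional ℂ E] [MeasurableSpace Ω] {μ : Measure Ω} {f : E → Ω → ℂ} {w₀ : E}
    {g : Ω → ℝ} (hg : Integrable g μ)
    (hmeas : ∀ᶠ w in 𝓝 w₀, AEStronglyMeasurable (f w) μ)
    (hd : ∀ᶠ w in 𝓝 w₀, ∀ t, DifferentiableAt ℂ (fun w => f w t) w)
    (hb : ∀ᶠ w in 𝓝 w₀, ∀ t, ‖f w t‖ ≤ g t) :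
    Integrable (fun t => fderiv ℂ (fun w => f w t) w₀) μ ∧
    HasFDerivAt (fun w => ∫ t, f w t ∂μ) (∫ t, fderiv ℂ (fun w => f w t) w₀ ∂μ) w₀ := by
  obtain ⟨r, hr, hball⟩ := Metric.eventually_nhds_iff_ball.1 (hd.and hb)
  have hr2 : 0 < r / 2 := by positivity
  have hg0 : ∀ t, 0 ≤ g t := fun t =>
    (norm_nonneg _).trans ((hball w₀ (Metric.mem_ball_self hr)).2 t)
  have hsub : ∀ x ∈ Metric.ball w₀ (r / 2), Metric.ball x (r / 2) ⊆ Metric.ball w₀ r := by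
    intro x hx y hy
    rw [Metric.mem_ball] at *
    linarith [dist_triangle y x w₀]
  have hbound : ∀ t, ∀ x ∈ Metric.ball w₀ (r / 2),
      ‖fderiv ℂ (fun w => f w t) x‖ ≤ 2 * g t / (r / 2) := by
    intro t x hx
    refine Complex.norm_fderiv_le_div_of_mapsTo_ball ?_ ?_ hr2
    · exact fun y hy => ((hball y (hsub x hx hy)).1 t).differentiableWithinAt
    · intro y hy
      rw [Metric.mem_closedBall, dist_eq_norm]
      have h1 := (hball y (hsub x hx hy)).2 t
      have h2 := (hball x (hsub x hx (Metric.mem_ball_self hr2))).2 t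
      exact (norm_sub_le _ _).trans (by linarith)
  -- the derivative is measurable in `t` as a limit of difference quotients
  have hm' : AEStronglyMeasurable (fun t => fderiv ℂ (fun w => f w t) w₀) μ := by
    refine aestronglyMeasurable_clm_of_apply fun v => ?_
    have hlim : Tendsto (fun n : ℕ => w₀ + ((n : ℂ) + 1)⁻¹ • v) atTop (𝓝 w₀) := by
      have : Tendsto (fun n : ℕ => ((n : ℂ) + 1)⁻¹) atTop (𝓝 0) := by
        simpa using tendsto_one_div_add_atTop_nhds_zero_nat (𝕜 := ℂ)
      simpa using (tendsto_const_nhds (x := w₀)).add (this.smul_const v)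
    obtain ⟨n₀, hn₀⟩ := eventually_atTop.1 (hlim.eventually hmeas)
    refine aestronglyMeasurable_of_tendsto_ae atTop
      (f := fun (n : ℕ) t => (((n + n₀ : ℕ) : ℂ) + 1) *
        (f (w₀ + (((n + n₀ : ℕ) : ℂ) + 1)⁻¹ • v) t - f w₀ t)) (fun n => ?_) ?_
    · exact ((hn₀ _ (Nat.le_add_left _ _)).sub hmeas.self_of_nhds).const_mul _
    · refine Eventually.of_forall fun t => ?_
      have hfd := ((hball w₀ (Metric.mem_ball_self hr)).1 t).hasFDerivAt
      have := hfd.lim v (c := fun n : ℕ => (((n + n₀ : ℕ) : ℂ) + 1)) (l := atTop) ?_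
      · simpa [smul_eq_mul] using this
      · have : Tendsto (fun n : ℕ => (((n + n₀ : ℕ) : ℝ) + 1)) atTop atTop :=
          tendsto_atTop_add_const_right _ _
            (tendsto_natCast_atTop_atTop.comp (tendsto_add_atTop_nat n₀))
        refine tendsto_atTop_mono (fun n => ?_) this
        have : ((n + n₀ : ℕ) : ℂ) + 1 = (((n + n₀ + 1 : ℕ)) : ℂ) := by push_cast; ring
        rw [this, Complex.norm_natCast]
        push_cast; rfl
  refine ⟨?_, ?_⟩
  · refine Integrable.mono' ((hg.const_mul 2).div_const (r / 2)) hm' (Eventually.of_forall fun t => ?_)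
    exact hbound t w₀ (Metric.mem_ball_self hr2)
  · refine hasFDerivAt_integral_of_dominated_of_fderiv_le (bound := fun t => 2 * g t / (r / 2))
      (Metric.ball_mem_nhds w₀ hr2) hmeas ?_ hm' (Eventually.of_forall hbound)
      ((hg.const_mul 2).div_const (r / 2)) (Eventually.of_forall fun t x hx => ?_)
    · exact hg.mono' hmeas.self_of_nhds (Eventually.of_forall (hball w₀ (Metric.mem_ball_self hr)).2)
    · exact ((hball x (Metric.ball_subset_ball (by linarith) hx)).1 t).hasFDerivAt

/-! ### Shifts of contours -/

/-- If `w ↦ ∫ F (w + ι t) dt` is holomorphic along the segment from `w` to `w + i ι d`, it takes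
the same value at both ends: it is invariant under the real translations `ι d`, so its complex
derivative vanishes on `ι d`, hence on `i ι d`. -/
theorem integral_translate_eq_of_segment {E T : Type*} [NormedAddCommGroup E] [NormedSpace ℂ E]
    [FiniteDimensional ℂ E] [NormedAddCommGroup T] [NormedSpace ℝ T] [MeasurableSpace T]
    [BorelSpace T] {μ : Measure T} [μ.IsAddLeftInvariant]
    (ι : T →ₗ[ℝ] E) {F : E → ℂ} {w : E} {d : T}
    (hG : ∀ τ ∈ Set.Icc (0 : ℝ) 1, DifferentiableAt ℂ (fun w => ∫ t, F (w + ι t) ∂μ)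
      (w + (τ : ℂ) • Complex.I • ι d)) :
    ∫ t, F (w + Complex.I • ι d + ι t) ∂μ = ∫ t, F (w + ι t) ∂μ := by
  set G : E → ℂ := fun w => ∫ t, F (w + ι t) ∂μ with hGdef
  have hinv : ∀ (w : E) (s : T), G (w + ι s) = G w := by
    intro w s
    simp only [hGdef]
    rw [← integral_add_left_eq_self (fun t => F (w + ι t)) s]
    simp only [map_add, add_assoc]
  have hderiv : ∀ w, DifferentiableAt ℂ G w → fderiv ℂ G w (Complex.I • ι d) = 0 := by
    intro w hw
    rw [map_smul]
    have h1 : HasDerivAt (fun s : ℝ => G (w + (s : ℂ) • ι d)) (fderiv ℂ G w (ι d)) 0 := by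
      have hline : HasDerivAt (fun s : ℂ => w + s • ι d) (ι d) 0 := by
        simpa using ((hasDerivAt_id (0 : ℂ)).smul_const (ι d)).const_add w
      have hw' : HasFDerivAt G (fderiv ℂ G w) (w + (0 : ℂ) • ι d) := by simpa using hw.hasFDerivAt
      simpa using (hw'.comp_hasDerivAt (0 : ℂ) hline).comp_ofReal (z := 0)
    have h2 : (fun s : ℝ => G (w + (s : ℂ) • ι d)) = fun _ => G w := by
      funext s
      rw [← hinv w (s • d), map_smul]
      simp
    rw [h2] at h1
    rw [h1.unique (hasDerivAt_const _ _), smul_zero]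
  have hline : ∀ τ ∈ Set.Icc (0 : ℝ) 1,
      HasDerivAt (fun s : ℝ => G (w + (s : ℂ) • Complex.I • ι d)) 0 τ := by
    intro τ hτ
    have h1 : HasDerivAt (fun s : ℂ => w + s • Complex.I • ι d) (Complex.I • ι d) (τ : ℂ) := by
      simpa using ((hasDerivAt_id (τ : ℂ)).smul_const (Complex.I • ι d)).const_add w
    have h2 := ((hG τ hτ).hasFDerivAt.comp_hasDerivAt (τ : ℂ) h1).comp_ofReal
    rwa [hderiv _ (hG τ hτ)] at h2
  have := constant_of_has_deriv_right_zero
    (fun τ hτ => (hline τ hτ).continuousAt.continuousWithinAt)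
    (fun τ hτ => (hline τ ⟨hτ.1, hτ.2.le⟩).hasDerivWithinAt) 1 (by simp)
  simpa [hGdef] using this

/-! ### Exponential bounds for the Gamma function and the sine -/

/-- Euler's integral with a complex rate, `∫ t^(a-1) e^{-rt} dt = r^{-a} Γ(a)` for `0 < Re r`, by
analytic continuation from real `r`. -/
theorem integral_cpow_mul_cexp_neg_mul_Ioi {a r : ℂ} (ha : 0 < a.re) (hr : 0 < r.re) :
    ∫ t in Set.Ioi (0 : ℝ), (t : ℂ) ^ (a - 1) * Complex.exp (-(r * t)) =
      (1 / r) ^ a * Complex.Gamma a := by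
  set U : Set ℂ := {r : ℂ | 0 < r.re} with hU
  have hUo : IsOpen U := isOpen_lt continuous_const Complex.continuous_re
  have hUc : IsPreconnected U := (convex_halfSpace_re_gt 0).isPreconnected
  -- `|t|` in place of `t` makes the bounds below hold for every real `t`
  set f : ℂ → ℝ → ℂ := fun r t => ((|t| : ℝ) : ℂ) ^ (a - 1) * Complex.exp (-(r * (|t| : ℝ)))
    with hf
  have hmeas : ∀ r, AEStronglyMeasurable (f r) (volume.restrict (Set.Ioi 0)) := by
    intro r
    refine Measurable.aestronglyMeasurable ?_
    have h1 : Measurable fun t : ℝ => ((|t| : ℝ) : ℂ) :=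
      Complex.measurable_ofReal.comp measurable_id.abs
    exact (h1.pow_const _).mul (Complex.measurable_exp.comp (h1.const_mul r).neg)
  have hdiffG : ∀ r ∈ U, DifferentiableAt ℂ
      (fun r => ∫ t in Set.Ioi (0 : ℝ), f r t) r := by
    intro r₀ hr₀
    have hr₀' : 0 < r₀.re := hr₀
    refine (hasFDerivAt_integral_of_holomorphic
      (g := fun t => ‖((|t| : ℝ) : ℂ) ^ (a - 1)‖ * Real.exp (-(r₀.re / 2 * |t|)))
      ?_ (Eventually.of_forall hmeas) (Eventually.of_forall fun w t => ?_) ?_).2.differentiableAt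
    · have h := integrableOn_rpow_mul_exp_neg_mul_rpow (s := a.re - 1) (p := 1) (b := r₀.re / 2)
        (by linarith) one_pos (by positivity)
      refine IntegrableOn.congr_fun h (fun t ht => ?_) measurableSet_Ioi
      have ht' : (0 : ℝ) < t := ht
      simp only [abs_of_pos ht', Real.rpow_one]
      rw [Complex.norm_cpow_eq_rpow_re_of_pos ht']
      simp
    · simp only [hf]
      fun_prop
    · have : ∀ᶠ w : ℂ in 𝓝 r₀, r₀.re / 2 < w.re :=
        Complex.continuous_re.continuousAt.eventually (lt_mem_nhds (by linarith))
      filter_upwards [this] with w hw t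
      simp only [hf, norm_mul, Complex.norm_exp]
      gcongr
      simp only [Complex.neg_re, Complex.re_mul_ofReal]
      nlinarith [abs_nonneg t]
  have hrhs : ∀ r ∈ U, DifferentiableAt ℂ (fun r : ℂ => (1 / r) ^ a * Complex.Gamma a) r := by
    intro r hr
    have hr' : 0 < r.re := hr
    have h0 : r ≠ 0 := fun h => by simp [h] at hr'
    refine DifferentiableAt.mul_const ?_ _
    refine DifferentiableAt.cpow_const (by fun_prop (disch := exact h0)) ?_
    refine Or.inl ?_
    rw [one_div, Complex.inv_re]
    exact div_pos hr' (Complex.normSq_pos.2 h0)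
  have heq : ∀ s : ℝ, 0 < s → (fun r => ∫ t in Set.Ioi (0 : ℝ), f r t) (s : ℂ) =
      (fun r : ℂ => (1 / r) ^ a * Complex.Gamma a) (s : ℂ) := by
    intro s hs
    have := Complex.integral_cpow_mul_exp_neg_mul_Ioi ha hs
    simp only [← this]
    refine setIntegral_congr_fun measurableSet_Ioi fun t ht => ?_
    have ht' : (0 : ℝ) < t := ht
    simp only [hf, abs_of_pos ht']
  have han := fun (F : ℂ → ℂ) (h : ∀ r ∈ U, DifferentiableAt ℂ F r) =>
    DifferentiableOn.analyticOnNhd (fun r hr => (h r hr).differentiableWithinAt) hUo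
  have hE := (han _ hdiffG).eqOn_of_preconnected_of_frequently_eq (han _ hrhs) hUc
    (z₀ := 1) (by simp [hU]) ?_
  · have := hE (show r ∈ U from hr)
    simp only at this
    rw [← this]
    refine setIntegral_congr_fun measurableSet_Ioi fun t ht => ?_
    have ht' : (0 : ℝ) < t := ht
    simp only [hf, abs_of_pos ht']
  · have hlim : Tendsto (fun n : ℕ => (((1 : ℝ) + 1 / ((n : ℝ) + 1) : ℝ) : ℂ)) atTop (𝓝[≠] 1) := by
      refine tendsto_nhdsWithin_iff.2 ⟨?_, Eventually.of_forall fun n => ?_⟩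
      · have h2 : Tendsto (fun n : ℕ => (1 : ℝ) + 1 / ((n : ℝ) + 1)) atTop (𝓝 1) := by
          simpa using (tendsto_const_nhds (x := (1 : ℝ))).add
            (tendsto_one_div_add_atTop_nhds_zero_nat (𝕜 := ℝ))
        have h3 := (Complex.continuous_ofReal.tendsto 1).comp h2
        rwa [Complex.ofReal_one] at h3
      · have : (0 : ℝ) < 1 / ((n : ℝ) + 1) := by positivity
        simp only [Set.mem_compl_iff, Set.mem_singleton_iff]
        intro h
        have h3 : (1 : ℝ) + 1 / ((n : ℝ) + 1) = 1 := by exact_mod_cast h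
        linarith
    exact hlim.frequently (Eventually.of_forall fun n => heq _ (by positivity)).frequently

/-- Euler's integral along the ray of direction `e^{iθ}`, estimated by absolute values. -/
theorem norm_Gamma_le_of_rotation {a : ℂ} (ha : 0 < a.re) {θ : ℝ} (hθ : |θ| < Real.pi / 2) :
    ‖Complex.Gamma a‖ ≤
      Real.exp (-(θ * a.im)) * ((1 / Real.cos θ) ^ a.re * Real.Gamma a.re) := by
  obtain ⟨h1, h2⟩ := abs_lt.1 hθ
  have hcos : 0 < Real.cos θ := Real.cos_pos_of_mem_Ioo ⟨by linarith, h2⟩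
  set r : ℂ := Complex.exp (θ * Complex.I) with hr
  have hrre : r.re = Real.cos θ := by
    rw [hr, Complex.exp_ofReal_mul_I_re]
  have key := integral_cpow_mul_cexp_neg_mul_Ioi (r := r) ha (by rw [hrre]; exact hcos)
  have hpow : (1 / r) ^ a = Complex.exp (-(θ * Complex.I) * a) := by
    have : 1 / r = Complex.exp (-(θ * Complex.I)) := by rw [hr, one_div, ← Complex.exp_neg]
    rw [this, Complex.cpow_def_of_ne_zero (Complex.exp_ne_zero _), Complex.log_exp]
    · simp; linarith [Real.pi_pos]
    · simp; linarith [Real.pi_pos]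
  have hn : ‖(1 / r) ^ a‖ = Real.exp (θ * a.im) := by
    rw [hpow, Complex.norm_exp]; simp
  have hbd : ‖∫ t in Set.Ioi (0 : ℝ), (t : ℂ) ^ (a - 1) * Complex.exp (-(r * t))‖ ≤
      (1 / Real.cos θ) ^ a.re * Real.Gamma a.re := by
    rw [← Real.integral_rpow_mul_exp_neg_mul_Ioi ha hcos]
    refine (norm_integral_le_integral_norm _).trans (le_of_eq ?_)
    refine setIntegral_congr_fun measurableSet_Ioi fun t ht => ?_
    have ht' : (0 : ℝ) < t := ht
    simp only [norm_mul]
    rw [Complex.norm_cpow_eq_rpow_re_of_pos ht', Complex.norm_exp]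
    simp [hrre]
  rw [key, norm_mul, hn] at hbd
  have he : 0 < Real.exp (θ * a.im) := Real.exp_pos _
  rw [Real.exp_neg, ← div_eq_inv_mul, le_div_iff₀ he, mul_comm]
  exact hbd

/-- `norm_Gamma_le_of_rotation` for `θ = ±(π/2 - η)`, the sign being that of `Im a`. -/
theorem norm_Gamma_le_exp {a : ℂ} (ha : 0 < a.re) {η : ℝ} (hη : 0 < η) (hη' : η < Real.pi / 2) :
    ‖Complex.Gamma a‖ ≤ Real.exp (-((Real.pi / 2 - η) * |a.im|)) *
      ((1 / Real.sin η) ^ a.re * Real.Gamma a.re) := by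
  rcases le_total 0 a.im with h | h
  · have := norm_Gamma_le_of_rotation ha (θ := Real.pi / 2 - η)
      (abs_lt.2 ⟨by linarith, by linarith⟩)
    rwa [Real.cos_pi_div_two_sub, ← abs_of_nonneg h] at this
  · have := norm_Gamma_le_of_rotation ha (θ := -(Real.pi / 2 - η))
      (abs_lt.2 ⟨by linarith, by linarith⟩)
    rw [Real.cos_neg, Real.cos_pi_div_two_sub] at this
    rw [abs_of_nonpos h]
    convert this using 3
    ring

theorem norm_sin_le_exp_abs_im (z : ℂ) : ‖Complex.sin z‖ ≤ Real.exp |z.im| := by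
  have h1 : ‖Complex.exp (-z * Complex.I)‖ ≤ Real.exp |z.im| := by
    rw [Complex.norm_exp]; simpa using le_abs_self z.im
  have h2 : ‖Complex.exp (z * Complex.I)‖ ≤ Real.exp |z.im| := by
    rw [Complex.norm_exp]; simpa using neg_le_abs z.im
  have h3 := norm_sub_le (Complex.exp (-z * Complex.I)) (Complex.exp (z * Complex.I))
  rw [Complex.sin, norm_div, norm_mul, Complex.norm_I, Complex.norm_two]
  linarith

/-- The reflection formula for the factors `1 / Γ`. It holds at the integers as well, where
`Complex.Gamma` takes the value `0` at its poles. -/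
theorem inv_Gamma_mul_Gamma_neg (w : ℂ) :
    1 / (Complex.Gamma w * Complex.Gamma (-w)) = -w / Real.pi * Complex.sin (Real.pi * w) := by
  by_cases hw : w = 0
  · simp [hw, Complex.Gamma_zero]
  have h1 := Complex.Gamma_mul_Gamma_one_sub w
  have h2 : Complex.Gamma (1 - w) = -w * Complex.Gamma (-w) := by
    rw [← Complex.Gamma_add_one _ (neg_ne_zero.2 hw)]; congr 1; ring
  have hpi : (Real.pi : ℂ) ≠ 0 := by exact_mod_cast Real.pi_ne_zero
  have h3 : Complex.Gamma w * Complex.Gamma (-w) =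
      (Real.pi / Complex.sin (Real.pi * w)) / (-w) := by
    rw [eq_div_iff (neg_ne_zero.2 hw), ← h1, h2]; ring
  rw [h3, one_div_div, div_div_eq_mul_div]
  ring

/-! ### The energy inequality for consecutive rows -/

theorem sum_sum_eq_sum_sum_erase_add {ι : Type*} [DecidableEq ι] (f : ι → ι → ℝ) (hf : ∀ i j, f i j = f j i)
    (hf0 : ∀ i, f i i = 0) {s : Finset ι} {a : ι} (ha : a ∈ s) :
    ∑ i ∈ s, ∑ j ∈ s, f i j =
      (∑ i ∈ s.erase a, ∑ j ∈ s.erase a, f i j) + 2 * ∑ j ∈ s.erase a, f a j := by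
  have h : ∀ i, ∑ j ∈ s, f i j = f i a + ∑ j ∈ s.erase a, f i j := fun i =>
    (Finset.add_sum_erase s (f i) ha).symm
  rw [← Finset.add_sum_erase s _ ha, h a, Finset.sum_congr rfl fun i _ => h i,
    Finset.sum_add_distrib, hf0, Finset.sum_congr rfl fun i _ => hf i a]
  ring

/-- The energy inequality for `n` points `x` and `n + 1` points `y` of the line, by induction on
`n`: remove the largest point of each family. -/
theorem sum_abs_sub_add_sum_abs_sub_le {ι κ : Type*} (x : ι → ℝ) (y : κ → ℝ)
    (s : Finset ι) (s' : Finset κ) (hcard : s'.card = s.card + 1) :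
    (∑ k ∈ s, ∑ l ∈ s, |x k - x l|) + (∑ k ∈ s', ∑ l ∈ s', |y k - y l|) ≤
      2 * ∑ k ∈ s, ∑ m ∈ s', |x k - y m| := by
  classical
  induction hn : s.card generalizing s s' with
  | zero =>
    have h0 : s = ∅ := Finset.card_eq_zero.1 hn
    obtain ⟨b, hb⟩ := Finset.card_eq_one.1 (by rw [hcard, hn] : s'.card = 1)
    simp [h0, hb]
  | succ n ih =>
    have hs : s.Nonempty := Finset.card_pos.1 (by omega)
    have hs' : s'.Nonempty := Finset.card_pos.1 (by omega)
    obtain ⟨a, ha, hamax⟩ := Finset.exists_max_image s x hs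
    obtain ⟨b, hb, hbmax⟩ := Finset.exists_max_image s' y hs'
    have hca := Finset.card_erase_of_mem ha
    have hcb := Finset.card_erase_of_mem hb
    have IH := ih (s.erase a) (s'.erase b) (by omega) (by omega)
    rw [sum_sum_eq_sum_sum_erase_add (fun k l => |x k - x l|) (fun i j => abs_sub_comm _ _) (by simp) ha,
      sum_sum_eq_sum_sum_erase_add (fun k l => |y k - y l|) (fun i j => abs_sub_comm _ _) (by simp) hb]
    have hcross : ∑ k ∈ s, ∑ m ∈ s', |x k - y m| =
        |x a - y b| + (∑ m ∈ s'.erase b, |x a - y m|) + (∑ k ∈ s.erase a, |x k - y b|) +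
          ∑ k ∈ s.erase a, ∑ m ∈ s'.erase b, |x k - y m| := by
      rw [← Finset.add_sum_erase s _ ha, ← Finset.add_sum_erase s' _ hb,
        Finset.sum_congr rfl fun k (_ : k ∈ s.erase a) => (Finset.add_sum_erase s' _ hb).symm,
        Finset.sum_add_distrib]
      ring
    have e1 : ∑ l ∈ s.erase a, |x a - x l| = (n : ℝ) * x a - ∑ l ∈ s.erase a, x l := by
      rw [Finset.sum_congr rfl fun l hl =>
        abs_of_nonneg (sub_nonneg.2 (hamax l (Finset.mem_of_mem_erase hl))),
        Finset.sum_sub_distrib, Finset.sum_const, hca, hn]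
      simp
    have e2 : ∑ l ∈ s'.erase b, |y b - y l| = ((n : ℝ) + 1) * y b - ∑ l ∈ s'.erase b, y l := by
      rw [Finset.sum_congr rfl fun l hl =>
        abs_of_nonneg (sub_nonneg.2 (hbmax l (Finset.mem_of_mem_erase hl))),
        Finset.sum_sub_distrib, Finset.sum_const, hcb, hcard, hn]
      simp
    have e3 : ((n : ℝ) + 1) * x a - ∑ m ∈ s'.erase b, y m ≤ ∑ m ∈ s'.erase b, |x a - y m| := by
      have : ∑ m ∈ s'.erase b, (x a - y m) = ((n : ℝ) + 1) * x a - ∑ m ∈ s'.erase b, y m := by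
        rw [Finset.sum_sub_distrib, Finset.sum_const, hcb, hcard, hn]; simp
      rw [← this]
      exact Finset.sum_le_sum fun m _ => le_abs_self _
    have e4 : (n : ℝ) * y b - ∑ k ∈ s.erase a, x k ≤ ∑ k ∈ s.erase a, |x k - y b| := by
      have : ∑ k ∈ s.erase a, -(x k - y b) = (n : ℝ) * y b - ∑ k ∈ s.erase a, x k := by
        rw [Finset.sum_neg_distrib, Finset.sum_sub_distrib, Finset.sum_const, hca, hn]; simp
      rw [← this]
      exact Finset.sum_le_sum fun m _ => neg_le_abs _
    have e5 := neg_le_abs (x a - y b)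
    rw [hcross, e1, e2]
    nlinarith

theorem sum_range_sum_range_lt (f : ℕ → ℕ → ℝ) (hf : ∀ i j, f i j = f j i)
    (hf0 : ∀ i, f i i = 0) (n : ℕ) :
    ∑ i ∈ Finset.range n, ∑ j ∈ Finset.range n, f i j =
      2 * ∑ p ∈ Finset.range n, ∑ s ∈ Finset.range p, f s p := by
  induction n with
  | zero => simp
  | succ n ih =>
    rw [sum_sum_eq_sum_sum_erase_add f hf hf0 (Finset.self_mem_range_succ n), Finset.range_add_one,
      Finset.erase_insert Finset.notMem_range_self, ih,
      Finset.sum_insert Finset.notMem_range_self, Finset.sum_congr rfl fun i _ => hf n i]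
    ring

/-- The exponent of the integrand is strictly negative. Each difference
`gap_n = ∑ |u_{n,k} - u_{n+1,m}| - V_n - V_{n+1}`, with `V_n` the sum of the distances in row `n`,
is nonnegative by the energy inequality, and at least `2 S_n - 2 N S_{n+1}` with
`S_n = ∑ |u_{n,j}|` by the triangle inequality. The sum of the `gap_n` is twice the right-hand
side, since row `N` vanishes; weighting the second bound by `(2N)^{-(N-n)}` makes it telescope. -/
theorem exists_pos_mul_sum_le_sum_cross_sub (N : ℕ) : ∃ ε : ℝ, 0 < ε ∧ ∀ u : ℕ → ℕ → ℝ,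
    (∀ j, u N j = 0) →
    ε * ∑ n ∈ Finset.range N, ∑ j ∈ Finset.range n, |u n j| ≤
      ∑ n ∈ Finset.range N,
        ((∑ k ∈ Finset.range n, ∑ m ∈ Finset.range (n + 1), |u n k - u (n + 1) m|) / 2 -
          ∑ p ∈ Finset.range n, ∑ s ∈ Finset.range p, |u n s - u n p|) := by
  rcases Nat.eq_zero_or_pos N with rfl | hN
  · exact ⟨1, one_pos, fun u _ => by simp⟩
  have hN' : (1 : ℝ) ≤ N := by exact_mod_cast hN
  set q : ℝ := 1 / (2 * N) with hq
  have hq0 : 0 < q := by positivity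
  have hq1 : q ≤ 1 := by rw [hq, div_le_one (by positivity)]; linarith
  have hqN : 2 * N * q = 1 := by rw [hq]; field_simp
  refine ⟨q ^ N / 2, by positivity, fun u hu => ?_⟩
  set A : ℕ → ℝ := fun n =>
    ∑ k ∈ Finset.range n, ∑ m ∈ Finset.range (n + 1), |u n k - u (n + 1) m| with hA
  set V : ℕ → ℝ := fun n => ∑ p ∈ Finset.range n, ∑ s ∈ Finset.range p, |u n s - u n p| with hV
  set S : ℕ → ℝ := fun n => ∑ j ∈ Finset.range n, |u n j| with hS
  have hS0 : ∀ n, 0 ≤ S n := fun n => Finset.sum_nonneg fun _ _ => abs_nonneg _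
  have hVsym : ∀ n, ∑ i ∈ Finset.range n, ∑ j ∈ Finset.range n, |u n i - u n j| = 2 * V n :=
    fun n => sum_range_sum_range_lt (fun i j => |u n i - u n j|)
      (fun i j => abs_sub_comm _ _) (by simp) n
  have hgap : ∀ n, V n + V (n + 1) ≤ A n := by
    intro n
    have := sum_abs_sub_add_sum_abs_sub_le (u n) (u (n + 1)) (Finset.range n)
      (Finset.range (n + 1)) (by simp)
    rw [hVsym n, hVsym (n + 1)] at this
    simp only [hA]
    linarith
  have hVle : ∀ n : ℕ, V (n + 1) ≤ n * S (n + 1) := by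
    intro n
    have h2 : ∑ i ∈ Finset.range (n + 1), ∑ j ∈ Finset.range (n + 1), |u (n + 1) i - u (n + 1) j| ≤
        2 * (n * S (n + 1)) := by
      calc _ ≤ ∑ i ∈ Finset.range (n + 1), ∑ j ∈ (Finset.range (n + 1)).erase i,
            (|u (n + 1) i| + |u (n + 1) j|) := by
            refine Finset.sum_le_sum fun i hi => ?_
            rw [← Finset.add_sum_erase _ _ hi, sub_self, abs_zero, zero_add]
            exact Finset.sum_le_sum fun j _ => abs_sub _ _
        _ = ∑ i ∈ Finset.range (n + 1), (n * |u (n + 1) i| + (S (n + 1) - |u (n + 1) i|)) := by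
            refine Finset.sum_congr rfl fun i hi => ?_
            rw [Finset.sum_add_distrib, Finset.sum_const, Finset.card_erase_of_mem hi,
              Finset.sum_erase_eq_sub hi]
            simp [hS]
        _ = _ := by
            rw [Finset.sum_add_distrib, Finset.sum_sub_distrib, ← Finset.mul_sum, Finset.sum_const]
            simp only [Finset.card_range, nsmul_eq_mul, hS]
            push_cast
            ring
    rw [hVsym] at h2
    linarith
  have hAge : ∀ n : ℕ, (n + 1) * S n - n * S (n + 1) ≤ A n := by
    intro n
    calc _ = ∑ k ∈ Finset.range n, ∑ m ∈ Finset.range (n + 1), (|u n k| - |u (n + 1) m|) := by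
          simp only [Finset.sum_sub_distrib, Finset.sum_const, Finset.card_range, nsmul_eq_mul,
            ← Finset.mul_sum, hS]
          push_cast
          ring
      _ ≤ _ := Finset.sum_le_sum fun k _ => Finset.sum_le_sum fun m _ =>
          abs_sub_abs_le_abs_sub _ _
  have hV0 : V 0 = 0 := by simp [hV]
  have hVN : V N = 0 := by simp [hV, hu]
  have hSN : S N = 0 := by simp [hS, hu]
  have hSz : S 0 = 0 := by simp [hS]
  have hgap2 : ∀ n ∈ Finset.range N, 2 * S n - 2 * N * S (n + 1) ≤ A n - V n - V (n + 1) := by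
    intro n hn
    have hnN : (n : ℝ) ≤ N := by exact_mod_cast (Finset.mem_range.1 hn).le
    rcases n with _ | n
    · have := hgap 0
      rw [hSz]
      nlinarith [hS0 (0 + 1), mul_nonneg (by linarith : (0 : ℝ) ≤ N) (hS0 (0 + 1))]
    · have h1 := hAge (n + 1)
      have h2 := hVle n
      have h3 := hVle (n + 1)
      push_cast at h1 h2 h3 hnN
      nlinarith [hS0 (n + 1 + 1)]
  have hmain : ∀ n ∈ Finset.range N,
      q ^ (N - n) * S n + (q ^ (N - n) * S n - q ^ (N - (n + 1)) * S (n + 1)) ≤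
        A n - V n - V (n + 1) := by
    intro n hn
    have hlt := Finset.mem_range.1 hn
    have hpow : q ^ (N - n) = q ^ (N - (n + 1)) * q := by
      rw [← pow_succ]; congr 1; omega
    have hd0 : 0 < q ^ (N - n) := by positivity
    have hd1 : q ^ (N - n) ≤ 1 := pow_le_one₀ hq0.le hq1
    have h1 := mul_le_mul_of_nonneg_left (hgap2 n hn) hd0.le
    have h2 : q ^ (N - n) * (A n - V n - V (n + 1)) ≤ A n - V n - V (n + 1) :=
      mul_le_of_le_one_left (by linarith [hgap n]) hd1
    have h3 : q ^ (N - n) * (2 * N * S (n + 1)) = q ^ (N - (n + 1)) * S (n + 1) := by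
      rw [hpow]
      calc _ = q ^ (N - (n + 1)) * (2 * N * q) * S (n + 1) := by ring
        _ = _ := by rw [hqN, mul_one]
    linarith
  have hsum := Finset.sum_le_sum hmain
  rw [Finset.sum_add_distrib] at hsum
  have htel := Finset.sum_range_sub' (fun n => q ^ (N - n) * S n) N
  rw [htel] at hsum
  have hVtel := Finset.sum_range_sub V N
  have hrhs : ∑ n ∈ Finset.range N, (A n / 2 - V n) =
      (∑ n ∈ Finset.range N, (A n - V n - V (n + 1))) / 2 := by
    have : ∀ n, A n / 2 - V n = (A n - V n - V (n + 1)) / 2 + (V (n + 1) - V n) / 2 :=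
      fun n => by ring
    rw [Finset.sum_congr rfl fun n _ => this n, Finset.sum_add_distrib, ← Finset.sum_div,
      ← Finset.sum_div, hVtel, hVN, hV0]
    ring
  have hlow : q ^ N * ∑ n ∈ Finset.range N, S n ≤ ∑ n ∈ Finset.range N, q ^ (N - n) * S n := by
    rw [Finset.mul_sum]
    refine Finset.sum_le_sum fun n _ => mul_le_mul_of_nonneg_right ?_ (hS0 n)
    exact pow_le_pow_of_le_one hq0.le hq1 (Nat.sub_le _ _)
  rw [hrhs]
  simp only [hSz, hSN, mul_zero, sub_zero, add_zero] at hsum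
  linarith

/-! ### Lagrange interpolation -/

theorem sum_eval_mul_prod_div_prod {ι : Type*} [DecidableEq ι] {s : Finset ι} {v : ι → ℂ}
    (hv : Set.InjOn v s) {p : Polynomial ℂ} (hp : p.degree < s.card) (lam : ℂ) :
    ∑ j ∈ s, p.eval (v j) * ((∏ i ∈ s.erase j, (lam - v i)) / ∏ i ∈ s.erase j, (v j - v i)) =
      p.eval lam := by
  conv_rhs => rw [Lagrange.eq_interpolate hv hp, Lagrange.interpolate_eq_sum]
  simp only [Polynomial.eval_finsetSum, Polynomial.eval_mul, Polynomial.eval_C,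
    Polynomial.eval_prod, Polynomial.eval_sub, Polynomial.eval_X]
  exact Finset.sum_congr rfl fun j _ => by ring

/-- The monic polynomials `∏_{m ≤ n} (X - b_m)` and `(X - c) ∏_{j < n} (X - v_j)` have the same two
leading coefficients if `c = ∑ b_m - ∑ v_j`. -/
theorem degree_prod_X_sub_C_sub_lt {n : ℕ} (v b : ℕ → ℂ) :
    ((∏ m ∈ Finset.range (n + 1), (Polynomial.X - Polynomial.C (b m))) -
      (Polynomial.X - Polynomial.C ((∑ m ∈ Finset.range (n + 1), b m) -
        ∑ j ∈ Finset.range n, v j)) *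
        ∏ j ∈ Finset.range n, (Polynomial.X - Polynomial.C (v j))).degree < (n : WithBot ℕ) := by
  set c : ℂ := (∑ m ∈ Finset.range (n + 1), b m) - ∑ j ∈ Finset.range n, v j
  -- the roots `v_0, …, v_{n-1}, c`
  set w : ℕ → ℂ := Function.update v n c with hw
  have h1 : (Polynomial.X - Polynomial.C c) *
      ∏ j ∈ Finset.range n, (Polynomial.X - Polynomial.C (v j)) =
      ∏ j ∈ Finset.range (n + 1), (Polynomial.X - Polynomial.C (w j)) := by
    rw [Finset.prod_range_succ, mul_comm]
    congr 1
    · refine Finset.prod_congr rfl fun j hj => ?_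
      rw [hw, Function.update_of_ne (Finset.mem_range.1 hj).ne]
    · simp [hw]
  have h2 : ∑ j ∈ Finset.range (n + 1), w j = ∑ m ∈ Finset.range (n + 1), b m := by
    rw [Finset.sum_range_succ, Finset.sum_congr rfl fun j hj => by
      rw [hw, Function.update_of_ne (Finset.mem_range.1 hj).ne]]
    simp [hw, c]
  rw [h1, Polynomial.degree_lt_iff_coeff_zero]
  intro k hk
  have hmon : ∀ g : ℕ → ℂ,
      (∏ j ∈ Finset.range (n + 1), (Polynomial.X - Polynomial.C (g j))).Monic :=
    fun g => Polynomial.monic_prod_of_monic _ _ fun j _ => Polynomial.monic_X_sub_C _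
  have hdeg : ∀ g : ℕ → ℂ,
      (∏ j ∈ Finset.range (n + 1), (Polynomial.X - Polynomial.C (g j))).natDegree = n + 1 := by
    intro g; rw [Polynomial.natDegree_prod_of_monic _ _ fun j _ => Polynomial.monic_X_sub_C _]; simp
  rw [Polynomial.coeff_sub, sub_eq_zero]
  rcases hk.lt_or_eq with hk | rfl
  · rcases (Nat.succ_le_of_lt hk).lt_or_eq with hk | rfl
    · rw [Polynomial.coeff_eq_zero_of_natDegree_lt (by rw [hdeg]; exact hk),
        Polynomial.coeff_eq_zero_of_natDegree_lt (by rw [hdeg]; exact hk)]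
    · have hb := (hmon b).coeff_natDegree
      have hw := (hmon w).coeff_natDegree
      rw [hdeg] at hb hw
      rw [Nat.succ_eq_add_one, hb, hw]
  · have hb := Polynomial.prod_X_sub_C_coeff_card_pred (Finset.range (n + 1)) b (by simp)
    have hw := Polynomial.prod_X_sub_C_coeff_card_pred (Finset.range (n + 1)) w (by simp)
    simp only [Finset.card_range, Nat.add_sub_cancel] at hb hw
    rw [hb, hw, h2]

/-- Interpolation, at the `n` nodes `v_j`, of the monic polynomial of degree `n + 1` with roots
`b_m`: it is recovered up to its multiple of `∏ (X - v_j)`. -/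
theorem sum_prod_sub_mul_prod_div_prod {n : ℕ} {v : ℕ → ℂ}
    (hv : Set.InjOn v (Finset.range n)) (b : ℕ → ℂ) (lam : ℂ) :
    ∑ j ∈ Finset.range n, (∏ m ∈ Finset.range (n + 1), (v j - b m)) *
      ((∏ i ∈ (Finset.range n).erase j, (lam - v i)) /
        ∏ i ∈ (Finset.range n).erase j, (v j - v i)) =
      (∏ m ∈ Finset.range (n + 1), (lam - b m)) -
      (lam - ((∑ m ∈ Finset.range (n + 1), b m) - ∑ j ∈ Finset.range n, v j)) *
        ∏ j ∈ Finset.range n, (lam - v j) := by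
  have h := sum_eval_mul_prod_div_prod hv
    (by simpa using degree_prod_X_sub_C_sub_lt (n := n) v b) lam
  simp only [Polynomial.eval_sub, Polynomial.eval_mul, Polynomial.eval_prod, Polynomial.eval_X,
    Polynomial.eval_C, Polynomial.eval_finsetSum] at h
  rw [← h]
  refine Finset.sum_congr rfl fun j hj => ?_
  rw [Finset.prod_eq_zero hj (sub_self (v j))]
  ring

theorem sum_prod_sub_mul_prod_div_prod_pred {n : ℕ} (hn : 1 ≤ n) {v : ℕ → ℂ}
    (hv : Set.InjOn v (Finset.range n)) (b : ℕ → ℂ) (lam : ℂ) :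
    ∑ j ∈ Finset.range n, (∏ m ∈ Finset.range (n - 1), (v j - b m)) *
      ((∏ i ∈ (Finset.range n).erase j, (lam - v i)) /
        ∏ i ∈ (Finset.range n).erase j, (v j - v i)) =
      ∏ m ∈ Finset.range (n - 1), (lam - b m) := by
  have h := sum_eval_mul_prod_div_prod hv
    (p := ∏ m ∈ Finset.range (n - 1), (Polynomial.X - Polynomial.C (b m))) ?_ lam
  · simpa only [Polynomial.eval_sub, Polynomial.eval_prod, Polynomial.eval_X,
      Polynomial.eval_C] using h
  · rw [Polynomial.degree_prod]
    simp only [Polynomial.degree_X_sub_C, Finset.sum_const, Finset.card_range, nsmul_eq_mul,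
      mul_one]
    exact_mod_cast (by omega : n - 1 < n)

/-- The leading coefficient of the Lagrange interpolation polynomial. -/
theorem sum_prod_sub_div_prod {n : ℕ} (hn : 1 ≤ n) {v : ℕ → ℂ}
    (hv : Set.InjOn v (Finset.range n)) (b : ℕ → ℂ) :
    ∑ j ∈ Finset.range n, (∏ m ∈ Finset.range (n - 1), (v j - b m)) /
        ∏ i ∈ (Finset.range n).erase j, (v j - v i) = 1 := by
  set p : Polynomial ℂ := ∏ m ∈ Finset.range (n - 1), (Polynomial.X - Polynomial.C (b m)) with hp
  have h := Lagrange.leadingCoeff_eq_sum hv (P := p) ?_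
  · have hmon : p.Monic := Polynomial.monic_prod_of_monic _ _ fun j _ => Polynomial.monic_X_sub_C _
    rw [hmon.leadingCoeff] at h
    simp only [hp, Polynomial.eval_sub, Polynomial.eval_prod, Polynomial.eval_X,
      Polynomial.eval_C] at h
    exact h.symm
  · rw [hp, Polynomial.degree_prod]
    simp only [Polynomial.degree_X_sub_C, Finset.sum_const, Finset.card_range, nsmul_eq_mul,
      mul_one]
    exact_mod_cast (by omega : n = n - 1 + 1)

/-! ### Polynomial functions of arrays and the parameter space -/

/-- The functions of an array that are polynomials in its entries. -/
inductive PolyFun : (GZArray → ℂ) → Prop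
  | const (c : ℂ) : PolyFun fun _ => c
  | coord (n j : ℕ) : PolyFun fun a => a n j
  | add {P Q : GZArray → ℂ} : PolyFun P → PolyFun Q → PolyFun fun a => P a + Q a
  | mul {P Q : GZArray → ℂ} : PolyFun P → PolyFun Q → PolyFun fun a => P a * Q a

theorem PolyFun.sub {P Q : GZArray → ℂ} (hP : PolyFun P) (hQ : PolyFun Q) :
    PolyFun fun a => P a - Q a := by
  simpa [sub_eq_add_neg] using hP.add ((PolyFun.const (-1)).mul hQ)

theorem PolyFun.sum {ι : Type*} {s : Finset ι} {P : ι → GZArray → ℂ}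
    (hP : ∀ i ∈ s, PolyFun (P i)) : PolyFun fun a => ∑ i ∈ s, P i a := by
  classical
  induction s using Finset.induction_on with
  | empty => simpa using PolyFun.const 0
  | insert i s hi ih =>
    simp only [Finset.sum_insert hi]
    exact (hP i (Finset.mem_insert_self _ _)).add
      (ih fun k hk => hP k (Finset.mem_insert_of_mem hk))

theorem PolyFun.prod {ι : Type*} {s : Finset ι} {P : ι → GZArray → ℂ}
    (hP : ∀ i ∈ s, PolyFun (P i)) : PolyFun fun a => ∏ i ∈ s, P i a := by
  classical
  induction s using Finset.induction_on with
  | empty => simpa using PolyFun.const 1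
  | insert i s hi ih =>
    simp only [Finset.prod_insert hi]
    exact (hP i (Finset.mem_insert_self _ _)).mul
      (ih fun k hk => hP k (Finset.mem_insert_of_mem hk))

theorem PolyFun.scaledDiff (ℏ : ℝ) (n k l m : ℕ) : PolyFun fun a => scaledDiff ℏ a n k l m := by
  simpa [TodaGZ.scaledDiff, div_eq_mul_inv] using
    ((PolyFun.coord n k).sub (PolyFun.coord l m)).mul (.const (Complex.I * ℏ)⁻¹)

theorem PolyFun.rowSum (n : ℕ) : PolyFun fun a => rowSum a n :=
  PolyFun.sum fun j _ => PolyFun.coord n j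

/-- The complex parameters of the integrals: the base point of the entries below the top level,
the label `γ_N`, and the positions `x` (complex, so that the derivatives in `x` are covered by the
same holomorphy statement). -/
abbrev Param (N : ℕ) : Type := Low ℂ N × (Fin N → ℂ) × (Fin N → ℂ)

/-- The array with the entries and the label of `w`. -/
def paramArray {N : ℕ} (w : Param N) : GZArray := fullArray N w.2.1 w.1

/-- The entries of `t` as a function on `ℕ × ℕ`, extended by zero; in particular row `N` is
zero. -/
def lowEntry {N : ℕ} (t : Low ℝ N) (n j : ℕ) : ℝ :=
  if hn : n < N then (if hj : j < n then t ⟨n, hn⟩ ⟨j, hj⟩ else 0) else 0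

/-- The directions of integration: real translations of the entries below the top level. -/
def realDir (N : ℕ) : Low ℝ N →ₗ[ℝ] Param N where
  toFun t := (fun n j => (t n j : ℂ), 0, 0)
  map_add' s t := by
    refine Prod.ext ?_ (by simp)
    funext n j; simp
  map_smul' c t := by
    refine Prod.ext ?_ (by simp)
    funext n j; simp

theorem paramArray_add_smul_realDir {N : ℕ} (w : Param N) (c : ℂ) (t : Low ℝ N) (n j : ℕ) :
    paramArray (w + c • realDir N t) n j = paramArray w n j + c * lowEntry t n j := by
  simp only [paramArray, fullArray, lowEntry, realDir]
  split_ifs <;> simp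

theorem paramArray_add_realDir {N : ℕ} (w : Param N) (t : Low ℝ N) (n j : ℕ) :
    paramArray (w + realDir N t) n j = paramArray w n j + lowEntry t n j := by
  simpa using paramArray_add_smul_realDir w 1 t n j

theorem abs_lowEntry_le {N : ℕ} (t : Low ℝ N) (n j : ℕ) : |lowEntry t n j| ≤ ‖t‖ := by
  unfold lowEntry
  split_ifs with h1 h2
  · exact (norm_le_pi_norm (t ⟨n, h1⟩) ⟨j, h2⟩).trans (norm_le_pi_norm t ⟨n, h1⟩)
  · simp
  · simp

theorem norm_le_sum_abs_lowEntry {N : ℕ} (t : Low ℝ N) :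
    ‖t‖ ≤ ∑ n ∈ Finset.range N, ∑ j ∈ Finset.range n, |lowEntry t n j| := by
  have h0 : ∀ n, 0 ≤ ∑ j ∈ Finset.range n, |lowEntry t n j| :=
    fun n => Finset.sum_nonneg fun _ _ => abs_nonneg _
  refine (pi_norm_le_iff_of_nonneg (Finset.sum_nonneg fun n _ => h0 n)).2 fun n => ?_
  refine le_trans ?_ (Finset.single_le_sum (fun n _ => h0 n) (Finset.mem_range.2 n.2))
  refine (pi_norm_le_iff_of_nonneg (h0 _)).2 fun j => ?_
  refine le_trans (le_of_eq ?_) (Finset.single_le_sum (f := fun j => |lowEntry t n j|)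
    (fun j _ => abs_nonneg _) (Finset.mem_range.2 j.2))
  simp [lowEntry]

theorem differentiable_paramArray {N : ℕ} (n j : ℕ) :
    Differentiable ℂ fun w : Param N => paramArray w n j := by
  unfold paramArray fullArray
  split_ifs <;> fun_prop

theorem PolyFun.differentiable {N : ℕ} {P : GZArray → ℂ} (hP : PolyFun P) :
    Differentiable ℂ fun w : Param N => P (paramArray w) := by
  induction hP with
  | const c => exact differentiable_const _
  | coord n j => exact differentiable_paramArray n j
  | add _ _ h1 h2 => exact h1.add h2
  | mul _ _ h1 h2 => exact h1.mul h2

/-! ### Bounds that are uniform along real translations -/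

/-- `F (w + t)` is bounded by a multiple of `exp (φ t)` for all real translations `t`, uniformly
for `w` near `w₀`. -/
def TransBound {N : ℕ} (w₀ : Param N) (F : Param N → ℂ) (φ : Low ℝ N → ℝ) : Prop :=
  ∃ C : ℝ, ∀ᶠ w in 𝓝 w₀, ∀ t, ‖F (w + realDir N t)‖ ≤ C * Real.exp (φ t)

section TransBound
variable {N : ℕ} {w₀ : Param N} {F G : Param N → ℂ} {φ ψ : Low ℝ N → ℝ}

theorem TransBound.mul (hF : TransBound w₀ F φ) (hG : TransBound w₀ G ψ) :
    TransBound w₀ (fun w => F w * G w) (fun t => φ t + ψ t) := by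
  obtain ⟨C, hC⟩ := hF
  obtain ⟨D, hD⟩ := hG
  refine ⟨C * D, ?_⟩
  filter_upwards [hC, hD] with w h1 h2 t
  rw [norm_mul, Real.exp_add]
  calc _ ≤ (C * Real.exp (φ t)) * (D * Real.exp (ψ t)) :=
        mul_le_mul (h1 t) (h2 t) (norm_nonneg _) ((norm_nonneg _).trans (h1 t))
    _ = _ := by ring

theorem TransBound.add (hF : TransBound w₀ F φ) (hG : TransBound w₀ G φ) :
    TransBound w₀ (fun w => F w + G w) φ := by
  obtain ⟨C, hC⟩ := hF
  obtain ⟨D, hD⟩ := hG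
  refine ⟨C + D, ?_⟩
  filter_upwards [hC, hD] with w h1 h2 t
  exact (norm_add_le _ _).trans (by linarith [h1 t, h2 t])

theorem TransBound.mono (hF : TransBound w₀ F φ) {B : ℝ} (h : ∀ t, φ t ≤ B + ψ t) :
    TransBound w₀ F ψ := by
  obtain ⟨C, hC⟩ := hF
  refine ⟨C * Real.exp B, ?_⟩
  filter_upwards [hC] with w h1 t
  have hC0 : 0 ≤ C := by
    have := (norm_nonneg _).trans (h1 t)
    exact nonneg_of_mul_nonneg_left this (Real.exp_pos _)
  refine (h1 t).trans ?_
  rw [mul_assoc, ← Real.exp_add]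
  gcongr
  exact h t

theorem TransBound.prod {ι : Type*} {s : Finset ι} {F : ι → Param N → ℂ}
    {φ : ι → Low ℝ N → ℝ} (h : ∀ i ∈ s, TransBound w₀ (F i) (φ i)) :
    TransBound w₀ (fun w => ∏ i ∈ s, F i w) (fun t => ∑ i ∈ s, φ i t) := by
  classical
  induction s using Finset.induction_on with
  | empty => exact ⟨1, Eventually.of_forall fun w t => by simp⟩
  | insert i s hi ih =>
    simp only [Finset.prod_insert hi, Finset.sum_insert hi]
    exact (h i (Finset.mem_insert_self _ _)).mul
      (ih fun k hk => h k (Finset.mem_insert_of_mem hk))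

theorem eventually_norm_paramArray_le (w₀ : Param N) (n j : ℕ) :
    ∀ᶠ w in 𝓝 w₀, ‖paramArray w n j‖ ≤ ‖paramArray w₀ n j‖ + 1 := by
  have hc : Continuous fun w : Param N => ‖paramArray w n j‖ :=
    (differentiable_paramArray n j).continuous.norm
  filter_upwards [hc.continuousAt.eventually (gt_mem_nhds (lt_add_one _))] with w hw
  exact hw.le

theorem PolyFun.transBound {P : GZArray → ℂ} (hP : PolyFun P) (w₀ : Param N) {η : ℝ} (hη : 0 < η) :
    TransBound w₀ (fun w => P (paramArray w)) (fun t => η * ‖t‖) := by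
  induction hP generalizing η with
  | const c =>
    refine ⟨‖c‖, Eventually.of_forall fun w t => ?_⟩
    exact le_mul_of_one_le_right (norm_nonneg _) (Real.one_le_exp (by positivity))
  | coord n j =>
    refine ⟨‖paramArray w₀ n j‖ + 1 + 1 / η, ?_⟩
    filter_upwards [eventually_norm_paramArray_le w₀ n j] with w hw t
    rw [paramArray_add_realDir]
    have h1 : 1 ≤ Real.exp (η * ‖t‖) := Real.one_le_exp (by positivity)
    have h2 : ‖t‖ ≤ 1 / η * Real.exp (η * ‖t‖) := by
      rw [one_div, ← div_eq_inv_mul, le_div_iff₀ hη]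
      linarith [Real.add_one_le_exp (η * ‖t‖)]
    have h3 : ‖((lowEntry t n j : ℝ) : ℂ)‖ ≤ ‖t‖ := by
      rw [Complex.norm_real]; exact abs_lowEntry_le t n j
    have h4 := norm_add_le (paramArray w n j) ((lowEntry t n j : ℝ) : ℂ)
    have h5 : ‖paramArray w₀ n j‖ + 1 ≤ (‖paramArray w₀ n j‖ + 1) * Real.exp (η * ‖t‖) :=
      le_mul_of_one_le_right (by positivity) h1
    rw [add_mul]
    linarith
  | add _ _ h1 h2 => exact (h1 hη).add (h2 hη)
  | mul _ _ h1 h2 =>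
    refine ((h1 (half_pos hη)).mul (h2 (half_pos hη))).mono (B := 0) fun t => ?_
    linarith

theorem scaledDiff_re (ℏ : ℝ) (a : GZArray) (n k l m : ℕ) :
    (scaledDiff ℏ a n k l m).re = ((a n k).im - (a l m).im) / ℏ := by
  have : scaledDiff ℏ a n k l m = -Complex.I * (a n k - a l m) / ℏ := by
    rw [scaledDiff, ← div_div, div_eq_mul_inv _ Complex.I, Complex.inv_I]; ring
  rw [this, Complex.div_ofReal_re]; simp

theorem scaledDiff_im (ℏ : ℝ) (a : GZArray) (n k l m : ℕ) :
    (scaledDiff ℏ a n k l m).im = -(((a n k).re - (a l m).re) / ℏ) := by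
  have : scaledDiff ℏ a n k l m = -Complex.I * (a n k - a l m) / ℏ := by
    rw [scaledDiff, ← div_div, div_eq_mul_inv _ Complex.I, Complex.inv_I]; ring
  rw [this, Complex.div_ofReal_im]; simp; ring

/-- Along real translations `t`, `|Im (γ_{n,k} - γ_{l,m}) / (iℏ)|` differs from
`|t_{n,k} - t_{l,m}| / ℏ` by a bounded amount. -/
theorem abs_scaledDiff_im {ℏ : ℝ} (hℏ : 0 < ℏ) (w : Param N) (t : Low ℝ N) (n k l m : ℕ) :
    |(|(scaledDiff ℏ (paramArray (w + realDir N t)) n k l m).im| -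
      |lowEntry t n k - lowEntry t l m| / ℏ)| ≤ |(scaledDiff ℏ (paramArray w) n k l m).im| := by
  have h : |lowEntry t n k - lowEntry t l m| / ℏ = |-((lowEntry t n k - lowEntry t l m) / ℏ)| := by
    rw [abs_neg, abs_div, abs_of_pos hℏ]
  rw [h]
  refine (abs_abs_sub_abs_le_abs_sub _ _).trans (le_of_eq ?_)
  rw [scaledDiff_im, scaledDiff_im, paramArray_add_realDir, paramArray_add_realDir]
  congr 1
  simp
  ring

theorem scaledDiff_re_add_realDir {ℏ : ℝ} (w : Param N) (t : Low ℝ N) (n k l m : ℕ) :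
    (scaledDiff ℏ (paramArray (w + realDir N t)) n k l m).re =
      (scaledDiff ℏ (paramArray w) n k l m).re := by
  simp [scaledDiff_re, paramArray_add_realDir]

theorem transBound_gammaFactor {ℏ : ℝ} (hℏ : 0 < ℏ) {e : ℕ} {n k l m : ℕ}
    (hw : 0 < (scaledDiff ℏ (paramArray w₀) n k l m + e).re) {η : ℝ} (hη : 0 < η)
    (hη' : η < Real.pi / 2) :
    TransBound w₀ (fun w => (ℏ : ℂ) ^ scaledDiff ℏ (paramArray w) n k l m *
        Complex.Gamma (scaledDiff ℏ (paramArray w) n k l m + e))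
      (fun t => -((Real.pi / 2 - η) / ℏ * |lowEntry t n k - lowEntry t l m|)) := by
  set z : Param N → ℂ := fun w => scaledDiff ℏ (paramArray w) n k l m with hz
  have hzc : Continuous z := (PolyFun.scaledDiff ℏ n k l m).differentiable.continuous
  have hre : Continuous fun w => (z w + e).re := Complex.continuous_re.comp (hzc.add_const _)
  have hpos : ∀ᶠ w in 𝓝 w₀, 0 < (z w + e).re := hre.continuousAt.eventually (lt_mem_nhds hw)
  -- the constant of the bound, a continuous function of `w`
  set B : Param N → ℝ := fun w => ℏ ^ (z w).re * (Real.exp ((Real.pi / 2 - η) * |(z w).im|) *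
    ((1 / Real.sin η) ^ (z w + e).re * Real.Gamma (z w + e).re)) with hB
  have hsin : 0 < Real.sin η := Real.sin_pos_of_pos_of_lt_pi hη (by linarith [Real.pi_pos])
  have hBc : ContinuousAt B w₀ := by
    have hzre : Continuous fun w => (z w).re := Complex.continuous_re.comp hzc
    have hzim : Continuous fun w => |(z w).im| := (Complex.continuous_im.comp hzc).abs
    refine ContinuousAt.mul ?_ (ContinuousAt.mul ?_ (ContinuousAt.mul ?_ ?_))
    · exact ((Real.continuous_const_rpow hℏ.ne').comp hzre).continuousAt
    · exact (Real.continuous_exp.comp (hzim.const_mul _)).continuousAt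
    · exact ((Real.continuous_const_rpow (by positivity)).comp hre).continuousAt
    · refine ContinuousAt.comp (f := fun w => (z w + e).re) (g := Real.Gamma) ?_ hre.continuousAt
      refine (Real.differentiableAt_Gamma fun q => ?_).continuousAt
      have : (0 : ℝ) ≤ q := Nat.cast_nonneg q
      linarith
  have hBev : ∀ᶠ w in 𝓝 w₀, B w < B w₀ + 1 := hBc.eventually (gt_mem_nhds (lt_add_one _))
  refine ⟨B w₀ + 1, ?_⟩
  filter_upwards [hpos, hBev] with w hw1 hw2 t
  have hret : (z (w + realDir N t)).re = (z w).re := scaledDiff_re_add_realDir w t n k l m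
  have hret' : (z (w + realDir N t) + e).re = (z w + e).re := by
    rw [Complex.add_re, hret, Complex.add_re]
  have him := (abs_le.1 (abs_scaledDiff_im hℏ w t n k l m)).1
  have hG := norm_Gamma_le_exp (a := z (w + realDir N t) + e) (by rw [hret']; exact hw1) hη hη'
  have him' : (z (w + realDir N t) + e).im = (z (w + realDir N t)).im := by simp
  rw [hret', him'] at hG
  have hGpos : 0 ≤ (1 / Real.sin η) ^ (z w + e).re * Real.Gamma (z w + e).re :=
    mul_nonneg (by positivity) (Real.Gamma_pos_of_pos hw1).le
  rw [norm_mul, Complex.norm_cpow_eq_rpow_re_of_pos hℏ]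
  change ℏ ^ (z (w + realDir N t)).re * _ ≤ _
  rw [hret]
  calc _ ≤ ℏ ^ (z w).re * (Real.exp (-((Real.pi / 2 - η) * |(z (w + realDir N t)).im|)) *
        ((1 / Real.sin η) ^ (z w + e).re * Real.Gamma (z w + e).re)) := by
        gcongr
    _ ≤ ℏ ^ (z w).re * ((Real.exp ((Real.pi / 2 - η) * |(z w).im|) *
          Real.exp (-((Real.pi / 2 - η) / ℏ * |lowEntry t n k - lowEntry t l m|))) *
        ((1 / Real.sin η) ^ (z w + e).re * Real.Gamma (z w + e).re)) := by
        rw [← Real.exp_add]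
        gcongr
        have := mul_le_mul_of_nonneg_left him (by linarith : 0 ≤ Real.pi / 2 - η)
        have e1 : (Real.pi / 2 - η) / ℏ * |lowEntry t n k - lowEntry t l m| =
          (Real.pi / 2 - η) * (|lowEntry t n k - lowEntry t l m| / ℏ) := by ring
        rw [e1]
        simp only [hz]
        linarith
    _ = B w * Real.exp (-((Real.pi / 2 - η) / ℏ * |lowEntry t n k - lowEntry t l m|)) := by
        simp only [hB]; ring
    _ ≤ _ := by gcongr

theorem transBound_sinFactor {ℏ : ℝ} (hℏ : 0 < ℏ) (w₀ : Param N) (n s p : ℕ) :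
    TransBound w₀ (fun w => Complex.sin (Real.pi * scaledDiff ℏ (paramArray w) n s n p))
      (fun t => Real.pi / ℏ * |lowEntry t n s - lowEntry t n p|) := by
  set z : Param N → ℂ := fun w => scaledDiff ℏ (paramArray w) n s n p with hz
  have hzc : Continuous z := (PolyFun.scaledDiff ℏ n s n p).differentiable.continuous
  have hzim : Continuous fun w => |(z w).im| := (Complex.continuous_im.comp hzc).abs
  have hev : ∀ᶠ w in 𝓝 w₀, |(z w).im| < |(z w₀).im| + 1 :=
    hzim.continuousAt.eventually (gt_mem_nhds (lt_add_one _))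
  refine ⟨Real.exp (Real.pi * (|(z w₀).im| + 1)), ?_⟩
  filter_upwards [hev] with w hw t
  refine (norm_sin_le_exp_abs_im _).trans ?_
  rw [← Real.exp_add]
  refine Real.exp_le_exp.2 ?_
  have him := (abs_le.1 (abs_scaledDiff_im hℏ w t n s n p)).2
  rw [Complex.im_ofReal_mul, abs_mul, abs_of_pos Real.pi_pos]
  have e1 : Real.pi / ℏ * |lowEntry t n s - lowEntry t n p| =
          Real.pi * (|lowEntry t n s - lowEntry t n p| / ℏ) := by ring
  rw [e1, ← mul_add]
  refine mul_le_mul_of_nonneg_left ?_ Real.pi_pos.le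
  simp only [hz] at hw ⊢
  linarith

end TransBound

/-! ### The product of Gamma factors, sines and the plane wave -/

/-- The plane wave `planeWave` at complex positions. -/
def planeWaveC (ℏ : ℝ) (N : ℕ) (x : Fin N → ℂ) (a : GZArray) : ℂ :=
  Complex.exp (Complex.I / ℏ * ∑ n : Fin N, (rowSum a (n + 1) - rowSum a n) * x n)

theorem planeWaveC_ofReal (ℏ : ℝ) (N : ℕ) (x : Fin N → ℝ) (a : GZArray) :
    planeWaveC ℏ N (fun k => (x k : ℂ)) a = planeWave ℏ N x a := rfl

/-- The transcendental part of the integrand, without the plane wave. The natural numbers `e n k m`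
offset the arguments of the Gamma factors, but not the exponents of `ℏ`; with `e = 0`, multiplied
by `diffProduct` and the plane wave, this is `mbIntegrand`. -/
def gammaSin (ℏ : ℝ) (N : ℕ) (e : ℕ → ℕ → ℕ → ℕ) (a : GZArray) : ℂ :=
  ∏ n ∈ Finset.Ico 1 N,
    ((∏ k ∈ Finset.range n, ∏ m ∈ Finset.range (n + 1),
      (ℏ : ℂ) ^ scaledDiff ℏ a n k (n + 1) m *
        Complex.Gamma (scaledDiff ℏ a n k (n + 1) m + e n k m)) *
    ∏ p ∈ Finset.range n, ∏ s ∈ Finset.range p, Complex.sin (Real.pi * scaledDiff ℏ a n s n p))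

/-- The arrays at which all Gamma factors of `gammaSin ℏ N e` have arguments with positive real
part. For `e = 0` this is the condition on the heights of the lines. -/
def InDomain (ℏ : ℝ) (N : ℕ) (e : ℕ → ℕ → ℕ → ℕ) (a : GZArray) : Prop :=
  ∀ n ∈ Finset.Ico 1 N, ∀ k ∈ Finset.range n, ∀ m ∈ Finset.range (n + 1),
    0 < (scaledDiff ℏ a n k (n + 1) m + e n k m).re

/-- The change of the sum of row `n` under the real translation `t`. -/
def rowSlope {N : ℕ} (t : Low ℝ N) (n : ℕ) : ℝ :=
  ∑ j ∈ Finset.range n, lowEntry t n j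

theorem rowSum_add_realDir {N : ℕ} (w : Param N) (t : Low ℝ N) (n : ℕ) :
    rowSum (paramArray (w + realDir N t)) n = rowSum (paramArray w) n + rowSlope t n := by
  simp [rowSum, rowSlope, paramArray_add_realDir, Finset.sum_add_distrib]

theorem abs_rowSlope_le {N : ℕ} (t : Low ℝ N) (n : ℕ) : |rowSlope t n| ≤ n * ‖t‖ := by
  refine (Finset.abs_sum_le_sum_abs _ _).trans ?_
  refine (Finset.sum_le_sum fun j _ => abs_lowEntry_le t n j).trans ?_
  simp

theorem differentiable_planeWaveC {N : ℕ} (ℏ : ℝ) :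
    Differentiable ℂ fun w : Param N => planeWaveC ℏ N w.2.2 (paramArray w) := by
  unfold planeWaveC
  have h : ∀ n, Differentiable ℂ fun w : Param N => rowSum (paramArray w) n :=
    fun n => (PolyFun.rowSum n).differentiable
  refine Differentiable.cexp (Differentiable.const_mul ?_ _)
  refine Differentiable.fun_sum fun n _ => ((h _).sub (h _)).mul ?_
  fun_prop

/-- At real positions the plane wave is bounded along real translations; for positions with small
imaginary part it grows at a small exponential rate. -/
theorem transBound_planeWaveC {N : ℕ} {ℏ : ℝ} (hℏ : 0 < ℏ) (w₀ : Param N)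
    (hx : ∀ k, (w₀.2.2 k).im = 0) {η : ℝ} (hη : 0 < η) :
    TransBound w₀ (fun w => planeWaveC ℏ N w.2.2 (paramArray w)) (fun t => η * ‖t‖) := by
  have hc : Continuous fun w : Param N => ‖planeWaveC ℏ N w.2.2 (paramArray w)‖ :=
    (differentiable_planeWaveC ℏ).continuous.norm
  have h1 := hc.continuousAt.eventually (gt_mem_nhds (lt_add_one (‖planeWaveC ℏ N w₀.2.2 (paramArray w₀)‖)))
  have hc2 : Continuous fun w : Param N => ∑ n : Fin N, (2 * N) / ℏ * |(w.2.2 n).im| := by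
    fun_prop
  have h2 := hc2.continuousAt.eventually
    (gt_mem_nhds (show ∑ n : Fin N, (2 * N) / ℏ * |(w₀.2.2 n).im| < η by simpa [hx] using hη))
  refine ⟨‖planeWaveC ℏ N w₀.2.2 (paramArray w₀)‖ + 1, ?_⟩
  filter_upwards [h1, h2] with w hw1 hw2 t
  have hfac : planeWaveC ℏ N (w + realDir N t).2.2 (paramArray (w + realDir N t)) =
      planeWaveC ℏ N w.2.2 (paramArray w) *
        Complex.exp (Complex.I / ℏ *
          ∑ n : Fin N, ((rowSlope t (n + 1) - rowSlope t n : ℝ) : ℂ) * w.2.2 n) := by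
    have hx' : (w + realDir N t).2.2 = w.2.2 := by simp [realDir]
    rw [planeWaveC, planeWaveC, ← Complex.exp_add, ← mul_add, ← Finset.sum_add_distrib, hx']
    congr 2
    refine Finset.sum_congr rfl fun n _ => ?_
    rw [rowSum_add_realDir, rowSum_add_realDir]
    push_cast
    ring
  rw [hfac, norm_mul]
  refine mul_le_mul hw1.le ?_ (norm_nonneg _) (by positivity)
  rw [Complex.norm_exp]
  refine Real.exp_le_exp.2 ?_
  have hre : (Complex.I / ℏ *
          ∑ n : Fin N, ((rowSlope t (n + 1) - rowSlope t n : ℝ) : ℂ) * w.2.2 n).re =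
      ∑ n : Fin N, -((rowSlope t (n + 1) - rowSlope t n) * (w.2.2 n).im / ℏ) := by
    rw [Finset.mul_sum, Complex.re_sum]
    refine Finset.sum_congr rfl fun n _ => ?_
    rw [div_mul_eq_mul_div, Complex.div_ofReal_re, Complex.I_mul_re, Complex.im_ofReal_mul]
    ring
  rw [hre]
  calc _ ≤ ∑ n : Fin N, (2 * N) / ℏ * |(w.2.2 n).im| * ‖t‖ := by
        refine Finset.sum_le_sum fun n _ => ?_
        refine (neg_le_abs _).trans ?_
        rw [abs_div, abs_mul, abs_of_pos hℏ]
        have e1 := abs_rowSlope_le t (n + 1)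
        have e2 := abs_rowSlope_le t n
        have hn : ((n : ℕ) : ℝ) + 1 ≤ N := by exact_mod_cast n.2
        have e3 : |rowSlope t (n + 1) - rowSlope t n| ≤ 2 * N * ‖t‖ := by
          refine (abs_sub _ _).trans ?_
          push_cast at e1
          nlinarith [norm_nonneg t]
        have : 2 * N / ℏ * |(w.2.2 n).im| * ‖t‖ = 2 * N * ‖t‖ * |(w.2.2 n).im| / ℏ := by ring
        rw [this]
        gcongr
    _ = (∑ n : Fin N, (2 * N) / ℏ * |(w.2.2 n).im|) * ‖t‖ := by rw [Finset.sum_mul]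
    _ ≤ _ := by gcongr

theorem sum_exponent_eq {N : ℕ} (ℏ η : ℝ) (u : ℕ → ℕ → ℝ) :
    ∑ n ∈ Finset.Ico 1 N,
      ((∑ k ∈ Finset.range n, ∑ m ∈ Finset.range (n + 1),
        -((Real.pi / 2 - η) / ℏ * |u n k - u (n + 1) m|)) +
      ∑ p ∈ Finset.range n, ∑ s ∈ Finset.range p, Real.pi / ℏ * |u n s - u n p|) =
    (η * (∑ n ∈ Finset.range N, ∑ k ∈ Finset.range n, ∑ m ∈ Finset.range (n + 1),
        |u n k - u (n + 1) m|) -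
      Real.pi * ∑ n ∈ Finset.range N,
        ((∑ k ∈ Finset.range n, ∑ m ∈ Finset.range (n + 1), |u n k - u (n + 1) m|) / 2 -
          ∑ p ∈ Finset.range n, ∑ s ∈ Finset.range p, |u n s - u n p|)) / ℏ := by
  have hsub : Finset.Ico 1 N ⊆ Finset.range N := fun n hn =>
    Finset.mem_range.2 (Finset.mem_Ico.1 hn).2
  rw [Finset.sum_subset hsub fun n hn hn' => ?_, Finset.mul_sum, Finset.mul_sum,
    ← Finset.sum_sub_distrib, Finset.sum_div]
  · refine Finset.sum_congr rfl fun n _ => ?_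
    simp only [Finset.sum_neg_distrib, ← Finset.mul_sum]
    ring
  · have : n = 0 := by
      simp only [Finset.mem_range, Finset.mem_Ico] at hn hn'
      omega
    simp [this]

theorem exists_sum_exponent_le {N : ℕ} {ℏ : ℝ} (hℏ : 0 < ℏ) :
    ∃ ε η : ℝ, 0 < ε ∧ 0 < η ∧ η < Real.pi / 2 ∧ ∀ t : Low ℝ N,
      ∑ n ∈ Finset.Ico 1 N,
        ((∑ k ∈ Finset.range n, ∑ m ∈ Finset.range (n + 1),
          -((Real.pi / 2 - η) / ℏ * |lowEntry t n k - lowEntry t (n + 1) m|)) +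
        ∑ p ∈ Finset.range n, ∑ s ∈ Finset.range p,
          Real.pi / ℏ * |lowEntry t n s - lowEntry t n p|) ≤ -(ε * ‖t‖) := by
  obtain ⟨ε, hε, hmain⟩ := exists_pos_mul_sum_le_sum_cross_sub N
  obtain ⟨K, hK0, hAK⟩ : ∃ K : ℝ, 0 ≤ K ∧ ∀ t : Low ℝ N,
      ∑ n ∈ Finset.range N, ∑ k ∈ Finset.range n, ∑ m ∈ Finset.range (n + 1),
        |lowEntry t n k - lowEntry t (n + 1) m| ≤ K * ‖t‖ := by
    refine ⟨∑ n ∈ Finset.range N, ∑ k ∈ Finset.range n, ∑ m ∈ Finset.range (n + 1), (2 : ℝ),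
      Finset.sum_nonneg fun n _ => Finset.sum_nonneg fun k _ =>
        Finset.sum_nonneg fun m _ => zero_le_two, fun t => ?_⟩
    simp only [Finset.sum_mul]
    refine Finset.sum_le_sum fun n _ => Finset.sum_le_sum fun k _ => Finset.sum_le_sum fun m _ => ?_
    exact (abs_sub _ _).trans
      (by linarith [abs_lowEntry_le t n k, abs_lowEntry_le t (n + 1) m])
  obtain ⟨η, hηdef⟩ : ∃ η, η = min (Real.pi / 4) (Real.pi * ε / (2 * (K + 1))) := ⟨_, rfl⟩
  have hη : 0 < η := by rw [hηdef]; exact lt_min (by positivity) (by positivity)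
  have hη' : η < Real.pi / 2 := by
    rw [hηdef]; exact (min_le_left _ _).trans_lt (by linarith [Real.pi_pos])
  have hηK : η * K ≤ Real.pi * ε / 2 := by
    have h1 : η * K ≤ Real.pi * ε / (2 * (K + 1)) * (K + 1) := by
      rw [hηdef]; exact mul_le_mul (min_le_right _ _) (by linarith) hK0 (by positivity)
    refine h1.trans (le_of_eq ?_)
    field_simp
  refine ⟨Real.pi * ε / 2 / ℏ, η, by positivity, hη, hη', fun t => ?_⟩
  rw [sum_exponent_eq]
  have h1 := mul_le_mul_of_nonneg_left
    ((mul_le_mul_of_nonneg_left (norm_le_sum_abs_lowEntry t) hε.le).trans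
      (hmain (lowEntry t) (fun j => by simp [lowEntry]))) Real.pi_pos.le
  have h2 := mul_le_mul_of_nonneg_left (hAK t) hη.le
  have h3 := mul_le_mul_of_nonneg_right hηK (norm_nonneg t)
  rw [show -(Real.pi * ε / 2 / ℏ * ‖t‖) = -(Real.pi * ε / 2 * ‖t‖) / ℏ by ring]
  refine div_le_div_of_nonneg_right ?_ hℏ.le
  linarith

theorem exists_transBound_gammaSin {N : ℕ} {ℏ : ℝ} (hℏ : 0 < ℏ) :
    ∃ ε : ℝ, 0 < ε ∧ ∀ (e : ℕ → ℕ → ℕ → ℕ) (w₀ : Param N), InDomain ℏ N e (paramArray w₀) →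
      TransBound w₀ (fun w => gammaSin ℏ N e (paramArray w)) (fun t => -(ε * ‖t‖)) := by
  obtain ⟨ε, η, hε, hη, hη', h⟩ := exists_sum_exponent_le (N := N) hℏ
  refine ⟨ε, hε, fun e w₀ hw₀ => ?_⟩
  have hprod := TransBound.prod (w₀ := w₀) (s := Finset.Ico 1 N) (fun n hn =>
    (TransBound.prod (s := Finset.range n) fun k hk =>
      TransBound.prod (s := Finset.range (n + 1)) fun m hm =>
        transBound_gammaFactor hℏ (hw₀ n hn k hk m hm) hη hη').mul
    (TransBound.prod (s := Finset.range n) fun p _ =>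
      TransBound.prod (s := Finset.range p) fun s _ => transBound_sinFactor hℏ w₀ n s p))
  exact hprod.mono (B := 0) fun t => by rw [zero_add]; exact h t

/-! ### Integrability and analyticity of the integrals -/

/-- The product of a polynomial function `P`, the Gamma factors, the sines and the plane wave. -/
def integrand (ℏ : ℝ) (N : ℕ) (e : ℕ → ℕ → ℕ → ℕ) (P : GZArray → ℂ) (w : Param N) : ℂ :=
  P (paramArray w) * (gammaSin ℏ N e (paramArray w) * planeWaveC ℏ N w.2.2 (paramArray w))

/-- The parameters at which the integral of `integrand ℏ N e P` converges absolutely. -/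
def IsGood (ℏ : ℝ) (N : ℕ) (e : ℕ → ℕ → ℕ → ℕ) (w : Param N) : Prop :=
  InDomain ℏ N e (paramArray w) ∧ ∀ k, (w.2.2 k).im = 0

theorem exists_transBound_integrand {N : ℕ} {ℏ : ℝ} (hℏ : 0 < ℏ) {e : ℕ → ℕ → ℕ → ℕ}
    {P : GZArray → ℂ} (hP : PolyFun P) {w₀ : Param N} (hw : IsGood ℏ N e w₀) :
    ∃ ε : ℝ, 0 < ε ∧ TransBound w₀ (integrand ℏ N e P) (fun t => -(ε * ‖t‖)) := by
  obtain ⟨ε, hε, h⟩ := exists_transBound_gammaSin (N := N) hℏ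
  refine ⟨ε / 3, by positivity, ?_⟩
  have h3 : 0 < ε / 3 := by positivity
  refine ((hP.transBound w₀ h3).mul
    ((h e w₀ hw.1).mul (transBound_planeWaveC hℏ w₀ hw.2 h3))).mono (B := 0) fun t => ?_
  linarith

theorem eventually_inDomain {N : ℕ} {ℏ : ℝ} {e : ℕ → ℕ → ℕ → ℕ} {w₀ : Param N}
    (hw : InDomain ℏ N e (paramArray w₀)) :
    ∀ᶠ w in 𝓝 w₀, InDomain ℏ N e (paramArray w) := by
  refine (Filter.eventually_all_finset _).2 fun n hn => (Filter.eventually_all_finset _).2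
    fun k hk => (Filter.eventually_all_finset _).2 fun m hm => ?_
  have hc : Continuous fun w : Param N => (scaledDiff ℏ (paramArray w) n k (n + 1) m + e n k m).re :=
    Complex.continuous_re.comp ((PolyFun.scaledDiff ℏ n k (n + 1) m).differentiable.continuous.add_const _)
  exact hc.continuousAt.eventually (lt_mem_nhds (hw n hn k hk m hm))

theorem InDomain.add_realDir {N : ℕ} {ℏ : ℝ} {e : ℕ → ℕ → ℕ → ℕ} {w : Param N}
    (hw : InDomain ℏ N e (paramArray w)) (t : Low ℝ N) :
    InDomain ℏ N e (paramArray (w + realDir N t)) := by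
  intro n hn k hk m hm
  rw [Complex.add_re, scaledDiff_re_add_realDir, ← Complex.add_re]
  exact hw n hn k hk m hm

theorem differentiableAt_finsetProd {E ι : Type*} [NormedAddCommGroup E] [NormedSpace ℂ E]
    {s : Finset ι} {f : ι → E → ℂ} {x : E} (h : ∀ i ∈ s, DifferentiableAt ℂ (f i) x) :
    DifferentiableAt ℂ (fun y => ∏ i ∈ s, f i y) x := by
  classical
  exact (HasFDerivAt.finsetProd (g := f) fun i hi => (h i hi).hasFDerivAt).differentiableAt.congr_of_eventuallyEq
    (Eventually.of_forall fun y => by simp)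

theorem differentiableAt_gammaSin {N : ℕ} {ℏ : ℝ} (hℏ : 0 < ℏ) {e : ℕ → ℕ → ℕ → ℕ}
    {w : Param N} (hw : InDomain ℏ N e (paramArray w)) :
    DifferentiableAt ℂ (fun w : Param N => gammaSin ℏ N e (paramArray w)) w := by
  have hz : ∀ n k l m, DifferentiableAt ℂ (fun w : Param N => scaledDiff ℏ (paramArray w) n k l m) w :=
    fun n k l m => (PolyFun.scaledDiff ℏ n k l m).differentiable.differentiableAt
  unfold gammaSin
  refine differentiableAt_finsetProd fun n hn => ?_
  refine DifferentiableAt.fun_mul ?_ ?_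
  · refine differentiableAt_finsetProd fun k hk => differentiableAt_finsetProd fun m hm => ?_
    refine ((hz n k (n + 1) m).const_cpow (Or.inl (by exact_mod_cast hℏ.ne'))).mul ?_
    refine DifferentiableAt.comp (g := Complex.Gamma)
      (f := fun w : Param N => scaledDiff ℏ (paramArray w) n k (n + 1) m + e n k m) w ?_
      ((hz n k (n + 1) m).add_const _)
    refine Complex.differentiableAt_Gamma _ fun q hq => ?_
    have := hw n hn k hk m hm
    rw [hq] at this
    have h0 : (0 : ℝ) ≤ q := Nat.cast_nonneg q
    simp at this
    linarith
  · exact differentiableAt_finsetProd fun p _ => differentiableAt_finsetProd fun s _ =>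
      ((hz n s n p).const_mul _).csin

theorem differentiableAt_integrand {N : ℕ} {ℏ : ℝ} (hℏ : 0 < ℏ) {e : ℕ → ℕ → ℕ → ℕ}
    {P : GZArray → ℂ} (hP : PolyFun P) {w : Param N} (hw : InDomain ℏ N e (paramArray w)) :
    DifferentiableAt ℂ (integrand ℏ N e P) w :=
  hP.differentiable.differentiableAt.fun_mul
    ((differentiableAt_gammaSin hℏ hw).fun_mul (differentiable_planeWaveC ℏ).differentiableAt)

theorem integrable_exp_neg_mul_norm {E : Type*} [NormedAddCommGroup E] [NormedSpace ℝ E]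
    [FiniteDimensional ℝ E] [MeasurableSpace E] [BorelSpace E] (μ : Measure E)
    [μ.IsAddHaarMeasure] {ε : ℝ} (hε : 0 < ε) :
    Integrable (fun x : E => Real.exp (-(ε * ‖x‖))) μ := by
  set d : ℕ := Module.finrank ℝ E + 1 with hd
  have hI := integrable_one_add_norm (E := E) (μ := μ) (r := d) (by rw [hd]; push_cast; linarith)
  -- compare with `(1 + ‖x‖) ^ (-d)` through `(ε (1 + ‖x‖)) ^ d ≤ d! exp (ε (1 + ‖x‖))`
  refine (hI.const_mul (d.factorial * Real.exp ε / ε ^ d)).mono'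
    (by fun_prop) (Eventually.of_forall fun x => ?_)
  have hpos : 0 < 1 + ‖x‖ := by positivity
  have h := Real.pow_div_factorial_le_exp (ε * (1 + ‖x‖)) (by positivity) d
  rw [Real.norm_of_nonneg (Real.exp_pos _).le, Real.rpow_neg hpos.le, Real.rpow_natCast]
  have h1 : Real.exp (-(ε * ‖x‖)) = Real.exp ε / Real.exp (ε * (1 + ‖x‖)) := by
    rw [← Real.exp_sub]; congr 1; ring
  rw [h1, div_le_iff₀ (Real.exp_pos _)]
  rw [div_le_iff₀ (by positivity), mul_pow] at h
  have h2 : Real.exp ε = (Real.exp ε / ε ^ d * ((1 + ‖x‖) ^ d)⁻¹) * (ε ^ d * (1 + ‖x‖) ^ d) := by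
    field_simp
  calc Real.exp ε = (Real.exp ε / ε ^ d * ((1 + ‖x‖) ^ d)⁻¹) * (ε ^ d * (1 + ‖x‖) ^ d) := h2
    _ ≤ (Real.exp ε / ε ^ d * ((1 + ‖x‖) ^ d)⁻¹) * (Real.exp (ε * (1 + ‖x‖)) * d.factorial) := by
        gcongr
    _ = _ := by ring

theorem integrable_and_hasFDerivAt_integral_integrand {N : ℕ} {ℏ : ℝ} (hℏ : 0 < ℏ) {e : ℕ → ℕ → ℕ → ℕ}
    {P : GZArray → ℂ} (hP : PolyFun P) {w₀ : Param N} (hw : IsGood ℏ N e w₀) :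
    Integrable (fun t => integrand ℏ N e P (w₀ + realDir N t)) ∧
    Integrable (fun t => fderiv ℂ (fun w => integrand ℏ N e P (w + realDir N t)) w₀) ∧
    HasFDerivAt (fun w => ∫ t, integrand ℏ N e P (w + realDir N t))
      (∫ t, fderiv ℂ (fun w => integrand ℏ N e P (w + realDir N t)) w₀) w₀ := by
  obtain ⟨ε, hε, C, hC⟩ := exists_transBound_integrand hℏ hP hw
  have hg : Integrable (fun t : Low ℝ N => C * Real.exp (-(ε * ‖t‖))) :=
    (integrable_exp_neg_mul_norm volume hε).const_mul C
  have hcd : Continuous (realDir N) := LinearMap.continuous_of_finiteDimensional _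
  have hd : ∀ᶠ w in 𝓝 w₀, ∀ t,
      DifferentiableAt ℂ (integrand ℏ N e P) (w + realDir N t) := by
    filter_upwards [eventually_inDomain hw.1] with w hw t
    exact differentiableAt_integrand hℏ hP (hw.add_realDir t)
  have hm : ∀ᶠ w in 𝓝 w₀,
      AEStronglyMeasurable (fun t => integrand ℏ N e P (w + realDir N t)) := by
    filter_upwards [hd] with w hw
    refine Continuous.aestronglyMeasurable ?_
    refine continuous_iff_continuousAt.2 fun t => ?_
    exact ContinuousAt.comp (f := fun t => w + realDir N t) (hw t).continuousAt
      (hcd.const_add w).continuousAt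
  refine ⟨?_, hasFDerivAt_integral_of_holomorphic hg hm ?_ hC⟩
  · exact hg.mono' hm.self_of_nhds (Eventually.of_forall hC.self_of_nhds)
  · filter_upwards [hd] with w hw t
    exact DifferentiableAt.comp (f := fun w => w + realDir N t) w (hw t) (by fun_prop)

/-- The domain is convex in the imaginary parts of the entries. -/
theorem IsGood.add_smul_I_smul_realDir {N : ℕ} {ℏ : ℝ} {e : ℕ → ℕ → ℕ → ℕ}
    {w : Param N} {d : Low ℝ N} (hw : IsGood ℏ N e w)
    (hw' : IsGood ℏ N e (w + Complex.I • realDir N d)) {τ : ℝ} (hτ : τ ∈ Set.Icc (0 : ℝ) 1) :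
    IsGood ℏ N e (w + (τ : ℂ) • Complex.I • realDir N d) := by
  refine ⟨fun n hn k hk m hm => ?_, ?_⟩
  · have h1 := hw.1 n hn k hk m hm
    have h2 := hw'.1 n hn k hk m hm
    rw [Complex.add_re, scaledDiff_re] at *
    rw [smul_smul]
    simp only [paramArray_add_smul_realDir] at *
    simp only [Complex.add_im, Complex.mul_im, Complex.I_re, Complex.I_im, Complex.ofReal_im,
      Complex.ofReal_re, Complex.mul_re] at *
    obtain ⟨hτ0, hτ1⟩ := hτ
    have : 0 < (1 - τ) * (((paramArray w n k).im - (paramArray w (n + 1) m).im) / ℏ + (e n k m : ℂ).re) +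
        τ * (((paramArray w n k).im + (0 * 0 + 1 * lowEntry d n k) -
          ((paramArray w (n + 1) m).im + (0 * 0 + 1 * lowEntry d (n + 1) m))) / ℏ + (e n k m : ℂ).re) := by
      rcases hτ0.eq_or_lt with rfl | hpos
      · simpa using h1
      · exact add_pos_of_nonneg_of_pos (mul_nonneg (by linarith) h1.le) (mul_pos hpos h2)
    refine this.trans_le (le_of_eq ?_)
    ring
  · intro k
    have := hw.2 k
    simpa [realDir] using this

/-- The integral does not change when the lines move by `d` inside the domain. -/
theorem integral_integrand_shift {N : ℕ} {ℏ : ℝ} (hℏ : 0 < ℏ) {e : ℕ → ℕ → ℕ → ℕ}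
    {P : GZArray → ℂ} (hP : PolyFun P) {w : Param N} {d : Low ℝ N} (hw : IsGood ℏ N e w)
    (hw' : IsGood ℏ N e (w + Complex.I • realDir N d)) :
    ∫ t, integrand ℏ N e P (w + Complex.I • realDir N d + realDir N t) =
      ∫ t, integrand ℏ N e P (w + realDir N t) :=
  integral_translate_eq_of_segment (realDir N) fun _ hτ =>
    (integrable_and_hasFDerivAt_integral_integrand hℏ hP (hw.add_smul_I_smul_realDir hw' hτ)).2.2.differentiableAt

/-! ### Shifting one entry of the array -/

theorem shiftEntry_apply (a : GZArray) (n j : ℕ) (s : ℂ) (n' k : ℕ) :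
    shiftEntry a n j s n' k = a n' k + if n' = n ∧ k = j then s else 0 := by
  unfold shiftEntry
  by_cases h1 : n' = n
  · subst h1
    by_cases h2 : k = j
    · subst h2; simp
    · simp [h2]
  · simp [h1]

theorem scaledDiff_shiftEntry (ℏ : ℝ) (a : GZArray) (n j : ℕ) (s : ℂ) (n' k l m : ℕ) :
    scaledDiff ℏ (shiftEntry a n j s) n' k l m =
      scaledDiff ℏ a n' k l m + (if n' = n ∧ k = j then s / (Complex.I * ℏ) else 0) -
        (if l = n ∧ m = j then s / (Complex.I * ℏ) else 0) := by
  simp only [scaledDiff, shiftEntry_apply]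
  split_ifs <;> ring

theorem rowSum_shiftEntry (a : GZArray) {n j : ℕ} (hj : j < n) (s : ℂ) (n' : ℕ) :
    rowSum (shiftEntry a n j s) n' = rowSum a n' + if n' = n then s else 0 := by
  simp only [rowSum, shiftEntry_apply, Finset.sum_add_distrib]
  by_cases h : n' = n
  · subst h; simp [Finset.sum_ite_eq', hj]
  · simp [h]

/-- A product over all Gamma factors of a quantity that is trivial unless the factor contains the
entry `(n, j)`. (If `n = 1` there is no level below, and the second product is empty.) -/
theorem prod_level_entry {N n j : ℕ} (hn : n ∈ Finset.Ico 1 N) (hj : j < n) (A B : ℕ → ℂ) :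
    ∏ n' ∈ Finset.Ico 1 N, ∏ k ∈ Finset.range n', ∏ m ∈ Finset.range (n' + 1),
      (if n' = n ∧ k = j then A m else if n' + 1 = n ∧ m = j then B k else 1) =
    (∏ m ∈ Finset.range (n + 1), A m) * ∏ k ∈ Finset.range (n - 1), B k := by
  have h1 : ∏ k ∈ Finset.range n, ∏ m ∈ Finset.range (n + 1),
      (if n = n ∧ k = j then A m else if n + 1 = n ∧ m = j then B k else 1) =
      ∏ m ∈ Finset.range (n + 1), A m := by
    rw [Finset.prod_eq_single j]
    · simp
    · intro k _ hk; simp [hk]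
    · intro h; exact absurd (Finset.mem_range.2 hj) h
  have h2 : ∀ n', n' + 1 = n → ∏ k ∈ Finset.range n', ∏ m ∈ Finset.range (n' + 1),
      (if n' = n ∧ k = j then A m else if n' + 1 = n ∧ m = j then B k else 1) =
      ∏ k ∈ Finset.range n', B k := by
    intro n' hn'
    refine Finset.prod_congr rfl fun k _ => ?_
    have hne : n' ≠ n := by omega
    simp only [hne, false_and, if_false, hn', true_and]
    rw [Finset.prod_ite_eq' (Finset.range n) j fun _ => B k, if_pos (Finset.mem_range.2 hj)]
  have h3 : ∀ n', n' ≠ n → n' + 1 ≠ n → ∏ k ∈ Finset.range n', ∏ m ∈ Finset.range (n' + 1),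
      (if n' = n ∧ k = j then A m else if n' + 1 = n ∧ m = j then B k else 1) = 1 := by
    intro n' hn1 hn2
    simp [hn1, hn2]
  have hn' := Finset.mem_Ico.1 hn
  rcases Nat.lt_or_ge n 2 with h | h
  · obtain rfl : n = 1 := by omega
    rw [Finset.prod_eq_single 1, h1]
    · simp
    · intro b hb hb1
      have := (Finset.mem_Ico.1 hb).1
      exact h3 b hb1 (by omega)
    · intro h; exact absurd hn h
  · rw [Finset.prod_eq_mul n (n - 1) (by omega), h1, h2 (n - 1) (by omega)]
    · intro b _ hb
      exact h3 b hb.1 (by omega)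
    · intro h; exact absurd hn h
    · intro h; exact absurd (Finset.mem_Ico.2 ⟨by omega, by omega⟩) h

/-- A product over the pairs `s < p` of a quantity that is trivial unless the pair contains `j`. -/
theorem prod_pairs_containing {n j : ℕ} (hj : j < n) (f : ℕ → ℂ) :
    ∏ p ∈ Finset.range n, ∏ s ∈ Finset.range p,
      (if s = j then f p else if p = j then f s else 1) =
    ∏ s ∈ (Finset.range n).erase j, f s := by
  induction n, (Nat.succ_le_of_lt hj) using Nat.le_induction with
  | base =>
    rw [Finset.prod_range_succ, Finset.prod_eq_one fun p hp => ?_, one_mul, Nat.succ_eq_add_one,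
      Finset.range_add_one, Finset.erase_insert Finset.notMem_range_self]
    · refine Finset.prod_congr rfl fun s hs => ?_
      have := (Finset.mem_range.1 hs).ne
      simp [this]
    · refine Finset.prod_eq_one fun s hs => ?_
      have h1 := Finset.mem_range.1 hs
      have h2 := Finset.mem_range.1 hp
      rw [if_neg (by omega), if_neg (by omega)]
  | succ n hn ih =>
    have hn' : j < n := hn
    rw [Finset.prod_range_succ, ih hn', Finset.range_add_one,
      Finset.erase_insert_of_ne (by omega), Finset.prod_insert (by simp), mul_comm]
    congr 1
    have hne : n ≠ j := by omega
    simp only [hne, if_false]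
    rw [Finset.prod_ite_eq' (Finset.range n) j fun _ => f n, if_pos (Finset.mem_range.2 hn')]

/-- The offset `1` for the Gamma factors joining the entry `(n, j)` to level `n - 1`: they allow
the line of `γ_{n,j}` to rise by `ℏ`. -/
def entryOffset (n j : ℕ) : ℕ → ℕ → ℕ → ℕ := fun n' _ m => if n' + 1 = n ∧ m = j then 1 else 0

theorem prod_sin_shiftEntry {ℏ : ℝ} (hℏ : 0 < ℏ) (a : GZArray) {N n j : ℕ}
    (hn : n ∈ Finset.Ico 1 N) (hj : j < n) :
    ∏ n' ∈ Finset.Ico 1 N, ∏ p ∈ Finset.range n', ∏ s ∈ Finset.range p,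
      Complex.sin (Real.pi * scaledDiff ℏ (shiftEntry a n j (Complex.I * ℏ)) n' s n' p) =
    (-1) ^ (n - 1) * ∏ n' ∈ Finset.Ico 1 N, ∏ p ∈ Finset.range n', ∏ s ∈ Finset.range p,
      Complex.sin (Real.pi * scaledDiff ℏ a n' s n' p) := by
  have hI : Complex.I * ℏ / (Complex.I * ℏ) = 1 :=
    div_self (mul_ne_zero Complex.I_ne_zero (by exact_mod_cast hℏ.ne'))
  rw [← Finset.mul_prod_erase _ _ hn, ← Finset.mul_prod_erase _ _ hn, ← mul_assoc]
  congr 1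
  · have hcount : ((-1 : ℂ)) ^ (n - 1) = ∏ p ∈ Finset.range n, ∏ s ∈ Finset.range p,
        (if s = j then (fun _ => (-1 : ℂ)) p else if p = j then (fun _ => (-1 : ℂ)) s else 1) := by
      rw [prod_pairs_containing hj (fun _ => (-1 : ℂ)), Finset.prod_const,
        Finset.card_erase_of_mem (Finset.mem_range.2 hj), Finset.card_range]
    rw [hcount, ← Finset.prod_mul_distrib]
    refine Finset.prod_congr rfl fun p _ => ?_
    rw [← Finset.prod_mul_distrib]
    refine Finset.prod_congr rfl fun s hs => ?_
    have hsp := (Finset.mem_range.1 hs).ne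
    rw [scaledDiff_shiftEntry, hI]
    by_cases h1 : s = j
    · have h2 : p ≠ j := fun h => hsp (h1.trans h.symm)
      simp only [h1, h2, and_false, and_self, if_true, if_false, sub_zero]
      rw [mul_add, mul_one, Complex.sin_add_pi, neg_one_mul]
    · by_cases h2 : p = j
      · simp only [h1, h2, and_false, and_self, if_true, if_false, add_zero]
        rw [mul_sub, mul_one, Complex.sin_sub_pi, neg_one_mul]
      · simp [h1, h2]
  · refine Finset.prod_congr rfl fun n' hn' => ?_
    have := Finset.ne_of_mem_erase hn'
    simp [scaledDiff_shiftEntry, this]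

theorem gammaSin_eq_mul (ℏ : ℝ) (N : ℕ) (e : ℕ → ℕ → ℕ → ℕ) (a : GZArray) :
    gammaSin ℏ N e a = (∏ n ∈ Finset.Ico 1 N, ∏ k ∈ Finset.range n, ∏ m ∈ Finset.range (n + 1),
      (ℏ : ℂ) ^ scaledDiff ℏ a n k (n + 1) m *
        Complex.Gamma (scaledDiff ℏ a n k (n + 1) m + e n k m)) *
    ∏ n ∈ Finset.Ico 1 N, ∏ p ∈ Finset.range n, ∏ s ∈ Finset.range p,
      Complex.sin (Real.pi * scaledDiff ℏ a n s n p) := by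
  rw [gammaSin, Finset.prod_mul_distrib]

theorem InDomain.scaledDiff_ne_zero {ℏ : ℝ} {N : ℕ} {a : GZArray} (ha : InDomain ℏ N 0 a)
    {n k m : ℕ} (hn : n ∈ Finset.Ico 1 N) (hk : k ∈ Finset.range n)
    (hm : m ∈ Finset.range (n + 1)) : scaledDiff ℏ a n k (n + 1) m ≠ 0 := by
  intro h
  have := ha n hn k hk m hm
  simp [h] at this

theorem gammaSin_entryOffset {ℏ : ℝ} (hℏ : 0 < ℏ) {N n j : ℕ} (hn : n ∈ Finset.Ico 1 N)
    (hj : j < n) {a : GZArray} (ha : InDomain ℏ N 0 a) :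
    gammaSin ℏ N (entryOffset n j) a =
      (Complex.I / ℏ) ^ (n - 1) * (∏ k ∈ Finset.range (n - 1), (a n j - a (n - 1) k)) *
        gammaSin ℏ N 0 a := by
  have hℏ' : (ℏ : ℂ) ≠ 0 := by exact_mod_cast hℏ.ne'
  rw [gammaSin_eq_mul, gammaSin_eq_mul, ← mul_assoc]
  congr 1
  have hlev := prod_level_entry hn hj (fun _ => 1) (fun k => scaledDiff ℏ a (n - 1) k n j)
  have hc : (∏ m ∈ Finset.range (n + 1), (1 : ℂ)) *
      ∏ k ∈ Finset.range (n - 1), scaledDiff ℏ a (n - 1) k n j =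
      (Complex.I / ℏ) ^ (n - 1) * ∏ k ∈ Finset.range (n - 1), (a n j - a (n - 1) k) := by
    rw [Finset.prod_const_one, one_mul, ← Finset.card_range (n - 1), ← Finset.prod_const,
      Finset.card_range, ← Finset.prod_mul_distrib]
    refine Finset.prod_congr rfl fun k _ => ?_
    rw [scaledDiff]
    field_simp
    rw [Complex.I_sq]
    ring
  rw [← hc, ← hlev, ← Finset.prod_mul_distrib]
  refine Finset.prod_congr rfl fun n' hn' => ?_
  rw [← Finset.prod_mul_distrib]
  refine Finset.prod_congr rfl fun k hk => ?_
  rw [← Finset.prod_mul_distrib]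
  refine Finset.prod_congr rfl fun m hm => ?_
  by_cases h : n' + 1 = n ∧ m = j
  · obtain ⟨h1, rfl⟩ := h
    have hne : n' ≠ n := by omega
    have hn1 : n - 1 = n' := by omega
    have hz := ha.scaledDiff_ne_zero hn' hk hm
    subst h1
    simp only [entryOffset, hne, false_and, if_false, and_self, if_true, Nat.cast_one,
      Pi.zero_apply, Nat.cast_zero, add_zero, hn1]
    rw [Complex.Gamma_add_one _ hz]
    ring
  · simp only [entryOffset, if_neg h, Pi.zero_apply]
    simp

/-- The behaviour of the offset factors under `γ_{n,j} ↦ γ_{n,j} + iℏ`: the factors towards level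
`n + 1` gain `∏_m ℏ z_m`, those towards level `n - 1` lose their offset, and the `n - 1` sines
containing the entry change sign. -/
theorem gammaSin_shiftEntry {ℏ : ℝ} (hℏ : 0 < ℏ) {N n j : ℕ} (hn : n ∈ Finset.Ico 1 N)
    (hj : j < n) {a : GZArray} (ha : InDomain ℏ N 0 a) :
    gammaSin ℏ N (entryOffset n j) (shiftEntry a n j (Complex.I * ℏ)) =
      -((Complex.I / ℏ) ^ (n - 1) * (∏ m ∈ Finset.range (n + 1), (a n j - a (n + 1) m)) *
        gammaSin ℏ N 0 a) := by
  have hℏ' : (ℏ : ℂ) ≠ 0 := by exact_mod_cast hℏ.ne'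
  have hI : Complex.I * ℏ / (Complex.I * ℏ) = 1 :=
    div_self (mul_ne_zero Complex.I_ne_zero hℏ')
  have h1n := (Finset.mem_Ico.1 hn).1
  rw [gammaSin_eq_mul, gammaSin_eq_mul, prod_sin_shiftEntry hℏ a hn hj]
  have hlev := prod_level_entry hn hj (fun m => ℏ * scaledDiff ℏ a n j (n + 1) m)
    (fun _ => (ℏ : ℂ)⁻¹)
  have hc : (∏ m ∈ Finset.range (n + 1), (ℏ * scaledDiff ℏ a n j (n + 1) m)) *
      ∏ k ∈ Finset.range (n - 1), (ℏ : ℂ)⁻¹ =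
      -((-1) ^ (n - 1) * (Complex.I / ℏ) ^ (n - 1)) *
        ∏ m ∈ Finset.range (n + 1), (a n j - a (n + 1) m) := by
    have h2 : ∀ m, ℏ * scaledDiff ℏ a n j (n + 1) m = -Complex.I * (a n j - a (n + 1) m) := by
      intro m
      rw [scaledDiff]
      field_simp
      rw [Complex.I_sq]
      ring
    simp only [h2]
    rw [Finset.prod_mul_distrib, Finset.prod_const, Finset.prod_const, Finset.card_range,
      Finset.card_range]
    obtain ⟨q, rfl⟩ : ∃ q, n = q + 1 := ⟨n - 1, by omega⟩
    rw [Nat.add_sub_cancel, ← mul_pow, pow_add, pow_add, neg_pow, div_eq_mul_inv, ← mul_assoc (-1),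
      mul_pow _ _ q, mul_pow _ _ q]
    linear_combination (-((-1) ^ q * Complex.I ^ q * (∏ m ∈ Finset.range (q + 1 + 1), (a (q + 1) j - a (q + 1 + 1) m)) * ((ℏ : ℂ)⁻¹) ^ q)) * (-Complex.I_sq)
  have hg : ∏ n' ∈ Finset.Ico 1 N, ∏ k ∈ Finset.range n', ∏ m ∈ Finset.range (n' + 1),
      ((ℏ : ℂ) ^ scaledDiff ℏ (shiftEntry a n j (Complex.I * ℏ)) n' k (n' + 1) m *
        Complex.Gamma (scaledDiff ℏ (shiftEntry a n j (Complex.I * ℏ)) n' k (n' + 1) m +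
          entryOffset n j n' k m)) =
      (-((-1) ^ (n - 1) * (Complex.I / ℏ) ^ (n - 1)) *
        ∏ m ∈ Finset.range (n + 1), (a n j - a (n + 1) m)) *
      ∏ n' ∈ Finset.Ico 1 N, ∏ k ∈ Finset.range n', ∏ m ∈ Finset.range (n' + 1),
      ((ℏ : ℂ) ^ scaledDiff ℏ a n' k (n' + 1) m *
        Complex.Gamma (scaledDiff ℏ a n' k (n' + 1) m + (0 : ℕ → ℕ → ℕ → ℕ) n' k m)) := by
    rw [← hc, ← hlev, ← Finset.prod_mul_distrib]
    refine Finset.prod_congr rfl fun n' hn' => ?_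
    rw [← Finset.prod_mul_distrib]
    refine Finset.prod_congr rfl fun k hk => ?_
    rw [← Finset.prod_mul_distrib]
    refine Finset.prod_congr rfl fun m hm => ?_
    rw [scaledDiff_shiftEntry, hI]
    have hz := ha.scaledDiff_ne_zero hn' hk hm
    by_cases h : n' = n ∧ k = j
    · obtain ⟨rfl, rfl⟩ := h
      have hne : n' + 1 ≠ n' := by omega
      simp only [entryOffset, hne, false_and, if_false, and_self, if_true, Nat.cast_zero,
        Pi.zero_apply, add_zero, sub_zero]
      rw [Complex.Gamma_add_one _ hz, Complex.cpow_add _ _ hℏ', Complex.cpow_one]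
      ring
    · by_cases h' : n' + 1 = n ∧ m = j
      · simp only [entryOffset, if_neg h, if_pos h', Nat.cast_one, Pi.zero_apply, Nat.cast_zero,
          add_zero, sub_add_cancel]
        rw [Complex.cpow_sub _ _ hℏ', Complex.cpow_one]
        ring
      · simp only [entryOffset, if_neg h, if_neg h', Nat.cast_zero, Pi.zero_apply, add_zero,
          sub_zero, one_mul]
  rw [hg]
  have hs : ((-1 : ℂ)) ^ (n - 1) * (-1) ^ (n - 1) = 1 := by
    rw [← mul_pow]; simp
  linear_combination (-(Complex.I / ℏ) ^ (n - 1) * (∏ m ∈ Finset.range (n + 1), (a n j - a (n + 1) m)) *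
    (∏ n' ∈ Finset.Ico 1 N, ∏ k ∈ Finset.range n', ∏ m ∈ Finset.range (n' + 1),
      ((ℏ : ℂ) ^ scaledDiff ℏ a n' k (n' + 1) m *
        Complex.Gamma (scaledDiff ℏ a n' k (n' + 1) m + (0 : ℕ → ℕ → ℕ → ℕ) n' k m))) *
    ∏ n' ∈ Finset.Ico 1 N, ∏ p ∈ Finset.range n', ∏ s ∈ Finset.range p,
      Complex.sin (Real.pi * scaledDiff ℏ a n' s n' p)) * hs

theorem planeWaveC_shiftEntry {ℏ : ℝ} (hℏ : 0 < ℏ) {N n j : ℕ} (hn1 : n - 1 < N) (hnN : n < N)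
    (hj : j < n) (x : Fin N → ℂ) (a : GZArray) :
    planeWaveC ℏ N x (shiftEntry a n j (Complex.I * ℏ)) =
      Complex.exp (-(x ⟨n - 1, hn1⟩ - x ⟨n, hnN⟩)) * planeWaveC ℏ N x a := by
  have hℏ' : (ℏ : ℂ) ≠ 0 := by exact_mod_cast hℏ.ne'
  rw [planeWaveC, planeWaveC, ← Complex.exp_add]
  congr 1
  have h : ∀ k : Fin N, (rowSum (shiftEntry a n j (Complex.I * ℏ)) (k + 1) -
      rowSum (shiftEntry a n j (Complex.I * ℏ)) k) * x k =
      (rowSum a (k + 1) - rowSum a k) * x k + (Complex.I * ℏ *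
        ((if k = ⟨n - 1, hn1⟩ then x k else 0) - if k = ⟨n, hnN⟩ then x k else 0)) := by
    intro k
    rw [rowSum_shiftEntry a hj, rowSum_shiftEntry a hj]
    have e1 : ((k : ℕ) + 1 = n) ↔ (k = ⟨n - 1, hn1⟩) := by
      rw [Fin.ext_iff]; simp only; omega
    have e2 : ((k : ℕ) = n) ↔ (k = ⟨n, hnN⟩) := by
      rw [Fin.ext_iff]
    simp only [e1, e2]
    split_ifs <;> ring
  rw [Finset.sum_congr rfl fun k _ => h k, Finset.sum_add_distrib, ← Finset.mul_sum,
    Finset.sum_sub_distrib, Finset.sum_ite_eq' Finset.univ, Finset.sum_ite_eq' Finset.univ,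
    if_pos (Finset.mem_univ _), if_pos (Finset.mem_univ _)]
  have hI : Complex.I / ℏ * (Complex.I * ℏ) = -1 := by
    rw [div_mul_eq_mul_div, mul_comm Complex.I ℏ, mul_div_assoc, mul_div_assoc]
    field_simp
    exact Complex.I_sq
  rw [mul_add, ← mul_assoc (Complex.I / ℏ) (Complex.I * ℏ), hI]
  ring

/-! ### The difference product -/

/-- The polynomial factor `∏ (-w / π)` of the reflection formula, over all pairs in a row. -/
def diffProduct (ℏ : ℝ) (N : ℕ) (a : GZArray) : ℂ :=
  ∏ n ∈ Finset.Ico 1 N, ∏ p ∈ Finset.range n, ∏ s ∈ Finset.range p,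
    (-scaledDiff ℏ a n s n p / Real.pi)

theorem polyFun_diffProduct (ℏ : ℝ) (N : ℕ) : PolyFun (diffProduct ℏ N) := by
  refine PolyFun.prod fun n _ => PolyFun.prod fun p _ => PolyFun.prod fun s _ => ?_
  simpa [div_eq_mul_inv] using
    ((PolyFun.const (-1)).mul (PolyFun.scaledDiff ℏ n s n p)).mul (.const ((Real.pi : ℂ)⁻¹))

/-- The factors of the difference product that contain the entry `(n, j)` split off; the cofactor
does not depend on that entry. -/
theorem exists_diffProduct_eq_mul (ℏ : ℝ) {N n j : ℕ} (hn : n ∈ Finset.Ico 1 N) (hj : j < n) :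
    ∃ R : GZArray → ℂ, PolyFun R ∧ (∀ a z, R (shiftEntry a n j z) = R a) ∧
      ∀ a, diffProduct ℏ N a = R a * ∏ s ∈ (Finset.range n).erase j, (a n j - a n s) := by
  set r : ℕ → ℕ → GZArray → ℂ := fun p s a =>
    if s = j then -(Real.pi : ℂ)⁻¹ * (Complex.I * ℏ)⁻¹ else
    if p = j then (Real.pi : ℂ)⁻¹ * (Complex.I * ℏ)⁻¹ else
      -scaledDiff ℏ a n s n p / Real.pi with hr
  have hpoly : ∀ n' s p, PolyFun fun a => -scaledDiff ℏ a n' s n' p / (Real.pi : ℂ) := by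
    intro n' s p
    simpa [div_eq_mul_inv] using
      ((PolyFun.const (-1)).mul (PolyFun.scaledDiff ℏ n' s n' p)).mul (.const ((Real.pi : ℂ)⁻¹))
  refine ⟨fun a => (∏ p ∈ Finset.range n, ∏ s ∈ Finset.range p, r p s a) *
    ∏ n' ∈ (Finset.Ico 1 N).erase n, ∏ p ∈ Finset.range n', ∏ s ∈ Finset.range p,
      (-scaledDiff ℏ a n' s n' p / Real.pi), ?_, ?_, ?_⟩
  · refine PolyFun.mul (PolyFun.prod fun p _ => PolyFun.prod fun s _ => ?_)
      (PolyFun.prod fun n' _ => PolyFun.prod fun p _ => PolyFun.prod fun s _ => hpoly n' s p)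
    simp only [hr]
    split_ifs
    · exact .const _
    · exact .const _
    · exact hpoly n s p
  · intro a z
    refine congrArg₂ (· * ·) ?_ ?_
    · refine Finset.prod_congr rfl fun p _ => Finset.prod_congr rfl fun s _ => ?_
      simp only [hr, scaledDiff_shiftEntry]
      split_ifs <;> simp_all
    · refine Finset.prod_congr rfl fun n' hn' => Finset.prod_congr rfl fun p _ =>
        Finset.prod_congr rfl fun s _ => ?_
      have := Finset.ne_of_mem_erase hn'
      simp [scaledDiff_shiftEntry, this]
  · intro a
    rw [diffProduct, ← Finset.mul_prod_erase _ _ hn, mul_right_comm]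
    congr 1
    rw [← prod_pairs_containing hj (fun s => a n j - a n s), ← Finset.prod_mul_distrib]
    refine Finset.prod_congr rfl fun p _ => ?_
    rw [← Finset.prod_mul_distrib]
    refine Finset.prod_congr rfl fun s hs => ?_
    have hsp := (Finset.mem_range.1 hs).ne
    simp only [hr, scaledDiff]
    split_ifs with h1 h2
    · subst h1; ring
    · subst h2; ring
    · ring

/-! ### The integrals as functions of the positions -/

/-- The point of the parameter space over the lines `Im = c`, at real positions `x`. -/
def basePoint {N : ℕ} (γ : Fin N → ℂ) (c : Low ℝ N) (x : Fin N → ℝ) : Param N :=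
  (fun n j => (c n j : ℂ) * Complex.I, γ, fun k => (x k : ℂ))

theorem paramArray_basePoint_add {N : ℕ} (γ : Fin N → ℂ) (c : Low ℝ N) (x : Fin N → ℝ)
    (t : Low ℝ N) : paramArray (basePoint γ c x + realDir N t) = lineArray N γ c t := by
  simp only [paramArray, lineArray, basePoint, realDir]
  congr 1
  · simp
  · funext n j; simp [add_comm]

/-- The integral over the lines `Im = c` of the integrand with polynomial factor `P`, as a function
of the positions. -/
def lineIntegral (ℏ : ℝ) {N : ℕ} (γ : Fin N → ℂ) (c : Low ℝ N) (P : GZArray → ℂ)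
    (x : Fin N → ℝ) : ℂ :=
  ∫ t : Low ℝ N, integrand ℏ N 0 P (basePoint γ c x + realDir N t)

section lineIntegral
variable {ℏ : ℝ} {N : ℕ} {γ : Fin N → ℂ} {c : Low ℝ N}

theorem isGood_basePoint (e : ℕ → ℕ → ℕ → ℕ) {x : Fin N → ℝ}
    (hc : InDomain ℏ N e (paramArray (basePoint γ c x))) : IsGood ℏ N e (basePoint γ c x) :=
  ⟨hc, fun k => by simp [basePoint]⟩

/-- The derivative of `basePoint` in the positions. -/
def basePointDir (N : ℕ) : (Fin N → ℝ) →L[ℝ] Param N :=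
  (0 : (Fin N → ℝ) →L[ℝ] Low ℂ N).prod ((0 : (Fin N → ℝ) →L[ℝ] (Fin N → ℂ)).prod
    (ContinuousLinearMap.pi fun k => Complex.ofRealCLM.comp (ContinuousLinearMap.proj k)))

theorem basePoint_eq (x : Fin N → ℝ) :
    basePoint γ c x = basePoint γ c 0 + basePointDir N x := by
  refine Prod.ext ?_ (Prod.ext ?_ ?_) <;> simp [basePoint, basePointDir]
  rfl

/-- The logarithmic derivative of the plane wave in the direction `y`. -/
def waveSlope (ℏ : ℝ) (N : ℕ) (y : Fin N → ℝ) (a : GZArray) : ℂ :=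
  Complex.I / ℏ * ∑ n : Fin N, (rowSum a (n + 1) - rowSum a n) * (y n : ℂ)

theorem polyFun_waveSlope (ℏ : ℝ) (y : Fin N → ℝ) : PolyFun (waveSlope ℏ N y) :=
  (PolyFun.const _).mul (PolyFun.sum fun n _ =>
    ((PolyFun.rowSum _).sub (PolyFun.rowSum _)).mul (PolyFun.const _))

theorem fderiv_integrand_basePointDir (hℏ : 0 < ℏ) {P : GZArray → ℂ} (hP : PolyFun P)
    {e : ℕ → ℕ → ℕ → ℕ} {w : Param N} (hw : InDomain ℏ N e (paramArray w)) (t : Low ℝ N)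
    (y : Fin N → ℝ) :
    fderiv ℂ (fun w => integrand ℏ N e P (w + realDir N t)) w (basePointDir N y) =
      integrand ℏ N e (fun a => P a * waveSlope ℏ N y a) (w + realDir N t) := by
  have hd : DifferentiableAt ℂ (fun w => integrand ℏ N e P (w + realDir N t)) w :=
    DifferentiableAt.comp (f := fun w => w + realDir N t) w
      (differentiableAt_integrand hℏ hP (hw.add_realDir t)) (by fun_prop)
  have hline : HasDerivAt (fun s : ℂ => w + s • basePointDir N y) (basePointDir N y) 0 := by
    simpa using ((hasDerivAt_id (0 : ℂ)).smul_const (basePointDir N y)).const_add w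
  have h1 : HasDerivAt (fun s : ℂ => integrand ℏ N e P (w + s • basePointDir N y + realDir N t))
      (fderiv ℂ (fun w => integrand ℏ N e P (w + realDir N t)) w (basePointDir N y)) 0 := by
    have hd' : HasFDerivAt (fun w => integrand ℏ N e P (w + realDir N t))
      (fderiv ℂ (fun w => integrand ℏ N e P (w + realDir N t)) w)
      (w + (0 : ℂ) • basePointDir N y) := by simpa using hd.hasFDerivAt
    exact hd'.comp_hasDerivAt (0 : ℂ) hline
  set a := paramArray (w + realDir N t) with ha
  have harr : ∀ s : ℂ, paramArray (w + s • basePointDir N y + realDir N t) = a := by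
    intro s
    simp only [ha, paramArray, basePointDir]
    congr 1
    · simp
    · funext n j
      simp
  have h2 : (fun s : ℂ => integrand ℏ N e P (w + s • basePointDir N y + realDir N t)) =
      fun s => P a * (gammaSin ℏ N e a *
        (planeWaveC ℏ N (w + realDir N t).2.2 a * Complex.exp (s * waveSlope ℏ N y a))) := by
    funext s
    rw [integrand, harr, planeWaveC, planeWaveC, ← Complex.exp_add]
    congr 4
    rw [waveSlope, mul_left_comm, ← mul_add]
    congr 1
    rw [Finset.mul_sum, ← Finset.sum_add_distrib]
    refine Finset.sum_congr rfl fun k _ => ?_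
    simp [basePointDir, realDir]
    ring
  have h3 : HasDerivAt (fun s : ℂ => P a * (gammaSin ℏ N e a *
        (planeWaveC ℏ N (w + realDir N t).2.2 a * Complex.exp (s * waveSlope ℏ N y a))))
      (P a * (gammaSin ℏ N e a * (planeWaveC ℏ N (w + realDir N t).2.2 a *
        (waveSlope ℏ N y a)))) 0 := by
    have := (((((hasDerivAt_id (0 : ℂ)).mul_const (waveSlope ℏ N y a)).cexp).const_mul
      (planeWaveC ℏ N (w + realDir N t).2.2 a)).const_mul (gammaSin ℏ N e a)).const_mul (P a)
    simpa using this
  rw [h2] at h1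
  rw [h1.unique h3, integrand, ← ha]
  ring

theorem integrable_integrand (hℏ : 0 < ℏ)
    (hc : InDomain ℏ N 0 (paramArray (basePoint γ c 0))) {P : GZArray → ℂ} (hP : PolyFun P) (x : Fin N → ℝ) :
    Integrable fun t => integrand ℏ N 0 P (basePoint γ c x + realDir N t) :=
  (integrable_and_hasFDerivAt_integral_integrand hℏ hP (isGood_basePoint 0 (x := x) hc)).1

theorem differentiableAt_and_fderiv_lineIntegral (hℏ : 0 < ℏ)
    (hc : InDomain ℏ N 0 (paramArray (basePoint γ c 0))) {P : GZArray → ℂ} (hP : PolyFun P) (x : Fin N → ℝ) :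
    DifferentiableAt ℝ (lineIntegral ℏ γ c P) x ∧ ∀ y, fderiv ℝ (lineIntegral ℏ γ c P) x y =
      lineIntegral ℏ γ c (fun a => P a * waveSlope ℏ N y a) x := by
  have hgood := isGood_basePoint 0 (x := x) hc
  obtain ⟨-, hint, hder⟩ := integrable_and_hasFDerivAt_integral_integrand hℏ hP hgood
  have hbase : HasFDerivAt (basePoint γ c) (basePointDir N) x := by
    rw [funext (basePoint_eq (γ := γ) (c := c))]
    exact (basePointDir N).hasFDerivAt.const_add _
  have h : HasFDerivAt (lineIntegral ℏ γ c P) _ x := (hder.restrictScalars ℝ).comp x hbase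
  refine ⟨h.differentiableAt, fun y => ?_⟩
  rw [h.fderiv]
  simp only [ContinuousLinearMap.comp_apply, ContinuousLinearMap.coe_restrictScalars']
  rw [ContinuousLinearMap.integral_apply hint]
  exact integral_congr_ae (Eventually.of_forall fun t =>
    fderiv_integrand_basePointDir hℏ hP hgood.1 t y)

theorem contDiff_lineIntegral (hℏ : 0 < ℏ)
    (hc : InDomain ℏ N 0 (paramArray (basePoint γ c 0))) {P : GZArray → ℂ} (hP : PolyFun P) :
    ContDiff ℝ ((⊤ : ℕ∞) : WithTop ℕ∞) (lineIntegral ℏ γ c P) := by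
  refine contDiff_infty.2 fun n => ?_
  induction n generalizing P with
  | zero =>
    refine contDiff_zero.2 (Differentiable.continuous (𝕜 := ℝ) fun x =>
      (differentiableAt_and_fderiv_lineIntegral hℏ hc hP x).1)
  | succ n ih =>
    push_cast
    refine contDiff_succ_iff_fderiv_apply.2
      ⟨fun x => (differentiableAt_and_fderiv_lineIntegral hℏ hc hP x).1, by simp, fun y => ?_⟩
    rw [funext fun x => (differentiableAt_and_fderiv_lineIntegral hℏ hc hP x).2 y]
    exact ih (hP.mul (polyFun_waveSlope ℏ y))

theorem momentum_lineIntegral (hℏ : 0 < ℏ)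
    (hc : InDomain ℏ N 0 (paramArray (basePoint γ c 0))) {P : GZArray → ℂ} (hP : PolyFun P) (k : Fin N) (x : Fin N → ℝ) :
    momentum ℏ k (lineIntegral ℏ γ c P) x =
      lineIntegral ℏ γ c (fun a => P a * (rowSum a (k + 1) - rowSum a k)) x := by
  have hℏ' : (ℏ : ℂ) ≠ 0 := by exact_mod_cast hℏ.ne'
  rw [momentum, (differentiableAt_and_fderiv_lineIntegral hℏ hc hP x).2, lineIntegral, lineIntegral,
    ← integral_const_mul]
  congr 1
  funext t
  simp only [integrand, waveSlope]
  rw [Finset.sum_eq_single k (fun b _ hb => by simp [hb]) (by simp)]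
  simp only [Pi.single_eq_same, Complex.ofReal_one, mul_one]
  have hI : -(Complex.I * ℏ) * (Complex.I / ℏ) = 1 := by
    field_simp
    rw [Complex.I_sq]; ring
  linear_combination (P (paramArray (basePoint γ c x + realDir N t)) *
    (rowSum (paramArray (basePoint γ c x + realDir N t)) (k + 1) -
      rowSum (paramArray (basePoint γ c x + realDir N t)) k) *
    (gammaSin ℏ N 0 (paramArray (basePoint γ c x + realDir N t)) *
      planeWaveC ℏ N (basePoint γ c x + realDir N t).2.2
        (paramArray (basePoint γ c x + realDir N t)))) * hI

theorem lineIntegral_const_mul (z : ℂ) (P : GZArray → ℂ) (x : Fin N → ℝ) :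
    lineIntegral ℏ γ c (fun a => z * P a) x = z * lineIntegral ℏ γ c P x := by
  rw [lineIntegral, lineIntegral, ← integral_const_mul]
  congr 1
  funext t
  simp only [integrand]
  ring

theorem lineIntegral_sub (hℏ : 0 < ℏ)
    (hc : InDomain ℏ N 0 (paramArray (basePoint γ c 0))) {P Q : GZArray → ℂ} (hP : PolyFun P) (hQ : PolyFun Q) (x : Fin N → ℝ) :
    lineIntegral ℏ γ c (fun a => P a - Q a) x = lineIntegral ℏ γ c P x - lineIntegral ℏ γ c Q x := by
  rw [lineIntegral, lineIntegral, lineIntegral,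
    ← integral_sub (integrable_integrand hℏ hc hP x) (integrable_integrand hℏ hc hQ x)]
  congr 1
  funext t
  simp only [integrand]
  ring

theorem lineIntegral_sum (hℏ : 0 < ℏ)
    (hc : InDomain ℏ N 0 (paramArray (basePoint γ c 0))) {ι : Type*} {s : Finset ι} {P : ι → GZArray → ℂ}
    (hP : ∀ i ∈ s, PolyFun (P i)) (x : Fin N → ℝ) :
    lineIntegral ℏ γ c (fun a => ∑ i ∈ s, P i a) x = ∑ i ∈ s, lineIntegral ℏ γ c (P i) x := by
  simp only [lineIntegral]
  rw [← integral_finsetSum s fun i hi => integrable_integrand hℏ hc (hP i hi) x]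
  congr 1
  funext t
  simp only [integrand, Finset.sum_mul]

/-! ### The contour shift identity and the Toda recursion -/

/-- Shift of the line of `γ_{n,j}` by `iℏ`. With the factor `∏_k (γ_{n,j} - γ_{n-1,k})` the
integrand continues holomorphically, and at the shifted point this factor becomes
`∏_m (γ_{n,j} - γ_{n+1,m})`. -/
theorem lineIntegral_mul_prod_sub (hℏ : 0 < ℏ)
    (hc : InDomain ℏ N 0 (paramArray (basePoint γ c 0))) {n j : ℕ} (hn : n ∈ Finset.Ico 1 N) (hj : j < n)
    {Q : GZArray → ℂ} (hQ : PolyFun Q) (hQs : ∀ a z, Q (shiftEntry a n j z) = Q a)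
    (hn1 : n - 1 < N) (hnN : n < N) (x : Fin N → ℝ) :
    Complex.exp ((x ⟨n - 1, hn1⟩ - x ⟨n, hnN⟩ : ℝ) : ℂ) *
      lineIntegral ℏ γ c (fun a => Q a * ∏ k ∈ Finset.range (n - 1), (a n j - a (n - 1) k)) x =
    -lineIntegral ℏ γ c (fun a => Q a * ∏ m ∈ Finset.range (n + 1), (a n j - a (n + 1) m)) x := by
  have hℏ' : (ℏ : ℂ) ≠ 0 := by exact_mod_cast hℏ.ne'
  set e := entryOffset n j with he
  set d : Low ℝ N := fun n' j' => if (n' : ℕ) = n ∧ (j' : ℕ) = j then ℏ else 0 with hd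
  have hdl : ∀ n' k, lowEntry d n' k = if n' = n ∧ k = j then ℏ else 0 := by
    intro n' k
    simp only [lowEntry, hd]
    split_ifs <;> first | rfl | omega
  set W := basePoint γ c x with hW
  have harr : ∀ t, paramArray (W + Complex.I • realDir N d + realDir N t) =
      shiftEntry (paramArray (W + realDir N t)) n j (Complex.I * ℏ) := by
    intro t
    funext n' k
    rw [paramArray_add_realDir, paramArray_add_smul_realDir, shiftEntry_apply,
      paramArray_add_realDir, hdl]
    split_ifs <;> push_cast <;> ring
  have hdom : InDomain ℏ N 0 (paramArray W) := hc
  have hI : Complex.I * ℏ / (Complex.I * ℏ) = 1 :=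
    div_self (mul_ne_zero Complex.I_ne_zero hℏ')
  have hg1 : IsGood ℏ N e W := by
    refine isGood_basePoint e fun n' hn' k hk m hm => ?_
    have := hdom n' hn' k hk m hm
    simp only [Pi.zero_apply, Nat.cast_zero, add_zero] at this
    rw [Complex.add_re, Complex.natCast_re]
    have h0 : (0 : ℝ) ≤ e n' k m := Nat.cast_nonneg _
    linarith
  have hg2 : IsGood ℏ N e (W + Complex.I • realDir N d) := by
    refine ⟨fun n' hn' k hk m hm => ?_, fun k => by simp [hW, basePoint, realDir]⟩
    have h1 := harr 0
    rw [map_zero, add_zero, add_zero] at h1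
    have := hdom n' hn' k hk m hm
    simp only [Pi.zero_apply, Nat.cast_zero, add_zero] at this
    rw [h1, scaledDiff_shiftEntry, hI]
    simp only [he, entryOffset]
    split_ifs <;> simp <;> linarith
  have hshift := integral_integrand_shift (d := d) hℏ hQ hg1 hg2
  have hdt : ∀ t, InDomain ℏ N 0 (paramArray (W + realDir N t)) := fun t => hdom.add_realDir t
  have hR : ∀ t, integrand ℏ N e Q (W + realDir N t) = (Complex.I / ℏ) ^ (n - 1) *
      integrand ℏ N 0 (fun a => Q a * ∏ k ∈ Finset.range (n - 1), (a n j - a (n - 1) k))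
        (W + realDir N t) := by
    intro t
    rw [integrand, integrand, he, gammaSin_entryOffset hℏ hn hj (hdt t)]
    ring
  have hx2 : ∀ t, (W + Complex.I • realDir N d + realDir N t).2.2 = fun k => (x k : ℂ) := by
    intro t
    simp [hW, basePoint, realDir]
  have hx1 : ∀ t, (W + realDir N t).2.2 = fun k => (x k : ℂ) := by
    intro t
    simp [hW, basePoint, realDir]
  have hL : ∀ t, integrand ℏ N e Q (W + Complex.I • realDir N d + realDir N t) =
      -((Complex.I / ℏ) ^ (n - 1) * Complex.exp (-((x ⟨n - 1, hn1⟩ : ℂ) - x ⟨n, hnN⟩))) *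
      integrand ℏ N 0 (fun a => Q a * ∏ m ∈ Finset.range (n + 1), (a n j - a (n + 1) m))
        (W + realDir N t) := by
    intro t
    rw [integrand, integrand, harr, hQs, he, gammaSin_shiftEntry hℏ hn hj (hdt t), hx2, hx1,
      planeWaveC_shiftEntry hℏ hn1 hnN hj]
    ring
  simp only [hR, hL] at hshift
  rw [integral_const_mul, integral_const_mul] at hshift
  change _ * lineIntegral ℏ γ c _ x = _ * lineIntegral ℏ γ c _ x at hshift
  have hpow : (Complex.I / (ℏ : ℂ)) ^ (n - 1) ≠ 0 :=
    pow_ne_zero _ (div_ne_zero Complex.I_ne_zero hℏ')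
  have h2 : lineIntegral ℏ γ c
      (fun a => Q a * ∏ k ∈ Finset.range (n - 1), (a n j - a (n - 1) k)) x =
      -(Complex.exp (-((x ⟨n - 1, hn1⟩ : ℂ) - x ⟨n, hnN⟩)) *
      lineIntegral ℏ γ c
        (fun a => Q a * ∏ m ∈ Finset.range (n + 1), (a n j - a (n + 1) m)) x) := by
    refine mul_left_cancel₀ hpow ?_
    rw [← hshift]
    ring
  rw [h2, Complex.exp_neg]
  push_cast
  have := Complex.exp_ne_zero ((x ⟨n - 1, hn1⟩ : ℂ) - x ⟨n, hnN⟩)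
  field_simp

/-- The sines vanish where two entries of a row coincide, so that the zero denominators in the
interpolation formulas do no harm. -/
theorem gammaSin_eq_zero {e : ℕ → ℕ → ℕ → ℕ} {n : ℕ} (hn : n ∈ Finset.Ico 1 N) {a : GZArray}
    (h : ¬ Set.InjOn (a n) (Finset.range n)) : gammaSin ℏ N e a = 0 := by
  obtain ⟨s, p, hsp, hp, heq⟩ : ∃ s p, s < p ∧ p < n ∧ a n s = a n p := by
    simp only [Set.InjOn, not_forall] at h
    obtain ⟨s, hs, p, hp, heq, hne⟩ := h
    simp only [Finset.coe_range, Set.mem_Iio] at hs hp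
    rcases lt_or_gt_of_ne hne with h | h
    · exact ⟨s, p, h, hp, heq⟩
    · exact ⟨p, s, h, hs, heq.symm⟩
  rw [gammaSin_eq_mul]
  refine mul_eq_zero_of_right _ (Finset.prod_eq_zero hn (Finset.prod_eq_zero
    (Finset.mem_range.2 hp) (Finset.prod_eq_zero (Finset.mem_range.2 hsp) ?_)))
  simp [scaledDiff, heq]

theorem lineIntegral_congr {P Q : GZArray → ℂ} (x : Fin N → ℝ)
    (h : ∀ a, P a * gammaSin ℏ N 0 a = Q a * gammaSin ℏ N 0 a) :
    lineIntegral ℏ γ c P x = lineIntegral ℏ γ c Q x := by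
  simp only [lineIntegral, integrand, ← mul_assoc, h]

/-- The relation between three consecutive levels that drives the recursion for `todaA`. -/
theorem exp_mul_lineIntegral_diffProduct (hℏ : 0 < ℏ)
    (hc : InDomain ℏ N 0 (paramArray (basePoint γ c 0))) {n : ℕ} (hn : n ∈ Finset.Ico 1 N)
    (hn1 : n - 1 < N) (hnN : n < N) (lam : ℂ) (x : Fin N → ℝ) :
    Complex.exp ((x ⟨n - 1, hn1⟩ - x ⟨n, hnN⟩ : ℝ) : ℂ) *
      lineIntegral ℏ γ c (fun a => diffProduct ℏ N a *
        ∏ k ∈ Finset.range (n - 1), (lam - a (n - 1) k)) x =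
    lineIntegral ℏ γ c (fun a => diffProduct ℏ N a *
      ((lam - (rowSum a (n + 1) - rowSum a n)) * (∏ j ∈ Finset.range n, (lam - a n j)) -
        ∏ m ∈ Finset.range (n + 1), (lam - a (n + 1) m))) x := by
  choose! R hRp hRs hR using fun j (hj : j < n) => exists_diffProduct_eq_mul ℏ hn hj
  set Q : ℕ → GZArray → ℂ := fun j a =>
    R j a * ∏ s ∈ (Finset.range n).erase j, (lam - a n s) with hQ
  have hQp : ∀ j ∈ Finset.range n, PolyFun (Q j) := fun j hj =>
    (hRp j (Finset.mem_range.1 hj)).mul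
      (PolyFun.prod fun s _ => (PolyFun.const lam).sub (PolyFun.coord n s))
  have hQs : ∀ j ∈ Finset.range n, ∀ a z, Q j (shiftEntry a n j z) = Q j a := by
    intro j hj a z
    simp only [hQ, hRs j (Finset.mem_range.1 hj)]
    congr 1
    refine Finset.prod_congr rfl fun s hs => ?_
    simp [shiftEntry_apply, Finset.ne_of_mem_erase hs]
  have hQdiv : ∀ a : GZArray, Set.InjOn (a n) (Finset.range n) → ∀ j ∈ Finset.range n,
      Q j a = diffProduct ℏ N a * ((∏ i ∈ (Finset.range n).erase j, (lam - a n i)) /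
        ∏ i ∈ (Finset.range n).erase j, (a n j - a n i)) := by
    intro a ha j hj
    have hne : ∏ i ∈ (Finset.range n).erase j, (a n j - a n i) ≠ 0 := by
      refine Finset.prod_ne_zero_iff.2 fun i hi => sub_ne_zero.2 fun h => ?_
      exact Finset.ne_of_mem_erase hi (ha hj (Finset.mem_of_mem_erase hi) h).symm
    rw [hR j (Finset.mem_range.1 hj) a]
    simp only [hQ]
    field_simp
  have hcoord : ∀ (j l : ℕ) (s : Finset ℕ), PolyFun fun a => ∏ m ∈ s, (a n j - a l m) :=
    fun j l s => PolyFun.prod fun m _ => (PolyFun.coord n j).sub (PolyFun.coord l m)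
  have e1 : lineIntegral ℏ γ c (fun a => diffProduct ℏ N a *
        ∏ k ∈ Finset.range (n - 1), (lam - a (n - 1) k)) x =
      ∑ j ∈ Finset.range n, lineIntegral ℏ γ c
        (fun a => Q j a * ∏ k ∈ Finset.range (n - 1), (a n j - a (n - 1) k)) x := by
    rw [← lineIntegral_sum hℏ hc fun j hj => (hQp j hj).mul (hcoord j (n - 1) _)]
    refine lineIntegral_congr x fun a => ?_
    by_cases ha : Set.InjOn (a n) (Finset.range n)
    · congr 1
      rw [← sum_prod_sub_mul_prod_div_prod_pred (Finset.mem_Ico.1 hn).1 ha (a (n - 1)) lam,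
        Finset.mul_sum]
      refine Finset.sum_congr rfl fun j hj => ?_
      rw [hQdiv a ha j hj]
      ring
    · rw [gammaSin_eq_zero hn ha, mul_zero, mul_zero]
  have e2 : lineIntegral ℏ γ c (fun a => diffProduct ℏ N a *
      ((lam - (rowSum a (n + 1) - rowSum a n)) * (∏ j ∈ Finset.range n, (lam - a n j)) -
        ∏ m ∈ Finset.range (n + 1), (lam - a (n + 1) m))) x =
      -∑ j ∈ Finset.range n, lineIntegral ℏ γ c
        (fun a => Q j a * ∏ m ∈ Finset.range (n + 1), (a n j - a (n + 1) m)) x := by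
    rw [← lineIntegral_sum hℏ hc fun j hj => (hQp j hj).mul (hcoord j (n + 1) _),
      ← neg_one_mul, ← lineIntegral_const_mul]
    refine lineIntegral_congr x fun a => ?_
    by_cases ha : Set.InjOn (a n) (Finset.range n)
    · congr 1
      have h := sum_prod_sub_mul_prod_div_prod ha (a (n + 1)) lam
      have h' : ∑ j ∈ Finset.range n, Q j a * ∏ m ∈ Finset.range (n + 1), (a n j - a (n + 1) m) =
          diffProduct ℏ N a * ∑ j ∈ Finset.range n, (∏ m ∈ Finset.range (n + 1), (a n j - a (n + 1) m)) *
            ((∏ i ∈ (Finset.range n).erase j, (lam - a n i)) /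
              ∏ i ∈ (Finset.range n).erase j, (a n j - a n i)) := by
        rw [Finset.mul_sum]
        refine Finset.sum_congr rfl fun j hj => ?_
        rw [hQdiv a ha j hj]
        ring
      rw [h', h]
      simp only [rowSum]
      ring
    · rw [gammaSin_eq_zero hn ha, mul_zero, mul_zero]
  rw [e1, e2, Finset.mul_sum, ← Finset.sum_neg_distrib]
  exact Finset.sum_congr rfl fun j hj =>
    lineIntegral_mul_prod_sub hℏ hc hn (Finset.mem_range.1 hj) (hQp j hj) (hQs j hj) hn1 hnN x

/-- On the integrals, `A_n(λ)` multiplies the integrand by `∏_j (λ - γ_{n,j})`. -/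
theorem todaA_lineIntegral (hℏ : 0 < ℏ)
    (hc : InDomain ℏ N 0 (paramArray (basePoint γ c 0))) (lam : ℂ) (n : ℕ) (hn : n ≤ N) (x : Fin N → ℝ) :
    todaA ℏ N lam (lineIntegral ℏ γ c (diffProduct ℏ N)) n hn x =
      lineIntegral ℏ γ c (fun a => diffProduct ℏ N a * ∏ j ∈ Finset.range n, (lam - a n j)) x := by
  have hD := polyFun_diffProduct ℏ N
  have hpoly : ∀ n, PolyFun fun a => diffProduct ℏ N a * ∏ j ∈ Finset.range n, (lam - a n j) :=
    fun n => hD.mul (PolyFun.prod fun j _ => (PolyFun.const lam).sub (PolyFun.coord n j))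
  induction n using Nat.strong_induction_on generalizing x with
  | _ n ih =>
    match n, hn, ih with
    | 0, _, _ => simp [todaA]
    | 1, h, _ =>
      rw [todaA]
      beta_reduce
      rw [momentum_lineIntegral hℏ hc hD, ← lineIntegral_const_mul,
        ← lineIntegral_sub hℏ hc ((PolyFun.const lam).mul hD)
          (hD.mul ((PolyFun.rowSum _).sub (PolyFun.rowSum _)))]
      congr 1
      funext a
      simp [rowSum]
      ring
    | n + 2, h, ih =>
      have h1 : todaA ℏ N lam (lineIntegral ℏ γ c (diffProduct ℏ N)) (n + 1) (by omega) =
          lineIntegral ℏ γ c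
            (fun a => diffProduct ℏ N a * ∏ j ∈ Finset.range (n + 1), (lam - a (n + 1) j)) :=
        funext fun y => ih (n + 1) (by omega) _ y
      have h0 := ih n (by omega) (by omega) x
      rw [todaA]
      beta_reduce
      rw [h1, h0, momentum_lineIntegral hℏ hc (hpoly (n + 1)), ← lineIntegral_const_mul]
      have key := exp_mul_lineIntegral_diffProduct hℏ hc (n := n + 1)
        (Finset.mem_Ico.2 ⟨by omega, by omega⟩) (by omega) (by omega) lam x
      simp only [Nat.add_sub_cancel] at key
      have hs := fun n => PolyFun.rowSum n
      rw [key, ← lineIntegral_sub hℏ hc ((PolyFun.const lam).mul (hpoly (n + 1)))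
          ((hpoly (n + 1)).mul ((hs _).sub (hs _))),
        ← lineIntegral_sub hℏ hc (((PolyFun.const lam).mul (hpoly (n + 1))).sub
          ((hpoly (n + 1)).mul ((hs _).sub (hs _)))) (hD.mul (PolyFun.sub
            (((PolyFun.const lam).sub ((hs _).sub (hs _))).mul (PolyFun.prod fun j _ =>
              (PolyFun.const lam).sub (PolyFun.coord _ j))) (PolyFun.prod fun j _ =>
              (PolyFun.const lam).sub (PolyFun.coord _ j))))]
      congr 1
      funext a
      ring

end lineIntegral

/-! ### The Mellin–Barnes integrand -/

theorem prod_erase_eq_prod_pairs {M : Type*} [CommMonoid M] (f : ℕ → ℕ → M) (n : ℕ) :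
    ∏ s ∈ Finset.range n, ∏ p ∈ (Finset.range n).erase s, f s p =
      ∏ p ∈ Finset.range n, ∏ s ∈ Finset.range p, f s p * f p s := by
  induction n with
  | zero => simp
  | succ n ih =>
    have h : ∀ s ∈ Finset.range n, ∏ p ∈ (Finset.range (n + 1)).erase s, f s p =
        f s n * ∏ p ∈ (Finset.range n).erase s, f s p := by
      intro s hs
      have hne : n ≠ s := (Finset.mem_range.1 hs).ne'
      rw [Finset.range_add_one, Finset.erase_insert_of_ne hne, Finset.prod_insert (by simp)]
    rw [Finset.prod_range_succ, Finset.prod_range_succ, Finset.prod_congr rfl h,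
      Finset.prod_mul_distrib, ih, Finset.range_add_one,
      Finset.erase_insert Finset.notMem_range_self, Finset.prod_mul_distrib, mul_comm (∏ s ∈ _, f s n),
      mul_assoc]

theorem scaledDiff_swap (ℏ : ℝ) (a : GZArray) (n k l m : ℕ) :
    scaledDiff ℏ a l m n k = -scaledDiff ℏ a n k l m := by
  simp only [scaledDiff]; ring

theorem mbIntegrand_eq (ℏ : ℝ) (N : ℕ) (x : Fin N → ℝ) (a : GZArray) :
    mbIntegrand ℏ N x a = diffProduct ℏ N a * (gammaSin ℏ N 0 a * planeWave ℏ N x a) := by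
  rw [mbIntegrand, gammaSin, diffProduct, ← mul_assoc, ← Finset.prod_mul_distrib]
  congr 1
  refine Finset.prod_congr rfl fun n _ => ?_
  have h : (∏ s ∈ Finset.range n, ∏ p ∈ (Finset.range n).erase s,
      Complex.Gamma (scaledDiff ℏ a n s n p))⁻¹ =
      (∏ p ∈ Finset.range n, ∏ s ∈ Finset.range p, (-scaledDiff ℏ a n s n p / Real.pi)) *
      ∏ p ∈ Finset.range n, ∏ s ∈ Finset.range p,
        Complex.sin (Real.pi * scaledDiff ℏ a n s n p) := by
    rw [prod_erase_eq_prod_pairs, ← Finset.prod_inv_distrib, ← Finset.prod_mul_distrib]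
    refine Finset.prod_congr rfl fun p _ => ?_
    rw [← Finset.prod_inv_distrib, ← Finset.prod_mul_distrib]
    refine Finset.prod_congr rfl fun s _ => ?_
    rw [scaledDiff_swap ℏ a n s n p, ← inv_Gamma_mul_Gamma_neg, one_div]
  rw [div_eq_mul_inv, h]
  simp only [Pi.zero_apply, Nat.cast_zero, add_zero]
  ring

theorem mbIntegrand_lineArray (ℏ : ℝ) {N : ℕ} (γ : Fin N → ℂ) (c t : Low ℝ N) (x : Fin N → ℝ) :
    mbIntegrand ℏ N x (lineArray N γ c t) =
      integrand ℏ N 0 (diffProduct ℏ N) (basePoint γ c x + realDir N t) := by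
  rw [mbIntegrand_eq, integrand, paramArray_basePoint_add, ← planeWaveC_ofReal]
  congr 3
  simp [basePoint, realDir]

/-! ### The wave function -/

theorem inDomain_of_admissibleHeights {ℏ : ℝ} (hℏ : 0 < ℏ) {N : ℕ} {γ : Fin N → ℂ} {c : Low ℝ N}
    (h : AdmissibleHeights N γ c) (x : Fin N → ℝ) :
    InDomain ℏ N 0 (paramArray (basePoint γ c x)) := by
  intro n hn k hk m hm
  have h0 := h 0 n hn k hk m hm
  rw [← paramArray_basePoint_add γ c x, map_zero, add_zero] at h0
  simp only [Pi.zero_apply, Nat.cast_zero, add_zero, scaledDiff_re]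
  exact div_pos (by linarith) hℏ

theorem lineIntegral_eq_of_admissibleHeights {ℏ : ℝ} (hℏ : 0 < ℏ) {N : ℕ} {γ : Fin N → ℂ}
    {c c' : Low ℝ N} (h : AdmissibleHeights N γ c) (h' : AdmissibleHeights N γ c')
    {P : GZArray → ℂ} (hP : PolyFun P) (x : Fin N → ℝ) :
    lineIntegral ℏ γ c' P x = lineIntegral ℏ γ c P x := by
  have hb : basePoint γ c' x = basePoint γ c x + Complex.I • realDir N (c' - c) := by
    refine Prod.ext ?_ (by simp [basePoint, realDir])
    funext n j
    simp [basePoint, realDir]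
    ring
  have h1 := isGood_basePoint 0 (inDomain_of_admissibleHeights hℏ h x)
  have h2 := isGood_basePoint 0 (inDomain_of_admissibleHeights hℏ h' x)
  rw [hb] at h2
  rw [lineIntegral, lineIntegral, hb]
  exact integral_integrand_shift hℏ hP h1 h2

/-- The heights `b + d (N - n)` of the lines of level `n`. -/
def linearHeights (N : ℕ) (b d : ℝ) : Low ℝ N := fun n _ => b + d * ((N : ℝ) - (n : ℕ))

theorem lineArray_linearHeights_im {N : ℕ} (γ : Fin N → ℂ) (b d : ℝ) (t : Low ℝ N) {n j : ℕ}
    (hn : n < N) (hj : j < n) :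
    (lineArray N γ (linearHeights N b d) t n j).im = b + d * ((N : ℝ) - n) := by
  simp [lineArray, fullArray, hn, hj, linearHeights]

theorem admissibleHeights_linearHeights {N : ℕ} {γ : Fin N → ℂ} {b d : ℝ} (hd : 0 < d)
    (hb : ∀ j, (γ j).im ≤ b) : AdmissibleHeights N γ (linearHeights N b d) := by
  intro t n hn j hj m hm
  have hn' := (Finset.mem_Ico.1 hn).2
  rw [lineArray_linearHeights_im γ b d t hn' (Finset.mem_range.1 hj)]
  have hnN : (n : ℝ) + 1 ≤ N := by exact_mod_cast hn'
  rcases (Nat.succ_le_of_lt hn').lt_or_eq with h | h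
  · rw [lineArray_linearHeights_im γ b d t h (Finset.mem_range.1 hm)]
    push_cast
    nlinarith
  · have hm' : m < N := by have := Finset.mem_range.1 hm; omega
    have : lineArray N γ (linearHeights N b d) t (n + 1) m = γ ⟨m, hm'⟩ := by
      simp [lineArray, fullArray, show n + 1 = N from h, hm']
    rw [this]
    have := hb ⟨m, hm'⟩
    nlinarith

/-- The wave function, as the Mellin–Barnes integral over lines above the label; by
`waveFunction_eq` any other admissible lines give the same value. -/
def waveFunction (ℏ : ℝ) (N : ℕ) (γ : Fin N → ℂ) (x : Fin N → ℝ) : ℂ :=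
  lineIntegral ℏ γ (linearHeights N ‖γ‖ 1) (diffProduct ℏ N) x

theorem im_le_norm {N : ℕ} (γ : Fin N → ℂ) (j : Fin N) : (γ j).im ≤ ‖γ‖ :=
  ((le_abs_self _).trans (Complex.abs_im_le_norm _)).trans (norm_le_pi_norm γ j)

theorem waveFunction_eq {ℏ : ℝ} (hℏ : 0 < ℏ) {N : ℕ} {γ : Fin N → ℂ} {c : Low ℝ N}
    (hc : AdmissibleHeights N γ c) (x : Fin N → ℝ) :
    waveFunction ℏ N γ x = lineIntegral ℏ γ c (diffProduct ℏ N) x :=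
  lineIntegral_eq_of_admissibleHeights hℏ hc
    (admissibleHeights_linearHeights one_pos (im_le_norm γ)) (polyFun_diffProduct ℏ N) x

/-- The lines chosen in `waveFunction` depend on the label, but near a given label they can be
replaced by fixed ones. -/
theorem differentiable_waveFunction {ℏ : ℝ} (hℏ : 0 < ℏ) {N : ℕ} (x : Fin N → ℝ) :
    Differentiable ℂ fun γ => waveFunction ℏ N γ x := by
  intro γ₀
  set c := linearHeights N (‖γ₀‖ + 1) 1 with hc
  have hev : (fun γ => waveFunction ℏ N γ x) =ᶠ[𝓝 γ₀]
      fun γ => lineIntegral ℏ γ c (diffProduct ℏ N) x := by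
    filter_upwards [continuous_norm.continuousAt.eventually
      (gt_mem_nhds (lt_add_one ‖γ₀‖))] with γ hγ
    exact waveFunction_eq hℏ (admissibleHeights_linearHeights one_pos
      fun j => (im_le_norm γ j).trans hγ.le) x
  refine DifferentiableAt.congr_of_eventuallyEq ?_ hev
  have hadm : AdmissibleHeights N γ₀ c := admissibleHeights_linearHeights one_pos
    fun j => (im_le_norm γ₀ j).trans (by linarith)
  have h := (integrable_and_hasFDerivAt_integral_integrand hℏ (polyFun_diffProduct ℏ N)
    (isGood_basePoint 0 (inDomain_of_admissibleHeights hℏ hadm x))).2.2.differentiableAt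
  refine DifferentiableAt.comp (f := fun γ => basePoint γ c x) γ₀ h ?_
  unfold basePoint
  fun_prop

theorem waveFunction_todaA {ℏ : ℝ} (hℏ : 0 < ℏ) {N : ℕ} (γ : Fin N → ℂ) (lam : ℂ)
    (x : Fin N → ℝ) :
    todaA ℏ N lam (waveFunction ℏ N γ) N le_rfl x = (∏ j, (lam - γ j)) * waveFunction ℏ N γ x := by
  have hc := inDomain_of_admissibleHeights hℏ
    (admissibleHeights_linearHeights one_pos (im_le_norm γ)) 0
  change todaA ℏ N lam (lineIntegral ℏ γ (linearHeights N ‖γ‖ 1) (diffProduct ℏ N)) N le_rfl x = _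
  rw [todaA_lineIntegral hℏ hc, waveFunction, ← lineIntegral_const_mul, lineIntegral, lineIntegral]
  congr 1
  funext t
  have htop : ∏ j ∈ Finset.range N,
      (lam - paramArray (basePoint γ (linearHeights N ‖γ‖ 1) x + realDir N t) N j) =
      ∏ j, (lam - γ j) := by
    rw [Finset.prod_range]
    refine Finset.prod_congr rfl fun j _ => ?_
    rw [paramArray_basePoint_add]
    simp [lineArray, fullArray]
  simp only [integrand, htop]
  ring

/-! ### The integral over real arrays and the pairing -/

theorem norm_Gamma_sq_of_re_eq_zero {w : ℂ} (hw : w.re = 0) :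
    ((‖Complex.Gamma w‖ ^ 2 : ℝ) : ℂ) = Complex.Gamma w * Complex.Gamma (-w) := by
  have h : -w = (starRingEnd ℂ) w := by
    apply Complex.ext <;> simp [hw]
  rw [h, Complex.Gamma_conj, Complex.mul_conj, Complex.normSq_eq_norm_sq]

section real
variable {ℏ : ℝ} {N : ℕ} (γ : Fin N → ℝ) (t : Low ℝ N)

theorem realArray_im (n j : ℕ) : (realArray N γ t n j).im = 0 := by
  unfold realArray fullArray
  split_ifs <;> simp

theorem lineArray_eq_realArray_add {n j : ℕ} (hn : n ≤ N) (hj : j < n) :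
    lineArray N (fun j => (γ j : ℂ)) (linearHeights N 0 (ℏ / 2)) t n j =
      realArray N γ t n j + ℏ / 2 * ((N : ℂ) - n) * Complex.I := by
  rcases hn.lt_or_eq with h | rfl
  · simp [lineArray, realArray, fullArray, linearHeights, h, hj]
  · simp [lineArray, realArray, fullArray, hj]

/-- With the heights `ℏ (N - n) / 2`, the arguments of the Gamma factors between consecutive levels
increase by `1/2`, and the plane wave acquires the factor `e^{-x·ρ}`. -/
theorem mbIntegrand_lineArray_eq_realIntegrand (hℏ : 0 < ℏ) (x : Fin N → ℝ) :
    mbIntegrand ℏ N x (lineArray N (fun j => (γ j : ℂ)) (linearHeights N 0 (ℏ / 2)) t) =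
      rhoFactor N x * realIntegrand ℏ N x (realArray N γ t) := by
  have hℏ' : (ℏ : ℂ) ≠ 0 := by exact_mod_cast hℏ.ne'
  set a := lineArray N (fun j => (γ j : ℂ)) (linearHeights N 0 (ℏ / 2)) t with ha
  set b := realArray N γ t with hb
  have hab : ∀ n j, n ≤ N → j < n → a n j = b n j + ℏ / 2 * ((N : ℂ) - n) * Complex.I :=
    fun n j hn hj => lineArray_eq_realArray_add γ t hn hj
  have hrow : ∀ n ≤ N, rowSum a n = rowSum b n + n * (ℏ / 2 * ((N : ℂ) - n) * Complex.I) := by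
    intro n hn
    rw [rowSum, rowSum, Finset.sum_congr rfl fun j hj => hab n j hn (Finset.mem_range.1 hj),
      Finset.sum_add_distrib, Finset.sum_const, Finset.card_range, nsmul_eq_mul]
  have hwave : planeWave ℏ N x a = rhoFactor N x * planeWave ℏ N x b := by
    rw [planeWave, planeWave, rhoFactor, ← Complex.exp_add]
    congr 1
    rw [Finset.mul_sum, Finset.mul_sum, ← Finset.sum_neg_distrib, ← Finset.sum_add_distrib]
    refine Finset.sum_congr rfl fun k _ => ?_
    rw [hrow _ k.2, hrow _ k.2.le, rho]
    push_cast
    field_simp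
    ring_nf
    rw [Complex.I_sq]
    ring
  rw [mbIntegrand, realIntegrand, hwave, mul_left_comm]
  congr 2
  refine Finset.prod_congr rfl fun n hn => ?_
  have hn' := (Finset.mem_Ico.1 hn).2
  congr 1
  · refine Finset.prod_congr rfl fun k hk => Finset.prod_congr rfl fun m hm => ?_
    have : scaledDiff ℏ a n k (n + 1) m = scaledDiff ℏ b n k (n + 1) m + 1 / 2 := by
      rw [scaledDiff, scaledDiff, hab n k hn'.le (Finset.mem_range.1 hk),
        hab (n + 1) m hn' (Finset.mem_range.1 hm)]
      have := Complex.I_ne_zero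
      push_cast
      field_simp
      ring
    rw [this]
  · rw [prod_erase_eq_prod_pairs]
    refine Finset.prod_congr rfl fun p hp => Finset.prod_congr rfl fun s hs => ?_
    have hp' := Finset.mem_range.1 hp
    have hs' := Finset.mem_range.1 hs
    have : scaledDiff ℏ a n s n p = scaledDiff ℏ b n s n p := by
      rw [scaledDiff, scaledDiff, hab n s hn'.le (by omega), hab n p hn'.le hp']
      ring
    rw [norm_Gamma_sq_of_re_eq_zero (by rw [scaledDiff_re, hb, realArray_im, realArray_im]; simp),
      scaledDiff_swap ℏ a n s n p, this]

/-- The contribution of one pair of entries to the density of the pairing, from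
`|Γ(iy)|² = π / (y sinh(πy))`; for `u = v` both sides are zero. -/
theorem exp_pair_eq (hℏ : 0 < ℏ) (u v : ℝ) :
    ((u : ℂ) - v) * (Complex.exp (2 * Real.pi * v / ℏ) - Complex.exp (2 * Real.pi * u / ℏ)) *
        Complex.exp (-((Real.pi : ℂ) / ℏ) * (u + v)) =
      (-(2 * Real.pi * ℏ : ℝ) : ℂ) /
        ((‖Complex.Gamma (((u : ℂ) - v) / (Complex.I * ℏ))‖ ^ 2 : ℝ) : ℂ) := by
  have hℏ' : (ℏ : ℂ) ≠ 0 := by exact_mod_cast hℏ.ne'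
  have hpi : (Real.pi : ℂ) ≠ 0 := by exact_mod_cast Real.pi_ne_zero
  have hI := Complex.I_ne_zero
  set w : ℂ := ((u : ℂ) - v) / (Complex.I * ℏ) with hw
  have hwI : w * Complex.I = ((u : ℂ) - v) / ℏ := by rw [hw]; field_simp
  have hwre : w.re = 0 := by
    have : w = ((-((u - v) / ℏ) : ℝ) : ℂ) * Complex.I := by
      rw [hw]; push_cast; field_simp; rw [Complex.I_sq]; ring
    rw [this]; simp
  rw [norm_Gamma_sq_of_re_eq_zero hwre,
    div_eq_mul_one_div _ (Complex.Gamma w * Complex.Gamma (-w)), inv_Gamma_mul_Gamma_neg, Complex.sin,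
    mul_assoc, sub_mul (Complex.exp _), ← Complex.exp_add, ← Complex.exp_add]
  have e1 : 2 * (Real.pi : ℂ) * v / ℏ + -((Real.pi : ℂ) / ℏ) * (u + v) =
      -(Real.pi * w) * Complex.I := by
    rw [show -(Real.pi * w) * Complex.I = -(Real.pi * (w * Complex.I)) by ring, hwI]; ring
  have e2 : 2 * (Real.pi : ℂ) * u / ℏ + -((Real.pi : ℂ) / ℏ) * (u + v) =
      (Real.pi * w) * Complex.I := by
    rw [mul_assoc (Real.pi : ℂ) w, hwI]; ring
  rw [e1, e2]
  have e3 : (u : ℂ) - v = ℏ * (w * Complex.I) := by rw [hwI]; field_simp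
  rw [e3]
  push_cast
  field_simp

theorem sum_pairs_add (v : ℕ → ℂ) (n : ℕ) :
    ∑ p ∈ Finset.range n, ∑ s ∈ Finset.range p, (v s + v p) =
      ((n : ℂ) - 1) * ∑ j ∈ Finset.range n, v j := by
  induction n with
  | zero => simp
  | succ n ih =>
    rw [Finset.sum_range_succ, ih, Finset.sum_add_distrib, Finset.sum_range_succ v, Finset.sum_const,
      Finset.card_range, nsmul_eq_mul]
    push_cast
    ring

theorem sum_choose_two (N : ℕ) : ∑ n ∈ Finset.Ico 1 N, n.choose 2 = N.choose 3 := by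
  induction N with
  | zero => rfl
  | succ N ih =>
    rcases Nat.eq_zero_or_pos N with rfl | h
    · rfl
    · rw [Finset.sum_Ico_succ_top h, ih, Nat.choose_succ_succ' N 2, add_comm]

theorem prod_pairs_const (q : ℂ) (n : ℕ) :
    ∏ p ∈ Finset.range n, ∏ _s ∈ Finset.range p, q = q ^ n.choose 2 := by
  simp only [Finset.prod_const, Finset.card_range]
  rw [Finset.prod_pow_eq_pow_sum, Finset.sum_range_id, Nat.choose_two_right]

theorem pairingIntegrand_eq (hℏ : 0 < ℏ) (x : Fin N → ℝ) :
    pairingIntegrand ℏ N γ dualWhittakerVec (cartanTorus ℏ N x (whittakerVec ℏ N)) t =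
      (-(2 * Real.pi * ℏ : ℝ) : ℂ) ^ (N.choose 3) * realIntegrand ℏ N x (realArray N γ t) := by
  have hℏ' : (ℏ : ℂ) ≠ 0 := by exact_mod_cast hℏ.ne'
  have hI := Complex.I_ne_zero
  set b := realArray N γ t with hb
  change muZero ℏ N b * (starRingEnd ℂ) (dualWhittakerVec b) *
    cartanTorus ℏ N x (whittakerVec ℏ N) b = _
  have hwave : Complex.exp (-∑ k : Fin N, (x k : ℂ) * cartanSymbol ℏ (k + 1) b) =
      planeWave ℏ N x b := by
    rw [planeWave, Finset.mul_sum, ← Finset.sum_neg_distrib]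
    congr 1
    refine Finset.sum_congr rfl fun k _ => ?_
    rw [cartanSymbol, Nat.add_sub_cancel]
    field_simp
    rw [Complex.I_sq]
    ring
  have hmu : muZero ℏ N b = ∏ n ∈ Finset.Ico 1 N, ∏ p ∈ Finset.range n, ∏ s ∈ Finset.range p,
      (b n s - b n p) *
      (Complex.exp (2 * Real.pi * b n p / ℏ) - Complex.exp (2 * Real.pi * b n s / ℏ)) := by
    rw [muZero]
    refine Finset.prod_subset (fun n hn => ?_) fun n hn hn' => ?_
    · rw [Finset.mem_Ico] at *; omega
    · have : n = 1 := by rw [Finset.mem_Ico] at *; omega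
      simp [this]
  have hreal : ∀ n j, b n j = ((b n j).re : ℂ) := fun n j =>
    Complex.ext (by simp) (by simpa using realArray_im γ t n j)
  have hlevel : ∀ n, (∏ p ∈ Finset.range n, ∏ s ∈ Finset.range p, (b n s - b n p) *
      (Complex.exp (2 * Real.pi * b n p / ℏ) - Complex.exp (2 * Real.pi * b n s / ℏ))) *
      Complex.exp (-((Real.pi : ℂ) / ℏ) * (((n : ℂ) - 1) * rowSum b n)) =
      (-(2 * Real.pi * ℏ : ℝ) : ℂ) ^ (n.choose 2) /
        ∏ p ∈ Finset.range n, ∏ s ∈ Finset.range p,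
          ((‖Complex.Gamma (scaledDiff ℏ b n s n p)‖ ^ 2 : ℝ) : ℂ) := by
    intro n
    rw [rowSum, ← sum_pairs_add, Finset.mul_sum, Complex.exp_sum, ← prod_pairs_const,
      ← Finset.prod_mul_distrib, ← Finset.prod_div_distrib]
    refine Finset.prod_congr rfl fun p _ => ?_
    rw [Finset.mul_sum, Complex.exp_sum, ← Finset.prod_mul_distrib, ← Finset.prod_div_distrib]
    refine Finset.prod_congr rfl fun s _ => ?_
    rw [scaledDiff, hreal n s, hreal n p]
    exact exp_pair_eq hℏ _ _
  have hmain : muZero ℏ N b *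
      Complex.exp (-((Real.pi : ℂ) / ℏ) * ∑ n ∈ Finset.Ico 1 N, ((n : ℂ) - 1) * rowSum b n) =
      (-(2 * Real.pi * ℏ : ℝ) : ℂ) ^ (N.choose 3) *
        ∏ n ∈ Finset.Ico 1 N, (∏ p ∈ Finset.range n, ∏ s ∈ Finset.range p,
          ((‖Complex.Gamma (scaledDiff ℏ b n s n p)‖ ^ 2 : ℝ) : ℂ))⁻¹ := by
    rw [hmu, Finset.mul_sum, Complex.exp_sum, ← Finset.prod_mul_distrib,
      Finset.prod_congr rfl fun n _ => hlevel n, Finset.prod_congr rfl fun n _ => div_eq_mul_inv _ _,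
      Finset.prod_mul_distrib, Finset.prod_pow_eq_pow_sum, sum_choose_two]
  rw [cartanTorus, whittakerVec, realIntegrand, hwave, dualWhittakerVec, map_one, mul_one,
    Finset.prod_congr rfl fun n _ => div_eq_mul_inv _ _, Finset.prod_mul_distrib]
  have hs : ∏ n ∈ Finset.Ico 1 N, sFactor ℏ n b = ∏ n ∈ Finset.Ico 1 N,
      ∏ k ∈ Finset.range n, ∏ m ∈ Finset.range (n + 1),
        (ℏ : ℂ) ^ (scaledDiff ℏ b n k (n + 1) m + 1 / 2) *
          Complex.Gamma (scaledDiff ℏ b n k (n + 1) m + 1 / 2) := rfl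
  rw [← hs]
  linear_combination (planeWave ℏ N x b * ∏ n ∈ Finset.Ico 1 N, sFactor ℏ n b) * hmain

end real

/-! ### The Whittaker vectors -/

theorem Regular.injOn {ℏ : ℝ} {N : ℕ} {a : GZArray} (ha : Regular ℏ N a) {n : ℕ}
    (hn : n ∈ Finset.Ico 1 N) : Set.InjOn (a n) (Finset.range n) := by
  intro s hs p hp h
  by_contra hne
  exact ha.1 n hn s hs p hp hne h

theorem one_div_I_mul {ℏ : ℝ} (hℏ : 0 < ℏ) : 1 / (Complex.I * ℏ) = -(Complex.I / ℏ) := by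
  have hℏ' : (ℏ : ℂ) ≠ 0 := by exact_mod_cast hℏ.ne'
  have hI := Complex.I_ne_zero
  field_simp
  rw [Complex.I_sq, neg_neg]

theorem opLower_dualWhittakerVec {ℏ : ℝ} (hℏ : 0 < ℏ) {N n : ℕ} (hn : n ∈ Finset.Ico 1 N)
    {a : GZArray} (ha : Regular ℏ N a) :
    opLower ℏ n dualWhittakerVec a = -(Complex.I / ℏ) * dualWhittakerVec a := by
  have h := sum_prod_sub_div_prod (Finset.mem_Ico.1 hn).1 (ha.injOn hn)
    (fun r => a (n - 1) r - Complex.I * ℏ / 2)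
  simp only [opLower, dualWhittakerVec, mul_one]
  rw [← one_div_I_mul hℏ, ← mul_one (1 / (Complex.I * (ℏ : ℂ))), mul_assoc, one_mul]
  refine congrArg _ ((Finset.sum_congr rfl fun j _ => ?_).trans h)
  exact congrArg (· / _) (Finset.prod_congr rfl fun r _ => by ring)

/-- The functional equation of the Gamma function for the factors that contain the entry
`(n, j)`. -/
theorem prod_sFactor_shiftEntry {ℏ : ℝ} (hℏ : 0 < ℏ) {N n j : ℕ} (hn : n ∈ Finset.Ico 1 N)
    (hj : j < n) {a : GZArray} (ha : Regular ℏ N a) :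
    ∏ n' ∈ Finset.Ico 1 N, sFactor ℏ n' (shiftEntry a n j (-(Complex.I * ℏ))) =
      (∏ m ∈ Finset.range (n + 1), (-Complex.I * (a n j - a (n + 1) m - Complex.I * ℏ / 2))⁻¹) *
      (∏ k ∈ Finset.range (n - 1), (Complex.I * (a n j - a (n - 1) k - Complex.I * ℏ / 2))) *
      ∏ n' ∈ Finset.Ico 1 N, sFactor ℏ n' a := by
  have hℏ' : (ℏ : ℂ) ≠ 0 := by exact_mod_cast hℏ.ne'
  have hI0 := Complex.I_ne_zero
  have hI : -(Complex.I * (ℏ : ℂ)) / (Complex.I * ℏ) = -1 := by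
    rw [neg_div, div_self (mul_ne_zero hI0 hℏ')]
  rw [← prod_level_entry hn hj, ← Finset.prod_mul_distrib]
  refine Finset.prod_congr rfl fun n' hn' => ?_
  rw [sFactor, sFactor, ← Finset.prod_mul_distrib]
  refine Finset.prod_congr rfl fun k hk => ?_
  rw [← Finset.prod_mul_distrib]
  refine Finset.prod_congr rfl fun m hm => ?_
  have hz := ha.2 n' hn' k hk m hm
  rw [scaledDiff_shiftEntry, hI]
  set z := scaledDiff ℏ a n' k (n' + 1) m with hzdef
  by_cases h : n' = n ∧ k = j
  · obtain ⟨rfl, rfl⟩ := h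
    have hne : n' + 1 ≠ n' := by omega
    simp only [hne, false_and, if_false, and_self, if_true, sub_zero]
    have h1 : z - 1 / 2 ≠ 0 := by
      have := hz 1
      intro h0
      exact this (by push_cast; linear_combination h0)
    have e1 : -Complex.I * (a n' k - a (n' + 1) m - Complex.I * ℏ / 2) = ℏ * (z - 1 / 2) := by
      rw [hzdef, scaledDiff]
      field_simp
      ring_nf
      rw [show Complex.I ^ 3 = Complex.I ^ 2 * Complex.I by ring, Complex.I_sq]
      ring
    have e2 : z + -1 + 1 / 2 = (z + 1 / 2) - 1 := by ring
    have e3 : Complex.Gamma (z + 1 / 2) = (z - 1 / 2) * Complex.Gamma ((z + 1 / 2) - 1) := by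
      rw [← show (z + 1 / 2) - 1 = z - 1 / 2 by ring,
        ← Complex.Gamma_add_one _ (by rwa [show (z + 1 / 2) - 1 = z - 1 / 2 by ring]),
        sub_add_cancel]
    rw [e1, e2, e3, Complex.cpow_sub _ _ hℏ', Complex.cpow_one]
    generalize z - 1 / 2 = u at h1
    field_simp
  · by_cases h' : n' + 1 = n ∧ m = j
    · simp only [if_neg h, if_pos h', add_zero]
      obtain ⟨rfl, rfl⟩ := h'
      have e1 : Complex.I * (a (n' + 1) m - a (n' + 1 - 1) k - Complex.I * ℏ / 2) =
          ℏ * (z + 1 / 2) := by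
        rw [hzdef, scaledDiff, Nat.add_sub_cancel]
        field_simp
        ring_nf
        rw [show Complex.I ^ 3 = Complex.I ^ 2 * Complex.I by ring, Complex.I_sq]
        ring
      have h1 : z + 1 / 2 ≠ 0 := by simpa using hz 0
      rw [e1, show z - -1 + 1 / 2 = (z + 1 / 2) + 1 by ring, Complex.Gamma_add_one _ h1,
        Complex.cpow_add _ _ hℏ', Complex.cpow_one]
      ring
    · simp only [if_neg h, if_neg h', add_zero, sub_zero, one_mul]

theorem whittakerVec_shiftEntry {ℏ : ℝ} (hℏ : 0 < ℏ) {N n j : ℕ} (hn : n ∈ Finset.Ico 1 N)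
    (hj : j < n) {a : GZArray} (ha : Regular ℏ N a) :
    (∏ r ∈ Finset.range (n + 1), (a n j - a (n + 1) r - Complex.I * ℏ / 2)) *
      whittakerVec ℏ N (shiftEntry a n j (-(Complex.I * ℏ))) =
    -(∏ k ∈ Finset.range (n - 1), (a n j - (a (n - 1) k + Complex.I * ℏ / 2))) *
      whittakerVec ℏ N a := by
  have hℏ' : (ℏ : ℂ) ≠ 0 := by exact_mod_cast hℏ.ne'
  have hI0 := Complex.I_ne_zero
  have hexp : Complex.exp (-((Real.pi : ℂ) / ℏ) * ∑ n' ∈ Finset.Ico 1 N,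
      ((n' : ℂ) - 1) * rowSum (shiftEntry a n j (-(Complex.I * ℏ))) n') =
      (-1) ^ (n - 1) * Complex.exp (-((Real.pi : ℂ) / ℏ) * ∑ n' ∈ Finset.Ico 1 N,
        ((n' : ℂ) - 1) * rowSum a n') := by
    have h1 : ∀ n' : ℕ, ((n' : ℂ) - 1) * rowSum (shiftEntry a n j (-(Complex.I * ℏ))) n' =
        ((n' : ℂ) - 1) * rowSum a n' +
          if n' = n then ((n' : ℂ) - 1) * -(Complex.I * ℏ) else 0 := by
      intro n'
      rw [rowSum_shiftEntry a hj]
      split_ifs <;> ring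
    rw [Finset.sum_congr rfl fun n' _ => h1 n', Finset.sum_add_distrib,
      Finset.sum_ite_eq' (Finset.Ico 1 N), if_pos hn, mul_add, Complex.exp_add, mul_comm]
    congr 1
    rw [← Complex.exp_pi_mul_I, ← Complex.exp_nat_mul, Nat.cast_sub (Finset.mem_Ico.1 hn).1]
    congr 1
    push_cast
    field_simp
  have hne : ∏ r ∈ Finset.range (n + 1), (a n j - a (n + 1) r - Complex.I * ℏ / 2) ≠ 0 := by
    refine Finset.prod_ne_zero_iff.2 fun r hr h0 => ?_
    refine ha.2 n hn j (Finset.mem_range.2 hj) r hr 1 ?_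
    rw [scaledDiff, show a n j - a (n + 1) r = Complex.I * ℏ / 2 by linear_combination h0]
    push_cast
    field_simp
    norm_num
  rw [whittakerVec, whittakerVec, prod_sFactor_shiftEntry hℏ hn hj ha, hexp,
    Finset.prod_inv_distrib, Finset.prod_mul_distrib, Finset.prod_mul_distrib, Finset.prod_const,
    Finset.prod_const, Finset.card_range, Finset.card_range]
  have hk : ∏ k ∈ Finset.range (n - 1), (a n j - (a (n - 1) k + Complex.I * ℏ / 2)) =
      ∏ k ∈ Finset.range (n - 1), (a n j - a (n - 1) k - Complex.I * ℏ / 2) :=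
    Finset.prod_congr rfl fun k _ => by ring
  rw [hk]
  obtain ⟨q, rfl⟩ : ∃ q, n = q + 1 := ⟨n - 1, by have := (Finset.mem_Ico.1 hn).1; omega⟩
  have hsign : (-1 : ℂ) ^ q * (((-Complex.I) ^ (q + 1 + 1))⁻¹ * Complex.I ^ q) = -1 := by
    have hsq : (-1 : ℂ) ^ q * (-1) ^ q = 1 := by rw [← mul_pow]; simp
    rw [pow_add, pow_add, neg_pow Complex.I q, pow_one]
    have hI2 : -Complex.I * -Complex.I = -1 := by rw [neg_mul_neg, Complex.I_mul_I]
    rw [mul_assoc _ (-Complex.I), hI2]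
    have : Complex.I ^ q ≠ 0 := pow_ne_zero _ hI0
    have h3 : ((-1 : ℂ)) ^ q ≠ 0 := pow_ne_zero _ (by norm_num)
    field_simp
  rw [Nat.add_sub_cancel]
  have hX := mul_inv_cancel₀ hne
  rw [mul_inv]
  generalize ((-Complex.I) ^ (q + 1 + 1))⁻¹ = Y at hsign ⊢
  generalize (∏ r ∈ Finset.range (q + 1 + 1),
    (a (q + 1) j - a (q + 1 + 1) r - Complex.I * ℏ / 2))⁻¹ = X' at hX ⊢
  generalize Complex.exp (-((Real.pi : ℂ) / ℏ) * ∑ n' ∈ Finset.Ico 1 N,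
    ((n' : ℂ) - 1) * rowSum a n') = E
  generalize ∏ n' ∈ Finset.Ico 1 N, sFactor ℏ n' a = S
  linear_combination (∏ k ∈ Finset.range q, (a (q + 1) j - a q k - Complex.I * ℏ / 2)) * E * S *
    (hsign + (-1) ^ q * (Y * Complex.I ^ q) * hX)

theorem opRaise_whittakerVec {ℏ : ℝ} (hℏ : 0 < ℏ) {N n : ℕ} (hn : n ∈ Finset.Ico 1 N)
    {a : GZArray} (ha : Regular ℏ N a) :
    opRaise ℏ n (whittakerVec ℏ N) a = -(Complex.I / ℏ) * whittakerVec ℏ N a := by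
  have h := sum_prod_sub_div_prod (Finset.mem_Ico.1 hn).1 (ha.injOn hn)
    (fun r => a (n - 1) r + Complex.I * ℏ / 2)
  rw [opRaise, ← one_div_I_mul hℏ, neg_mul, ← mul_neg]
  congr 1
  have h2 : ∑ j ∈ Finset.range n, (∏ r ∈ Finset.range (n + 1),
        (a n j - a (n + 1) r - Complex.I * ℏ / 2)) /
      (∏ s ∈ (Finset.range n).erase j, (a n j - a n s)) *
      whittakerVec ℏ N (shiftEntry a n j (-(Complex.I * ℏ))) =
      ∑ j ∈ Finset.range n, -((∏ m ∈ Finset.range (n - 1),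
        (a n j - (a (n - 1) m + Complex.I * ℏ / 2))) /
        ∏ i ∈ (Finset.range n).erase j, (a n j - a n i)) * whittakerVec ℏ N a := by
    refine Finset.sum_congr rfl fun j hj => ?_
    rw [div_mul_eq_mul_div, whittakerVec_shiftEntry hℏ hn (Finset.mem_range.1 hj) ha]
    ring
  rw [h2, ← Finset.sum_mul, Finset.sum_neg_distrib, h]
  ring


end TodaGZ

end

open TodaGZ in
theorem theorem5p1 (N : ℕ) (hN : 1 ≤ N) (ℏ : ℝ) (hℏ : 0 < ℏ) :
    -- `w_N` and `w'_N` are Whittaker vectors of the Gelfand-Zetlin representation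
    (∀ n ∈ Finset.Ico 1 N, ∀ a : GZArray, Regular ℏ N a →
      opRaise ℏ n (whittakerVec ℏ N) a = -(Complex.I / ℏ) * whittakerVec ℏ N a ∧
      opLower ℏ n dualWhittakerVec a = -(Complex.I / ℏ) * dualWhittakerVec a) ∧
    -- the matrix element converges absolutely and gives the integral over real arrays
    (∀ (γ x : Fin N → ℝ),
      MeasureTheory.Integrable
        (pairingIntegrand ℏ N γ dualWhittakerVec (cartanTorus ℏ N x (whittakerVec ℏ N))) ∧
      MeasureTheory.Integrable (fun t : Low ℝ N => realIntegrand ℏ N x (realArray N γ t)) ∧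
      rhoFactor N x *
          pairing ℏ N γ dualWhittakerVec (cartanTorus ℏ N x (whittakerVec ℏ N)) =
        (-(2 * Real.pi * ℏ : ℝ) : ℂ) ^ (N.choose 3) *
          (rhoFactor N x * ∫ t : Low ℝ N, realIntegrand ℏ N x (realArray N γ t))) ∧
    -- the analytic continuation in `γ_N` and its Mellin-Barnes integral
    ∃ Ψ : (Fin N → ℂ) → (Fin N → ℝ) → ℂ,
      (∀ x, Differentiable ℂ (fun γ => Ψ γ x)) ∧
      (∀ (γ x : Fin N → ℝ), Ψ (fun j => (γ j : ℂ)) x =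
        rhoFactor N x * ∫ t : Low ℝ N, realIntegrand ℏ N x (realArray N γ t)) ∧
      (∀ (γ : Fin N → ℂ) (x : Fin N → ℝ) (c : Low ℝ N), AdmissibleHeights N γ c →
        MeasureTheory.Integrable (fun t : Low ℝ N => mbIntegrand ℏ N x (lineArray N γ c t)) ∧
        Ψ γ x = ∫ t : Low ℝ N, mbIntegrand ℏ N x (lineArray N γ c t)) ∧
      -- the wave function of the open Toda chain
      (∀ γ : Fin N → ℂ, ContDiff ℝ ((⊤ : ℕ∞) : WithTop ℕ∞) (Ψ γ) ∧
        ∀ (lam : ℂ) (x : Fin N → ℝ),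
          todaA ℏ N lam (Ψ γ) N le_rfl x = (∏ j, (lam - γ j)) * Ψ γ x) := by
  refine ⟨fun n hn a ha => ⟨opRaise_whittakerVec hℏ hn ha, opLower_dualWhittakerVec hℏ hn ha⟩,
    ?_, waveFunction ℏ N, differentiable_waveFunction hℏ, ?_, ?_, fun γ => ⟨?_, ?_⟩⟩
  · intro γ x
    have hadm : AdmissibleHeights N (fun j => (γ j : ℂ)) (linearHeights N 0 (ℏ / 2)) :=
      admissibleHeights_linearHeights (half_pos hℏ) (by simp)
    have hmb := integrable_integrand hℏ (inDomain_of_admissibleHeights hℏ hadm 0)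
      (polyFun_diffProduct ℏ N) x
    simp only [← mbIntegrand_lineArray, mbIntegrand_lineArray_eq_realIntegrand γ _ hℏ] at hmb
    have hreal : MeasureTheory.Integrable
        fun t : Low ℝ N => realIntegrand ℏ N x (realArray N γ t) := by
      have hne : rhoFactor N x ≠ 0 := Complex.exp_ne_zero _
      simpa [hne] using hmb.const_mul (rhoFactor N x)⁻¹
    have hpair : pairingIntegrand ℏ N γ dualWhittakerVec
        (cartanTorus ℏ N x (whittakerVec ℏ N)) = fun t =>
        (-(2 * Real.pi * ℏ : ℝ) : ℂ) ^ (N.choose 3) * realIntegrand ℏ N x (realArray N γ t) :=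
      funext fun t => pairingIntegrand_eq γ t hℏ x
    refine ⟨?_, hreal, ?_⟩
    · rw [hpair]
      exact hreal.const_mul _
    · rw [pairing, hpair, MeasureTheory.integral_const_mul]
      ring
  · intro γ x
    rw [waveFunction_eq hℏ (admissibleHeights_linearHeights (b := 0) (half_pos hℏ) (by simp)) x,
      lineIntegral, ← MeasureTheory.integral_const_mul]
    simp only [← mbIntegrand_lineArray, mbIntegrand_lineArray_eq_realIntegrand γ _ hℏ]
  · intro γ x c hc
    rw [waveFunction_eq hℏ hc x, lineIntegral]
    rw [funext fun t => mbIntegrand_lineArray ℏ γ c t x]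
    exact ⟨integrable_integrand hℏ (inDomain_of_admissibleHeights hℏ hc 0)
      (polyFun_diffProduct ℏ N) x, rfl⟩
  · exact contDiff_lineIntegral hℏ (inDomain_of_admissibleHeights hℏ
      (admissibleHeights_linearHeights one_pos (im_le_norm γ)) 0) (polyFun_diffProduct ℏ N)
  · exact fun lam x => waveFunction_todaA hℏ γ lam x
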